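/- Let $\Sigma$ be a smooth complete fan in $\mathbb{R}^n$ with lattice $\mathbb{Z}^n$, let $A$ be the set of primitive generators of its rays, let $X$ be the toric variety of $\Sigma$ over $\mathbb{C}$, and for $\alpha\in A$ let $D_\alpha$ be the corresponding toric prime divisor. Let $\omega$ be a toric Kähler form on $(\mathbb{C}^*)^n$ (invariant under the compact torus and Kähler for the standard complex structure) with a moment map $\mu\colon(\mathbb{C}^*)^n\to\mathbb{R}^n$ (convention $\iota_X\omega=-dH$) that is onto, and let $W_\Sigma=\sum_{\alpha\in A}c_\alpha z^\alpha$ with all $c_\alpha\in\mathbb{C}^*$. A *monomial division* for $W_\Sigma$ and $\mu$ consists of closed sets $C_\alpha\subset\mathbb{R}^n$ ($\alpha\in A$) that cover the complement of a compact set and for which there are constants $k_\alpha>0$ such that for every $z\in(\mathbb{C}^*)^n$ the maximum $\max_{\alpha\in A}|c_\alpha z^\alpha|^{k_\alpha}$ is achieved by some $\alpha$ with $\mu(z)\in C_\alpha$. The star of $\alpha$ is the union of the cones of $\Sigma$ containing $\alpha$. Let $\{C_\alpha\}$ be a monomial division that is *adapted to* $\Sigma$: for each $\alpha$, $\mu$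 maps the complement of a compact subset of $\mu^{-1}(C_\alpha)$ into the interior of the star of $\alpha$. Assume moreover that near infinity it is contained in a combinatorial division: there is $\varepsilon>0$ such that, for each $\alpha$, every $x\in C_\alpha$ outside of a compact set lies in the star of $\alpha$ and makes an angle at least $\varepsilon$ with every cone of $\Sigma$ not containing $\alpha$. A *monomially admissible Lagrangian section* is the image $L$ of a smooth section of $\mu$ that is Lagrangian for $\omega$ and such that, for each $\alpha$, $\arg(c_\alpha z^\alpha)=0$ at the points of $L\cap\mu^{-1}(C_\alpha)$ outside of a compact set. Two such sections $L,L'$ are *Hamiltonian isotopic* if there is a smooth Hamiltonian isotopy $(\phi_t)_{t\in[0,1]}$ of $(\mathbb{C}^*)^n$ with $\phi_1(L)=L'$ such that every $\phi_t(L)$ is a monomially admissible Lagrangian section, with compact sets that can be chosen independently of $t$. For a continuous lift $\theta\colon\mathbb{R}^n\to\mathbb{R}^n$ of the arguments of $z_1,\dots,z_n$ along $L$, a function $\nu_L\colon A\to\mathbb{Z}$ is defined by $$2\pi\,\nu_L(\alpha)=\alpha\cdot\theta(x)+\operatorname{Arg}(c_\alpha)\qquad\text{for all }x\in C_\alpha\text{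 outside of a compact set}$$ (so $\nu_L(\alpha)=\frac1{2\pi}\alpha\cdot\theta$ if the $c_\alpha$ are positive; $\operatorname{Arg}$ is the principal argument). Then: 1. Hamiltonian isotopy is an equivalence relation on the monomially admissible Lagrangian sections. Every such section $L$ has a function $\nu_L$, and the functions $\nu_L$ obtained from the various lifts of $L$ form exactly one class modulo the functions $\alpha\mapsto m\cdot\alpha$, $m\in\mathbb{Z}^n$. 2. The rule $[L]\mapsto\mathcal{O}\big(\sum_{\alpha\in A}-\nu_L(\alpha)D_\alpha\big)$ is a well-defined bijection from the set of Hamiltonian isotopy classes of monomially admissible Lagrangian sections to $\operatorname{Pic}(X)$. 3. A *twisting Hamiltonian* for $D=\sum n_\alpha D_\alpha$ is a function $H=h\circ\mu$ with $h\colon\mathbb{R}^n\to\mathbb{R}$ smooth and $\nabla h\cdot\alpha=-2\pi n_\alpha$ on each $C_\alpha$ outside of a compact set. The flow of every twisting Hamiltonian exists for times in $[0,1]$, its time-$1$ map takes monomially admissible Lagrangian sections to such sections, and these time-$1$ maps define an action of the additive group of all twisting Hamiltonians on the set of Hamiltonian isotopy classes. Under the bijection of 2, a twisting Hamiltonian for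 $D$ acts as $(\cdot)\otimes\mathcal{O}(D)$. -/

import Mathlib

open scoped TensorProduct

noncomputable section

/-! ### Smooth complete fans -/

/-- The vector of `ℝⁿ` underlying a lattice point. -/
def latticeVec {n : ℕ} (α : Fin n → ℤ) : EuclideanSpace ℝ (Fin n) :=
  WithLp.toLp 2 (fun i => (α i : ℝ))

/-- The cone of `ℝⁿ` generated by a finite set of lattice vectors. -/
def coneOf {n : ℕ} (σ : Finset (Fin n → ℤ)) : Set (EuclideanSpace ℝ (Fin n)) :=
  {x | ∃ a : (Fin n → ℤ) → ℝ, (∀ α, 0 ≤ a α) ∧ x = ∑ α ∈ σ, a α • latticeVec α}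

/-- A smooth complete fan in `ℝⁿ` with lattice `ℤⁿ`. Every cone of a smooth fan is generated by
part of a `ℤ`-basis of the lattice, and it is recorded by that set of primitive generators; its
faces are then the cones generated by the subsets. -/
structure SmoothCompleteFan (n : ℕ) where
  /-- the cones, each given by its set of primitive generators -/
  cones : Finset (Finset (Fin n → ℤ))
  smooth : ∀ σ ∈ cones, ∃ b : Module.Basis (Fin n) ℤ (Fin n → ℤ),
    (σ : Set (Fin n → ℤ)) ⊆ Set.range b
  face_mem : ∀ σ ∈ cones, ∀ τ ⊆ σ, τ ∈ cones
  inter : ∀ σ ∈ cones, ∀ τ ∈ cones, coneOf σ ∩ coneOf τ ⊆ coneOf (σ ∩ τ)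
  complete : ∀ x : EuclideanSpace ℝ (Fin n), ∃ σ ∈ cones, x ∈ coneOf σ

namespace SmoothCompleteFan

variable {n : ℕ} (F : SmoothCompleteFan n)

/-- The cones of the fan, ordered by the face relation. -/
abbrev Cone : Type := {σ : Finset (Fin n → ℤ) // σ ∈ F.cones}

/-- The rays of the fan, each given by its primitive generator. -/
abbrev Ray : Type := {α : Fin n → ℤ // {α} ∈ F.cones}

/-- A toric divisor `∑ D α • D_α`. -/
abbrev ToricDivisor : Type := F.Ray → ℤ

/-- The star of a ray: the union of the cones of the fan that contain the ray. -/
def star (α : F.Ray) : Set (EuclideanSpace ℝ (Fin n)) :=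
  {x | ∃ σ ∈ F.cones, α.1 ∈ σ ∧ x ∈ coneOf σ}

/-- The region slightly inside the star of `α`: the points of the star that make an angle at
least `ε` with every cone of the fan not containing `α`. -/
def combinatorialRegion (ε : ℝ) (α : F.Ray) : Set (EuclideanSpace ℝ (Fin n)) :=
  {x | x ∈ F.star α ∧ ∀ τ ∈ F.cones, α.1 ∉ τ → ∀ y ∈ coneOf τ, y ≠ 0 →
    ε ≤ InnerProductGeometry.angle x y}

theorem ray_mem (σ : F.Cone) {α : Fin n → ℤ} (h : α ∈ σ.1) : {α} ∈ F.cones :=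
  F.face_mem σ.1 σ.2 {α} (by simpa using h)

/-! ### The toric variety and its line bundles

The toric variety `X` of the fan over `ℂ` is glued from the affine charts `U_σ = Spec ℂ[σ^∨ ∩ M]`,
`M = ℤⁿ`, where `U_τ ⊆ U_σ` is an open subscheme if `τ` is a face of `σ`, and
`U_σ ∩ U_τ = U_{σ ∩ τ}`. -/

theorem exists_of_coeff_mul_ne_zero {f g : AddMonoidAlgebra ℂ (Fin n → ℤ)} {m : Fin n → ℤ}
    (h : (f * g).coeff m ≠ 0) :
    ∃ p q : Fin n → ℤ, f.coeff p ≠ 0 ∧ g.coeff q ≠ 0 ∧ p + q = m := by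
  classical
  by_contra hcon
  push Not at hcon
  apply h
  rw [AddMonoidAlgebra.coeff_mul]
  refine Finset.sum_eq_zero fun p hp => Finset.sum_eq_zero fun q hq => ?_
  exact if_neg (hcon p q (Finsupp.mem_support_iff.mp hp) (Finsupp.mem_support_iff.mp hq))

theorem eq_of_coeff_single_ne_zero {p m : Fin n → ℤ} {a : ℂ}
    (h : (AddMonoidAlgebra.single p a).coeff m ≠ 0) : m = p := by
  classical
  rw [AddMonoidAlgebra.coeff_single, Finsupp.single_apply] at h
  by_contra hne
  exact h (if_neg (fun e => hne e.symm))

/-- The coordinate ring `ℂ[σ^∨ ∩ M]` of `U_σ`, inside the ring `ℂ[M]` of Laurent polynomials. -/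
def coordRing (σ : F.Cone) : Subalgebra ℂ (AddMonoidAlgebra ℂ (Fin n → ℤ)) where
  carrier := {f | ∀ m : Fin n → ℤ, f.coeff m ≠ 0 → ∀ α ∈ σ.1, 0 ≤ m ⬝ᵥ α}
  mul_mem' := by
    intro f g hf hg m hm α hα
    obtain ⟨p, q, hp, hq, rfl⟩ := exists_of_coeff_mul_ne_zero hm
    rw [add_dotProduct]
    exact add_nonneg (hf p hp α hα) (hg q hq α hα)
  add_mem' := by
    intro f g hf hg m hm α hα
    by_cases h : f.coeff m = 0
    · refine hg m (fun h' => hm ?_) α hα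
      simp [h, h']
    · exact hf m h α hα
  algebraMap_mem' := by
    intro r m hm α hα
    rw [show algebraMap ℂ (AddMonoidAlgebra ℂ (Fin n → ℤ)) r = AddMonoidAlgebra.single 0 r from rfl]
      at hm
    rw [eq_of_coeff_single_ne_zero hm]
    simp

variable {F} in
theorem coordRing_le {τ σ : F.Cone} (h : τ ≤ σ) : F.coordRing σ ≤ F.coordRing τ :=
  fun _ hf m hm α hα => hf m hm α (h hα)

variable {F} in
/-- Restriction of functions from `U_σ` to `U_τ`, for a face `τ` of `σ`. -/
def restrict {τ σ : F.Cone} (h : τ ≤ σ) : F.coordRing σ →+* F.coordRing τ :=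
  (Subalgebra.inclusion (coordRing_le h)).toRingHom

/-- A line bundle (invertible sheaf) on the toric variety `X` of the fan, as its modules of
sections over the charts `U_σ` with their restriction maps. The section modules are invertible,
and the restriction maps exhibit the sheaf on `U_τ` as the restriction of the sheaf on `U_σ`:
the induced map `ℂ[U_τ] ⊗ sec σ → sec τ` is surjective, and then it is bijective, as a
surjection between invertible modules. -/
structure LineBundle where
  sec : F.Cone → Type
  [addCommGroup : ∀ σ, AddCommGroup (sec σ)]
  [module : ∀ σ, Module (F.coordRing σ) (sec σ)]
  [invertible : ∀ σ, Module.Invertible (F.coordRing σ) (sec σ)]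
  res : ∀ {τ σ : F.Cone} (h : τ ≤ σ), sec σ →ₛₗ[restrict h] sec τ
  res_self : ∀ (σ : F.Cone) (x : sec σ), res (le_refl σ) x = x
  res_res : ∀ {ρ τ σ : F.Cone} (h₁ : ρ ≤ τ) (h₂ : τ ≤ σ) (x : sec σ),
    res h₁ (res h₂ x) = res (h₁.trans h₂) x
  span_res : ∀ {τ σ : F.Cone} (h : τ ≤ σ),
    Submodule.span (F.coordRing τ) (Set.range (res h)) = ⊤

attribute [instance] LineBundle.addCommGroup LineBundle.module LineBundle.invertible

namespace LineBundle

variable {F}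

/-- Two line bundles are isomorphic if there are linear isomorphisms of their sections over all
charts that commute with restriction. -/
def IsIso (L L' : F.LineBundle) : Prop :=
  ∃ e : ∀ σ : F.Cone, L.sec σ ≃ₗ[F.coordRing σ] L'.sec σ,
    ∀ {τ σ : F.Cone} (h : τ ≤ σ) (x : L.sec σ), e τ (L.res h x) = L'.res h (e σ x)

theorem isIso_equivalence : Equivalence (IsIso (F := F)) where
  refl L := ⟨fun σ => LinearEquiv.refl _ _, fun _ _ => rfl⟩
  symm := by
    rintro L L' ⟨e, he⟩
    refine ⟨fun σ => (e σ).symm, fun {τ σ} h x => ?_⟩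
    rw [LinearEquiv.symm_apply_eq, he, LinearEquiv.apply_symm_apply]
  trans := by
    rintro L L' L'' ⟨e, he⟩ ⟨e', he'⟩
    refine ⟨fun σ => (e σ).trans (e' σ), fun {τ σ} h x => ?_⟩
    simp [he, he']

instance isoSetoid : Setoid F.LineBundle := ⟨IsIso, isIso_equivalence⟩

/-- The tensor product of two line bundles. -/
def tensor (L L' : F.LineBundle) : F.LineBundle where
  sec σ := L.sec σ ⊗[F.coordRing σ] L'.sec σ
  res h := TensorProduct.map (L.res h) (L'.res h)
  res_self σ x := by
    induction x using TensorProduct.induction_on with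
    | zero => simp
    | tmul a b => simp [L.res_self, L'.res_self]
    | add a b ha hb => rw [map_add, ha, hb]
  res_res h₁ h₂ x := by
    induction x using TensorProduct.induction_on with
    | zero => simp
    | tmul a b => simp [L.res_res, L'.res_res]
    | add a b ha hb => rw [map_add, map_add, ha, hb, map_add]
  span_res {τ σ} h := by
    rw [eq_top_iff, ← TensorProduct.map₂_mk_top_top_eq_top, ← L.span_res h, ← L'.span_res h,
      Submodule.map₂_span_span]
    refine Submodule.span_mono ?_
    rintro _ ⟨_, ⟨a, rfl⟩, _, ⟨b, rfl⟩, rfl⟩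
    exact ⟨a ⊗ₜ b, rfl⟩

end LineBundle

/-- The Picard group of `X`: isomorphism classes of line bundles, with the tensor product. -/
def Pic : Type 1 := Quotient (LineBundle.isoSetoid (F := F))

instance : Mul F.Pic where
  mul := Quotient.map₂ LineBundle.tensor (by
    rintro L₁ L₁' ⟨e₁, h₁⟩ L₂ L₂' ⟨e₂, h₂⟩
    refine ⟨fun σ => TensorProduct.congr (e₁ σ) (e₂ σ), fun {τ σ} h => ?_⟩
    have key : ∀ x : L₁.sec σ ⊗[F.coordRing σ] L₂.sec σ,
        TensorProduct.congr (e₁ τ) (e₂ τ) (TensorProduct.map (L₁.res h) (L₂.res h) x)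
          = TensorProduct.map (L₁'.res h) (L₂'.res h) (TensorProduct.congr (e₁ σ) (e₂ σ) x) := by
      intro x
      induction x using TensorProduct.induction_on with
      | zero => simp only [map_zero]
      | tmul a b => simp only [TensorProduct.map_tmul, TensorProduct.congr_tmul, h₁, h₂]
      | add a b ha hb => simp only [map_add, ha, hb]
    exact key)

/-- The sections of `O(D)` over `U_σ`: the Laurent polynomials `f` with `div f + D ≥ 0` on `U_σ`,
that is, those in which only monomials `m` with `⟨m, α⟩ ≥ - D α` for all rays `α` of `σ` occur. -/
def divisorSections (D : F.ToricDivisor) (σ : F.Cone) :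
    Submodule (F.coordRing σ) (AddMonoidAlgebra ℂ (Fin n → ℤ)) where
  carrier := {f | ∀ m : Fin n → ℤ, f.coeff m ≠ 0 →
    ∀ (α : Fin n → ℤ) (hα : α ∈ σ.1), - D ⟨α, F.ray_mem σ hα⟩ ≤ m ⬝ᵥ α}
  zero_mem' := fun m hm => absurd (by simp) hm
  add_mem' := by
    intro f g hf hg m hm α hα
    by_cases h : f.coeff m = 0
    · refine hg m (fun h' => hm ?_) α hα
      simp [h, h']
    · exact hf m h α hα
  smul_mem' := by
    intro r f hf m hm α hα
    obtain ⟨p, q, hp, hq, rfl⟩ := exists_of_coeff_mul_ne_zero hm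
    rw [add_dotProduct]
    have h₁ := r.2 p hp α hα
    have h₂ := hf q hq α hα
    linarith

theorem exists_character (D : F.ToricDivisor) (σ : F.Cone) :
    ∃ m : Fin n → ℤ, ∀ (α : Fin n → ℤ) (hα : α ∈ σ.1),
      m ⬝ᵥ α = - D ⟨α, F.ray_mem σ hα⟩ := by
  classical
  obtain ⟨b, hb⟩ := F.smooth σ.1 σ.2
  let w : (Fin n → ℤ) → ℤ := fun α => if h : {α} ∈ F.cones then - D ⟨α, h⟩ else 0
  let l : (Fin n → ℤ) →ₗ[ℤ] ℤ := b.constr ℤ (fun i => w (b i))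
  refine ⟨fun j => l (Pi.single j 1), fun α hα => ?_⟩
  obtain ⟨i, hi⟩ := hb hα
  have h₁ : (fun j => l (Pi.single j 1)) ⬝ᵥ α = l α := by
    have h₂ : α = ∑ j, α j • (Pi.single j 1 : Fin n → ℤ) := by
      ext k
      simp [Finset.sum_apply, Pi.single_apply]
    conv_rhs => rw [h₂]
    simp only [dotProduct, map_sum, map_smul, smul_eq_mul, mul_comm]
  have h₃ : l α = w α := by
    rw [← hi]
    exact b.constr_basis ℤ _ i
  rw [h₁, h₃]
  exact dif_pos (F.ray_mem σ hα)

theorem single_mul_mem (D D' : F.ToricDivisor) (σ : F.Cone) (m : Fin n → ℤ)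
    (hm : ∀ (α : Fin n → ℤ) (hα : α ∈ σ.1),
      m ⬝ᵥ α = D' ⟨α, F.ray_mem σ hα⟩ - D ⟨α, F.ray_mem σ hα⟩)
    {f : AddMonoidAlgebra ℂ (Fin n → ℤ)} (hf : f ∈ F.divisorSections D' σ) :
    AddMonoidAlgebra.single m 1 * f ∈ F.divisorSections D σ := by
  intro m' hm' α hα
  obtain ⟨p, q, hp, hq, rfl⟩ := exists_of_coeff_mul_ne_zero hm'
  rw [eq_of_coeff_single_ne_zero hp, add_dotProduct, hm α hα]
  have := hf q hq α hα
  linarith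

theorem mem_divisorSections_zero (σ : F.Cone) (f : AddMonoidAlgebra ℂ (Fin n → ℤ)) :
    f ∈ F.divisorSections 0 σ ↔ f ∈ F.coordRing σ :=
  ⟨fun h m hm α hα => by simpa using h m hm α hα, fun h m hm α hα => by simpa using h m hm α hα⟩

theorem single_mul_single_neg (m : Fin n → ℤ) (f : AddMonoidAlgebra ℂ (Fin n → ℤ)) :
    AddMonoidAlgebra.single m 1 * (AddMonoidAlgebra.single (-m) 1 * f) = f := by
  rw [← mul_assoc, AddMonoidAlgebra.single_mul_single, add_neg_cancel, one_mul,
    ← AddMonoidAlgebra.one_def, one_mul]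

/-- Over each chart, `O(D)` is trivialized by a monomial. -/
def divisorTrivialization (D : F.ToricDivisor) (σ : F.Cone) (m : Fin n → ℤ)
    (hm : ∀ (α : Fin n → ℤ) (hα : α ∈ σ.1), m ⬝ᵥ α = - D ⟨α, F.ray_mem σ hα⟩) :
    F.coordRing σ ≃ₗ[F.coordRing σ] F.divisorSections D σ where
  toFun f := ⟨AddMonoidAlgebra.single m 1 * f.1,
    F.single_mul_mem D 0 σ m (by simpa using hm) ((F.mem_divisorSections_zero σ _).2 f.2)⟩
  invFun g := ⟨AddMonoidAlgebra.single (-m) 1 * g.1,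
    (F.mem_divisorSections_zero σ _).1
      (F.single_mul_mem 0 D σ (-m) (by simpa [neg_dotProduct, neg_eq_iff_eq_neg] using hm) g.2)⟩
  map_add' f g := Subtype.ext (mul_add _ _ _)
  map_smul' r f := Subtype.ext (mul_left_comm _ _ _)
  left_inv f := Subtype.ext (by simpa using single_mul_single_neg (-m) f.1)
  right_inv g := Subtype.ext (single_mul_single_neg m g.1)

/-- The line bundle `O(D)` of a toric divisor. -/
def lineBundleOf (D : F.ToricDivisor) : F.LineBundle where
  sec σ := F.divisorSections D σ
  invertible σ :=
    Module.Invertible.congr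
      (F.divisorTrivialization D σ _ (F.exists_character D σ).choose_spec)
  res {τ σ} h :=
    { toFun := fun f => ⟨f.1, fun m hm α hα => f.2 m hm α (h hα)⟩
      map_add' := fun _ _ => rfl
      map_smul' := fun _ _ => rfl }
  res_self _ _ := rfl
  res_res _ _ _ := rfl
  span_res {τ σ} h := by
    obtain ⟨m, hm⟩ := F.exists_character D σ
    rw [eq_top_iff]
    rintro g -
    have hmτ : ∀ (α : Fin n → ℤ) (hα : α ∈ τ.1), m ⬝ᵥ α = - D ⟨α, F.ray_mem τ hα⟩ :=
      fun α hα => hm α (h hα)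
    obtain ⟨f, rfl⟩ := (F.divisorTrivialization D τ m hmτ).surjective g
    have : F.divisorTrivialization D τ m hmτ f
        = f • F.divisorTrivialization D τ m hmτ 1 := by
      rw [← map_smul, smul_eq_mul, mul_one]
    rw [this]
    refine Submodule.smul_mem _ _ (Submodule.subset_span ?_)
    exact ⟨F.divisorTrivialization D σ m hm 1, rfl⟩

/-- The class of `O(D)` in the Picard group. -/
def classO (D : F.ToricDivisor) : F.Pic := Quotient.mk _ (F.lineBundleOf D)

end SmoothCompleteFan

/-! ### Toric Kähler forms and moment maps on `(ℂ^*)ⁿ` -/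

/-- The torus `(ℂ^*)ⁿ`. -/
def torus (n : ℕ) : Set (Fin n → ℂ) := {z | ∀ i, z i ≠ 0}

/-- The generator `∂/∂θ_j` of the rotation of the `j`-th coordinate. -/
def rotationField {n : ℕ} (j : Fin n) (z : Fin n → ℂ) : Fin n → ℂ :=
  Pi.single j (Complex.I * z j)

/-- A toric Kähler form on `(ℂ^*)ⁿ`: a smooth closed real `2`-form that is invariant under the
compact torus, is of type `(1,1)` and is positive for the standard complex structure. Only its
values on the open subset `(ℂ^*)ⁿ` of `ℂⁿ` matter. -/
structure IsToricKahlerForm {n : ℕ}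
    (ω : (Fin n → ℂ) → (Fin n → ℂ) [⋀^Fin 2]→L[ℝ] ℝ) : Prop where
  smooth : ContDiffOn ℝ (⊤ : ℕ∞) ω (torus n)
  closed : ∀ z ∈ torus n, extDeriv ω z = 0
  invariant : ∀ z ∈ torus n, ∀ t : Fin n → ℂ, (∀ i, ‖t i‖ = 1) → ∀ v w : Fin n → ℂ,
    ω (t * z) ![t * v, t * w] = ω z ![v, w]
  compatible : ∀ z ∈ torus n, ∀ v w : Fin n → ℂ,
    ω z ![Complex.I • v, Complex.I • w] = ω z ![v, w]
  positive : ∀ z ∈ torus n, ∀ v : Fin n → ℂ, v ≠ 0 → 0 < ω z ![v, Complex.I • v]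

/-- A moment map for the compact torus action: it is invariant, and its `j`-th component is a
Hamiltonian for the rotation of the `j`-th coordinate, with the convention
`ι_X ω = - dH`. -/
structure IsMomentMap {n : ℕ} (ω : (Fin n → ℂ) → (Fin n → ℂ) [⋀^Fin 2]→L[ℝ] ℝ)
    (μ : (Fin n → ℂ) → EuclideanSpace ℝ (Fin n)) : Prop where
  smooth : ContDiffOn ℝ (⊤ : ℕ∞) μ (torus n)
  invariant : ∀ z ∈ torus n, ∀ t : Fin n → ℂ, (∀ i, ‖t i‖ = 1) → μ (t * z) = μ z
  hamiltonian : ∀ z ∈ torus n, ∀ (j : Fin n) (v : Fin n → ℂ),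
    ω z ![rotationField j z, v] = - (fderiv ℝ μ z v) j

/-! ### Monomial divisions -/

/-- The Laurent monomial `z^α`. -/
def monomial {n : ℕ} (α : Fin n → ℤ) (z : Fin n → ℂ) : ℂ := ∏ i, z i ^ α i

/-- The sets `C α` form a monomial division for `W = ∑ c α z^α` and `μ`. -/
structure IsMonomialDivision {n : ℕ} (F : SmoothCompleteFan n) (c : F.Ray → ℂ)
    (μ : (Fin n → ℂ) → EuclideanSpace ℝ (Fin n))
    (C : F.Ray → Set (EuclideanSpace ℝ (Fin n))) : Prop where
  closed : ∀ α, IsClosed (C α)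
  cover : ∃ K, IsCompact K ∧ ∀ x, x ∉ K → ∃ α, x ∈ C α
  max_mem : ∃ k : F.Ray → ℝ, (∀ α, 0 < k α) ∧ ∀ z ∈ torus n, ∃ α, μ z ∈ C α ∧
    ∀ β, ‖c β * monomial β.1 z‖ ^ k β ≤ ‖c α * monomial α.1 z‖ ^ k α

/-- The division is adapted to the fan: for each ray `α`, the moment map image of the complement
of a compact subset of `μ⁻¹(C α)` lies in the interior of the star of `α`. -/
def IsAdapted {n : ℕ} (F : SmoothCompleteFan n)
    (μ : (Fin n → ℂ) → EuclideanSpace ℝ (Fin n))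
    (C : F.Ray → Set (EuclideanSpace ℝ (Fin n))) : Prop :=
  ∀ α, ∃ K ⊆ torus n, IsCompact K ∧
    ∀ z ∈ torus n, z ∉ K → μ z ∈ C α → μ z ∈ interior (F.star α)

/-- Near infinity, the division is contained in a combinatorial division. -/
def IsEventuallyCombinatorial {n : ℕ} (F : SmoothCompleteFan n)
    (C : F.Ray → Set (EuclideanSpace ℝ (Fin n))) : Prop :=
  ∃ ε > 0, ∀ α, ∃ K, IsCompact K ∧ ∀ x ∈ C α, x ∉ K → x ∈ F.combinatorialRegion ε α

/-! ### Monomially admissible Lagrangian sections and Hamiltonian isotopies -/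

/-- `L` is a Lagrangian section of the moment map: the image of a smooth section `s` of `μ` with
`s^* ω = 0`. -/
def IsLagrangianSection {n : ℕ} (ω : (Fin n → ℂ) → (Fin n → ℂ) [⋀^Fin 2]→L[ℝ] ℝ)
    (μ : (Fin n → ℂ) → EuclideanSpace ℝ (Fin n)) (L : Set (Fin n → ℂ)) : Prop :=
  ∃ s : EuclideanSpace ℝ (Fin n) → (Fin n → ℂ), ContDiff ℝ (⊤ : ℕ∞) s ∧
    (∀ x, s x ∈ torus n ∧ μ (s x) = x) ∧ L = Set.range s ∧
    ∀ x v w, ω (s x) ![fderiv ℝ s x v, fderiv ℝ s x w] = 0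

/-- The argument of `c z^α` is zero at the points of `L` over `C` outside of `K`. -/
def AdmissibleOutside {n : ℕ} (μ : (Fin n → ℂ) → EuclideanSpace ℝ (Fin n)) (c : ℂ)
    (α : Fin n → ℤ) (C : Set (EuclideanSpace ℝ (Fin n))) (K L : Set (Fin n → ℂ)) : Prop :=
  ∀ z ∈ L, z ∉ K → μ z ∈ C → (c * monomial α z).arg = 0

/-- A monomially admissible Lagrangian section: over each `μ⁻¹(C α)`, the argument of `c α z^α`
restricted to it is zero outside of a compact set. -/
structure AdmissibleSection {n : ℕ} (F : SmoothCompleteFan n) (c : F.Ray → ℂ)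
    (ω : (Fin n → ℂ) → (Fin n → ℂ) [⋀^Fin 2]→L[ℝ] ℝ)
    (μ : (Fin n → ℂ) → EuclideanSpace ℝ (Fin n))
    (C : F.Ray → Set (EuclideanSpace ℝ (Fin n))) where
  carrier : Set (Fin n → ℂ)
  isSection : IsLagrangianSection ω μ carrier
  admissible : ∀ α, ∃ K ⊆ torus n, IsCompact K ∧ AdmissibleOutside μ (c α) α.1 (C α) K carrier

/-- `φ` is the flow, for times in `[0,1]`, of the time-dependent Hamiltonian `H` on `(ℂ^*)ⁿ`:
a smooth family of diffeomorphisms of `(ℂ^*)ⁿ` starting at the identity, whose velocity `X` at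
each time satisfies `ι_X ω = - dH`. -/
structure IsHamiltonianFlow {n : ℕ} (ω : (Fin n → ℂ) → (Fin n → ℂ) [⋀^Fin 2]→L[ℝ] ℝ)
    (H : ℝ → (Fin n → ℂ) → ℝ) (φ : ℝ → (Fin n → ℂ) → (Fin n → ℂ)) : Prop where
  smooth_hamiltonian :
    ContDiffOn ℝ (⊤ : ℕ∞) (Function.uncurry H) (Set.Icc (0 : ℝ) 1 ×ˢ torus n)
  smooth : ContDiffOn ℝ (⊤ : ℕ∞) (Function.uncurry φ) (Set.Icc (0 : ℝ) 1 ×ˢ torus n)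
  mapsTo : ∀ t ∈ Set.Icc (0 : ℝ) 1, Set.MapsTo (φ t) (torus n) (torus n)
  inverse : ∃ ψ : ℝ → (Fin n → ℂ) → (Fin n → ℂ),
    ContDiffOn ℝ (⊤ : ℕ∞) (Function.uncurry ψ) (Set.Icc (0 : ℝ) 1 ×ˢ torus n) ∧
    ∀ t ∈ Set.Icc (0 : ℝ) 1, Set.MapsTo (ψ t) (torus n) (torus n) ∧
      Set.InvOn (ψ t) (φ t) (torus n) (torus n)
  zero : ∀ z ∈ torus n, φ 0 z = z
  velocity : ∀ t ∈ Set.Icc (0 : ℝ) 1, ∀ z ∈ torus n, ∃ X : Fin n → ℂ,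
    HasDerivWithinAt (fun s => φ s z) X (Set.Icc 0 1) t ∧
    ∀ v : Fin n → ℂ, ω (φ t z) ![X, v] = - fderiv ℝ (H t) (φ t z) v

section Classes

variable {n : ℕ} {F : SmoothCompleteFan n} {c : F.Ray → ℂ}
  {ω : (Fin n → ℂ) → (Fin n → ℂ) [⋀^Fin 2]→L[ℝ] ℝ}
  {μ : (Fin n → ℂ) → EuclideanSpace ℝ (Fin n)}
  {C : F.Ray → Set (EuclideanSpace ℝ (Fin n))}

/-- Two monomially admissible Lagrangian sections are Hamiltonian isotopic if a Hamiltonian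
isotopy takes one to the other through Lagrangian sections that are monomially admissible,
outside of a compact set that does not depend on the time. -/
def HamiltonianIsotopic (L L' : AdmissibleSection F c ω μ C) : Prop :=
  ∃ (H : ℝ → (Fin n → ℂ) → ℝ) (φ : ℝ → (Fin n → ℂ) → (Fin n → ℂ)),
    IsHamiltonianFlow ω H φ ∧
    (∀ t ∈ Set.Icc (0 : ℝ) 1, IsLagrangianSection ω μ (φ t '' L.carrier)) ∧
    (∀ α, ∃ K ⊆ torus n, IsCompact K ∧ ∀ t ∈ Set.Icc (0 : ℝ) 1,
      AdmissibleOutside μ (c α) α.1 (C α) K (φ t '' L.carrier)) ∧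
    φ 1 '' L.carrier = L'.carrier

/-- `ν` is a function `ν_L : A → ℤ` of the section `L`: for some lift `θ` of `L`, that is, some
continuous choice of the arguments of the coordinates along `L`, the lifted argument of `c α z^α`
is `2π ν α` over the part of `C α` near infinity. -/
def IsSupportFunction (L : AdmissibleSection F c ω μ C) (ν : F.Ray → ℤ) : Prop :=
  ∃ θ : EuclideanSpace ℝ (Fin n) → (Fin n → ℝ), Continuous θ ∧
    (∀ z ∈ L.carrier, ∀ j, z j = ‖z j‖ * Complex.exp (θ (μ z) j * Complex.I)) ∧
    ∀ α : F.Ray, ∃ K, IsCompact K ∧ ∀ x ∈ C α, x ∉ K →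
      ∑ j, (α.1 j : ℝ) * θ x j + (c α).arg = 2 * Real.pi * ν α

end Classes

/-- The Hamiltonian isotopy classes of monomially admissible Lagrangian sections. -/
def IsotopyClass {n : ℕ} (F : SmoothCompleteFan n) (c : F.Ray → ℂ)
    (ω : (Fin n → ℂ) → (Fin n → ℂ) [⋀^Fin 2]→L[ℝ] ℝ)
    (μ : (Fin n → ℂ) → EuclideanSpace ℝ (Fin n))
    (C : F.Ray → Set (EuclideanSpace ℝ (Fin n))) : Type :=
  Quot (HamiltonianIsotopic (F := F) (c := c) (ω := ω) (μ := μ) (C := C))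

/-! ### Twisting Hamiltonians -/

/-- `h`, a function of the moment map coordinates, is a twisting Hamiltonian for the divisor
`∑ D α • D_α`: it is smooth and `∇h · α = - 2π D α` on `C α` outside of a compact set. -/
def IsTwisting {n : ℕ} {F : SmoothCompleteFan n} (C : F.Ray → Set (EuclideanSpace ℝ (Fin n)))
    (D : F.ToricDivisor) (h : EuclideanSpace ℝ (Fin n) → ℝ) : Prop :=
  ContDiff ℝ (⊤ : ℕ∞) h ∧ ∀ α : F.Ray, ∃ K, IsCompact K ∧ ∀ x ∈ C α, x ∉ K →
    fderiv ℝ h x (latticeVec α.1) = - (2 * Real.pi * D α)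

/-- The group, under addition, of all twisting Hamiltonians. -/
def twistingGroup {n : ℕ} {F : SmoothCompleteFan n}
    (C : F.Ray → Set (EuclideanSpace ℝ (Fin n))) :
    AddSubgroup (EuclideanSpace ℝ (Fin n) → ℝ) where
  carrier := {h | ∃ D : F.ToricDivisor, IsTwisting C D h}
  zero_mem' := ⟨0, contDiff_const, fun α => ⟨∅, isCompact_empty, fun x _ _ => by
    rw [show (0 : EuclideanSpace ℝ (Fin n) → ℝ) = fun _ => (0 : ℝ) from rfl]; simp⟩⟩
  add_mem' := by
    rintro h h' ⟨D, hs, hD⟩ ⟨D', hs', hD'⟩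
    refine ⟨D + D', hs.add hs', fun α => ?_⟩
    obtain ⟨K, hK, hx⟩ := hD α
    obtain ⟨K', hK', hx'⟩ := hD' α
    refine ⟨K ∪ K', hK.union hK', fun x hxC hxK => ?_⟩
    rw [Set.mem_union, not_or] at hxK
    rw [fderiv_add (hs.differentiable (by simp) x) (hs'.differentiable (by simp) x),
      add_apply, hx x hxC hxK.1, hx' x hxC hxK.2, Pi.add_apply]
    push_cast
    ring
  neg_mem' := by
    rintro h ⟨D, hs, hD⟩
    refine ⟨-D, hs.neg, fun α => ?_⟩
    obtain ⟨K, hK, hx⟩ := hD α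
    refine ⟨K, hK, fun x hxC hxK => ?_⟩
    rw [fderiv_neg, neg_apply, hx x hxC hxK, Pi.neg_apply]
    push_cast
    ring

end

/-!
A surjective moment map can serve as the radial coordinate on the torus: in logarithmic coordinates
its derivative is positive definite, so that it is a diffeomorphism on the positive real points, and
the absolute values of the coordinates are smooth functions `r` of `μ`
(`IsMomentMap.exists_radius`). A section
of `μ` is therefore `x ↦ r x * exp (i θ x)` with angles `θ`, and the pull-back of the form to it is
`∑ dx_j ∧ dθ_j`. So the section is Lagrangian exactly if `∑ θ_j dx_j` is closed
(`IsRadius.isLagrangianSection_iff`), and then it is the differential of a function by the Poincaré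
lemma. A function `h` of `μ` flows by adding `t ∇h` to the angles, and only so
(`IsHamiltonianFlow.eq_fibreRotation`).

Admissibility says that over the part of `C α` near infinity the angle of `c_α z^α` is an integer
number of full turns. That part may be disconnected, and then the integer could depend on the
component. It does not, because of closedness (`IsSeparatedDivision.exists_rayAngle_eq`): inside a
full-dimensional cone, the derivative of the angle of `α` in the direction `β` equals that of the
angle of `β` in the direction `α`, and the latter vanishes in the interior of `C β`. The lemma
`eq_of_partial_derivatives_vanish` derives from such vanishing that the angle is constant. This
gives the support function, and two lifts of the angles differ by a constant in `2πℤⁿ`.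

In a Hamiltonian isotopy, the value of the support function at `α` can be read off at one far point
of the ray of `α`, where it is an integer that depends continuously on the time
(`HamiltonianIsotopic.exists_isSupportFunction`). Conversely, linear interpolation of the angles of
two sections with the same support function is a Hamiltonian isotopy
(`IsRadius.hamiltonianIsotopic`). Every function on the rays occurs as a support function: take
the function that is linear on each cone and has the required slopes along the rays. Near a far
point of `C α` only cones that contain `α` occur, and on them the slope in the direction of `α` is
constant, so that the convolution with a bump function has the prescribed derivative there
(`IsSeparatedDivision.exists_contDiff_fderiv_eq`).

On the algebraic side, the coordinate ring of a chart is factorial, so line bundles on the charts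
are trivial, the transition functions are monomials up to constants, and the Picard group is the
group of toric divisors modulo characters (`SmoothCompleteFan.classO_surjective`,
`SmoothCompleteFan.classO_eq_iff`, `SmoothCompleteFan.classO_add`). Hence both isotopy classes and
line bundles are functions on the rays modulo characters, and a twisting Hamiltonian for `D`
subtracts `D` from the support function.
-/

noncomputable section



/-! ### Laurent polynomials -/

/-- The units of the ring of Laurent polynomials are the nonzero multiples of the monomials:
the product of `f` and `g` has at least two monomials unless both are monomials. -/
theorem exists_eq_single_of_mul_eq_one {n : ℕ} {f g : AddMonoidAlgebra ℂ (Fin n → ℤ)}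
    (h : f * g = 1) : ∃ (m : Fin n → ℤ) (a : ℂ), a ≠ 0 ∧ f = AddMonoidAlgebra.single m a := by
  classical
  have hf : f ≠ 0 := by rintro rfl; simp at h
  have hg : g ≠ 0 := by rintro rfl; simp at h
  have hf' : f.coeff.support.Nonempty := by
    simpa [Finsupp.support_nonempty_iff] using hf
  have hg' : g.coeff.support.Nonempty := by
    simpa [Finsupp.support_nonempty_iff] using hg
  have hcard : ¬ 1 < f.coeff.support.card * g.coeff.support.card := by
    intro hlt
    obtain ⟨p, hp, q, hq, hne, hup, huq⟩ := TwoUniqueSums.uniqueAdd_of_one_lt_card hlt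
    have key : ∀ p ∈ f.coeff.support ×ˢ g.coeff.support,
        UniqueAdd f.coeff.support g.coeff.support p.1 p.2 → p.1 + p.2 = 0 := by
      intro p hp hup
      have h₁ := AddMonoidAlgebra.coeff_mul_add_of_uniqueAdd hup
      rw [Finset.mem_product, Finsupp.mem_support_iff, Finsupp.mem_support_iff] at hp
      rw [h, AddMonoidAlgebra.one_def] at h₁
      refine SmoothCompleteFan.eq_of_coeff_single_ne_zero (a := (1 : ℂ)) ?_
      rw [h₁]
      exact mul_ne_zero hp.1 hp.2
    have e := (key p hp hup).trans (key q hq huq).symm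
    rw [Finset.mem_product] at hq
    exact hne (Prod.ext (hup hq.1 hq.2 e.symm).1.symm (hup hq.1 hq.2 e.symm).2.symm)
  have h1 : f.coeff.support.card = 1 := by
    have := hf'.card_pos
    have := hg'.card_pos
    nlinarith
  obtain ⟨m, a, ha, hm⟩ := Finsupp.card_support_eq_one'.1 h1
  exact ⟨m, a, ha, AddMonoidAlgebra.coeff_injective (by rw [hm]; rfl)⟩

namespace SmoothCompleteFan

variable {n : ℕ} (F : SmoothCompleteFan n)

/-! ### Triviality of line bundles on the charts -/

theorem exists_dual_basis (b : Module.Basis (Fin n) ℤ (Fin n → ℤ)) :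
    ∃ d : Fin n → (Fin n → ℤ), ∀ i j, d i ⬝ᵥ b j = if i = j then 1 else 0 := by
  refine ⟨fun i k => b.repr (Pi.single k 1) i, fun i j => ?_⟩
  have h : b.repr (b j) i = ∑ k, b j k * b.repr (Pi.single k 1) i := by
    conv_lhs => rw [show b j = ∑ k, b j k • (Pi.single k 1 : Fin n → ℤ) by
      ext k; simp [Finset.sum_apply, Pi.single_apply]]
    simp only [map_sum, map_smul, Finsupp.coe_finsetSum, Finset.sum_apply, Finsupp.smul_apply,
      smul_eq_mul]
  rw [b.repr_self, Finsupp.single_apply] at h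
  simp only [dotProduct]
  rw [Finset.sum_congr rfl fun k _ => mul_comm _ _, ← h]
  simp [eq_comm]

theorem eq_zero_of_dotProduct_basis (b : Module.Basis (Fin n) ℤ (Fin n → ℤ)) {m : Fin n → ℤ}
    (h : ∀ j, m ⬝ᵥ b j = 0) : m = 0 := by
  have : ∀ v : Fin n → ℤ, m ⬝ᵥ v = 0 := by
    intro v
    rw [← b.sum_repr v, dotProduct_sum]
    exact Finset.sum_eq_zero fun i _ => by rw [dotProduct_smul, h, smul_zero]
  exact dotProduct_eq_zero_iff.1 this

/-- The coordinate ring of a chart is a localization of a polynomial ring at a monomial,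
hence a unique factorization domain. -/
instance uniqueFactorizationMonoid_coordRing (σ : F.Cone) :
    UniqueFactorizationMonoid (F.coordRing σ) := by
  classical
  obtain ⟨b, hb⟩ := F.smooth σ.1 σ.2
  obtain ⟨d, hd⟩ := exists_dual_basis b
  -- The variables of the polynomial ring are the monomials of the dual basis `d`.
  let g : (Fin n →₀ ℕ) →+ (Fin n → ℤ) :=
    { toFun := fun a => ∑ i, (a i : ℤ) • d i
      map_zero' := by simp
      map_add' := fun a a' => by simp [add_smul, Finset.sum_add_distrib] }
  have hg : ∀ a j, g a ⬝ᵥ b j = a j := by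
    intro a j
    change (∑ i, (a i : ℤ) • d i) ⬝ᵥ b j = a j
    simp_rw [sum_dotProduct, smul_dotProduct, hd]
    simp
  have hg_inj : Function.Injective g := by
    intro a a' h
    ext j
    have := hg a j
    rw [h, hg a' j] at this
    exact_mod_cast this.symm
  have hg_surj : ∀ m : Fin n → ℤ, (∀ j, 0 ≤ m ⬝ᵥ b j) → ∃ a, g a = m := by
    intro m hm
    refine ⟨Finsupp.equivFunOnFinite.symm fun j => (m ⬝ᵥ b j).toNat, ?_⟩
    rw [← sub_eq_zero]
    refine eq_zero_of_dotProduct_basis b fun j => ?_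
    rw [sub_dotProduct, hg]
    simp [hm j]
  let Φ : MvPolynomial (Fin n) ℂ →ₐ[ℂ] AddMonoidAlgebra ℂ (Fin n → ℤ) :=
    AddMonoidAlgebra.mapDomainAlgHom ℂ ℂ g
  have hΦ_inj : Function.Injective Φ := AddMonoidAlgebra.mapDomain_injective hg_inj
  have hΦ_single : ∀ a r, Φ (AddMonoidAlgebra.single a r) = AddMonoidAlgebra.single (g a) r :=
    fun a r => AddMonoidAlgebra.mapDomain_single
  have hΦ_mem : ∀ p, Φ p ∈ F.coordRing σ := by
    intro p
    induction p using AddMonoidAlgebra.induction_linear with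
    | zero => rw [map_zero]; exact zero_mem _
    | add p q hp hq => rw [map_add]; exact add_mem hp hq
    | single a r =>
      rw [hΦ_single]
      intro m hm α hα
      rw [eq_of_coeff_single_ne_zero hm]
      obtain ⟨i, rfl⟩ := hb hα
      rw [hg]
      positivity
  let φ : MvPolynomial (Fin n) ℂ →ₐ[ℂ] F.coordRing σ := Φ.codRestrict _ hΦ_mem
  let : Algebra (MvPolynomial (Fin n) ℂ) (F.coordRing σ) := φ.toRingHom.toAlgebra
  have hφ : ∀ p, ((algebraMap (MvPolynomial (Fin n) ℂ) (F.coordRing σ) p : F.coordRing σ) :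
    AddMonoidAlgebra ℂ (Fin n → ℤ)) = Φ p := fun p => rfl
  -- The monomial to be inverted is the product of the variables dual to the `b j` outside of `σ`.
  let a₀ : Fin n →₀ ℕ := Finsupp.equivFunOnFinite.symm fun j => if b j ∈ σ.1 then 0 else 1
  have ha₀ : ∀ j, g a₀ ⬝ᵥ b j = if b j ∈ σ.1 then 0 else 1 := by
    intro j
    rw [hg]
    simp [a₀]
  let x : MvPolynomial (Fin n) ℂ := AddMonoidAlgebra.single a₀ 1
  have hloc : IsLocalization (Submonoid.powers x) (F.coordRing σ) := by
    refine ⟨?_, ?_, ?_⟩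
    · rintro ⟨_, k, rfl⟩
      simp only [map_pow]
      refine IsUnit.pow _ ?_
      have hinv : AddMonoidAlgebra.single (-g a₀) (1 : ℂ) ∈ F.coordRing σ := by
        intro m hm α hα
        rw [eq_of_coeff_single_ne_zero hm]
        obtain ⟨i, rfl⟩ := hb hα
        rw [neg_dotProduct, ha₀, if_pos hα, neg_zero]
      refine IsUnit.of_mul_eq_one ⟨_, hinv⟩ (Subtype.ext ?_)
      rw [MulMemClass.coe_mul, hφ, hΦ_single, AddMonoidAlgebra.single_mul_single, add_neg_cancel,
        one_mul]
      rfl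
    · intro f
      -- A power of the monomial that beats all the negative exponents of `f`.
      obtain ⟨N, hN⟩ : ∃ N : ℕ, ∀ m ∈ f.1.coeff.support, ∀ j, 0 ≤ m ⬝ᵥ b j + N := by
        refine ⟨∑ m ∈ f.1.coeff.support, ∑ j, (m ⬝ᵥ b j).natAbs, fun m hm j => ?_⟩
        have h₁ : (m ⬝ᵥ b j).natAbs ≤ ∑ j, (m ⬝ᵥ b j).natAbs :=
          Finset.single_le_sum (f := fun j => (m ⬝ᵥ b j).natAbs) (fun _ _ => Nat.zero_le _)
            (Finset.mem_univ j)
        have h₂ := Finset.single_le_sum (f := fun m => ∑ j, (m ⬝ᵥ b j).natAbs)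
          (fun _ _ => Nat.zero_le _) hm
        have h₃ := h₁.trans h₂
        omega
      have hrange : f.1 * AddMonoidAlgebra.single (N • g a₀) 1 ∈ Φ.range := by
        have e : f.1 = f.1.coeff.sum AddMonoidAlgebra.single :=
          (AddMonoidAlgebra.sum_coeff_single f.1).symm
        rw [e, Finsupp.sum, Finset.sum_mul]
        refine sum_mem fun m hm => ?_
        rw [AddMonoidAlgebra.single_mul_single]
        obtain ⟨a, ha⟩ := hg_surj (m + N • g a₀) (by
          intro j
          rw [add_dotProduct, smul_dotProduct, ha₀]
          split_ifs with hj
          · simpa using f.2 m (Finsupp.mem_support_iff.1 hm) _ hj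
          · simpa using hN m hm j)
        exact ⟨AddMonoidAlgebra.single a _, by rw [← ha]; exact hΦ_single _ _⟩
      obtain ⟨p, hp⟩ := hrange
      refine ⟨(p, ⟨x ^ N, N, rfl⟩), Subtype.ext ?_⟩
      rw [MulMemClass.coe_mul, hφ, hφ, map_pow, hΦ_single, AddMonoidAlgebra.single_pow, one_pow]
      exact hp.symm
    · intro p q h
      refine ⟨1, ?_⟩
      have := hΦ_inj (congrArg Subtype.val h)
      rw [this]
  exact UniqueFactorizationMonoid.of_isLocalization (Submonoid.powers x) (F.coordRing σ)

/-- Invertible modules over a unique factorization domain are free. -/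
theorem nonempty_linearEquiv_coordRing (σ : F.Cone) (M : Type) [AddCommGroup M]
    [Module (F.coordRing σ) M] [Module.Invertible (F.coordRing σ) M] :
    Nonempty (M ≃ₗ[F.coordRing σ] F.coordRing σ) := by
  have : IsGCDMonoid (F.coordRing σ) := ⟨UniqueFactorizationMonoid.toGCDMonoid _⟩
  exact Module.Invertible.free_iff_linearEquiv.1 inferInstance

/-! ### The Picard group -/

/-- The cone `{0}`, whose chart is the torus. -/
def zeroCone : F.Cone :=
  ⟨∅, by
    obtain ⟨σ, hσ, -⟩ := F.complete 0
    exact F.face_mem σ hσ ∅ (Finset.empty_subset _)⟩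

theorem zeroCone_le (σ : F.Cone) : F.zeroCone ≤ σ := Finset.empty_subset _

/-- The cone of a ray. -/
def rayCone (α : F.Ray) : F.Cone := ⟨{α.1}, α.2⟩

theorem rayCone_le {α : F.Ray} {σ : F.Cone} (h : α.1 ∈ σ.1) : F.rayCone α ≤ σ :=
  Finset.singleton_subset_iff.2 h

/-- A monomial that is a unit on the chart of a ray has order zero along its divisor. -/
theorem dotProduct_eq_zero_of_isUnit {α : F.Ray} {v : F.coordRing (F.rayCone α)} (hv : IsUnit v)
    {p : Fin n → ℤ} {a : ℂ} (h : v.1 = AddMonoidAlgebra.single p a) : p ⬝ᵥ α.1 = 0 := by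
  obtain ⟨w, hw⟩ := hv.exists_right_inv
  have hw' : v.1 * w.1 = 1 := congrArg Subtype.val hw
  obtain ⟨q, b, hb, hq⟩ := exists_eq_single_of_mul_eq_one ((mul_comm _ _).trans hw')
  rw [h, hq, AddMonoidAlgebra.single_mul_single, AddMonoidAlgebra.one_def] at hw'
  have ha : a ≠ 0 := by
    rintro rfl
    rw [zero_mul, AddMonoidAlgebra.single_zero] at hw'
    exact AddMonoidAlgebra.single_ne_zero.2 one_ne_zero hw'.symm
  have hpq : p + q = 0 := by
    rcases AddMonoidAlgebra.single_inj.1 hw' with h | h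
    · exact h.1
    · exact absurd h.2 one_ne_zero
  have h₁ : 0 ≤ p ⬝ᵥ α.1 := v.2 p (by rw [h]; simpa using ha) α.1 (Finset.mem_singleton_self _)
  have h₂ : 0 ≤ q ⬝ᵥ α.1 := w.2 q (by rw [hq]; simpa using hb) α.1 (Finset.mem_singleton_self _)
  have h₃ : p ⬝ᵥ α.1 + q ⬝ᵥ α.1 = 0 := by rw [← add_dotProduct, hpq, zero_dotProduct]
  omega

/-- Every line bundle is the line bundle of a toric divisor: compared with a trivialization over
the torus, its trivialization over each chart is a unit of the ring of Laurent polynomials, hence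
a monomial. -/
theorem classO_surjective : Function.Surjective F.classO := by
  intro x
  obtain ⟨L, rfl⟩ := Quotient.exists_rep x
  obtain ⟨e⟩ : Nonempty (∀ σ, L.sec σ ≃ₗ[F.coordRing σ] F.coordRing σ) :=
    ⟨fun σ => (F.nonempty_linearEquiv_coordRing σ (L.sec σ)).some⟩
  have hgen : ∀ (σ : F.Cone) (y : L.sec σ), y = e σ y • (e σ).symm 1 := by
    intro σ y
    rw [← map_smul, smul_eq_mul, mul_one, LinearEquiv.symm_apply_apply]
  have hres : ∀ {τ σ : F.Cone} (h : τ ≤ σ) (y : L.sec σ),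
      e τ (L.res h y) = restrict h (e σ y) * e τ (L.res h ((e σ).symm 1)) := by
    intro τ σ h y
    conv_lhs => rw [hgen σ y, LinearMap.map_smulₛₗ, map_smul, smul_eq_mul]
  -- Restrictions of generators are generators.
  have hunit : ∀ {τ σ : F.Cone} (h : τ ≤ σ), IsUnit (e τ (L.res h ((e σ).symm 1))) := by
    intro τ σ h
    set u := e τ (L.res h ((e σ).symm 1)) with hu
    have hspan : ∀ y : L.sec τ, u ∣ e τ y := by
      intro y
      have hy : y ∈ Submodule.span (F.coordRing τ) (Set.range (L.res h)) := by
        rw [L.span_res h]; trivial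
      induction hy using Submodule.span_induction with
      | mem y hy =>
        obtain ⟨z, rfl⟩ := hy
        rw [hres h z]
        exact dvd_mul_left _ _
      | zero => rw [map_zero]; exact dvd_zero _
      | add y z _ _ hy hz => rw [map_add]; exact dvd_add hy hz
      | smul r y _ hy => rw [map_smul, smul_eq_mul]; exact hy.mul_left r
    refine isUnit_of_dvd_one ?_
    simpa using hspan ((e τ).symm 1)
  have hmono : ∀ σ : F.Cone, ∃ (m : Fin n → ℤ) (a : ℂ), a ≠ 0 ∧
      (e F.zeroCone (L.res (F.zeroCone_le σ) ((e σ).symm 1))).1 = AddMonoidAlgebra.single m a := by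
    intro σ
    obtain ⟨w, hw⟩ := (hunit (F.zeroCone_le σ)).exists_right_inv
    exact exists_eq_single_of_mul_eq_one (congrArg Subtype.val hw)
  choose m a ha hm using hmono
  have hval : ∀ (σ : F.Cone) (y : L.sec σ), (e F.zeroCone (L.res (F.zeroCone_le σ) y)).1
      = AddMonoidAlgebra.single (m σ) (a σ) * (e σ y).1 := by
    intro σ y
    rw [hres (F.zeroCone_le σ) y, MulMemClass.coe_mul, hm, mul_comm]
    rfl
  -- On the chart of a ray of `σ`, the generators of both charts differ by a unit, so that the order
  -- of the monomial `m σ` along the divisor of the ray does not depend on `σ`.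
  let D : F.ToricDivisor := fun α => -(m (F.rayCone α) ⬝ᵥ α.1)
  have hD : ∀ (σ : F.Cone) (α : Fin n → ℤ) (hα : α ∈ σ.1),
      m σ ⬝ᵥ α = - D ⟨α, F.ray_mem σ hα⟩ := by
    intro σ α hα
    let α' : F.Ray := ⟨α, F.ray_mem σ hα⟩
    have hle : F.rayCone α' ≤ σ := F.rayCone_le hα
    have h₁ := hval (F.rayCone α') (L.res hle ((e σ).symm 1))
    rw [L.res_res, hm] at h₁
    have h₂ : (e (F.rayCone α') (L.res hle ((e σ).symm 1))).1
        = AddMonoidAlgebra.single (m σ - m (F.rayCone α')) (a σ * (a (F.rayCone α'))⁻¹) := by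
      have h₃ := congrArg
        (AddMonoidAlgebra.single (-m (F.rayCone α')) ((a (F.rayCone α'))⁻¹) * ·) h₁
      simp only [← mul_assoc, AddMonoidAlgebra.single_mul_single] at h₃
      rw [neg_add_cancel, inv_mul_cancel₀ (ha _), ← AddMonoidAlgebra.one_def, one_mul] at h₃
      rw [← h₃, mul_comm, neg_add_eq_sub]
    have h₄ := F.dotProduct_eq_zero_of_isUnit (hunit hle) h₂
    rw [sub_dotProduct, sub_eq_zero] at h₄
    rw [h₄, neg_neg]
  have hsc : ∀ σ, IsUnit (algebraMap ℂ (F.coordRing σ) (a σ)) := fun σ =>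
    (IsUnit.mk0 _ (ha σ)).map _
  let E : ∀ σ : F.Cone, L.sec σ ≃ₗ[F.coordRing σ] F.divisorSections D σ := fun σ =>
    ((e σ).trans (LinearEquiv.smulOfUnit (hsc σ).unit)).trans
      (F.divisorTrivialization D σ (m σ) (hD σ))
  have hE : ∀ (σ : F.Cone) (y : L.sec σ),
      (E σ y).1 = (e F.zeroCone (L.res (F.zeroCone_le σ) y)).1 := by
    intro σ y
    rw [hval]
    change AddMonoidAlgebra.single (m σ) 1 * (AddMonoidAlgebra.single 0 (a σ) * (e σ y).1) = _
    rw [← mul_assoc, AddMonoidAlgebra.single_mul_single, add_zero, one_mul]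
  refine ⟨D, Quotient.sound ?_⟩
  refine Setoid.symm (?_ : LineBundle.IsIso L (F.lineBundleOf D))
  refine ⟨E, fun {τ σ} h y => Subtype.ext ?_⟩
  change (E τ (L.res h y)).1 = (E σ y).1
  rw [hE, hE, L.res_res]

/-- Two toric divisors have isomorphic line bundles exactly if they differ by the divisor of a
monomial. -/
theorem classO_eq_iff {D D' : F.ToricDivisor} :
    F.classO D = F.classO D' ↔ ∃ m : Fin n → ℤ, ∀ α : F.Ray, D' α = D α + m ⬝ᵥ α.1 := by
  constructor
  · intro h
    obtain ⟨e, he⟩ := Quotient.exact h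
    -- Over the torus, the isomorphism is multiplication by a unit.
    have mem₀ : ∀ (D : F.ToricDivisor) f, f ∈ F.divisorSections D F.zeroCone :=
      fun D f m _ α hα => absurd hα (Finset.notMem_empty α)
    let e₀ : F.divisorSections D F.zeroCone ≃ₗ[F.coordRing F.zeroCone]
      F.divisorSections D' F.zeroCone := e F.zeroCone
    set u := (e₀ ⟨1, mem₀ D 1⟩).1 with hu
    have hmul : ∀ f (hf : f ∈ F.divisorSections D F.zeroCone), (e₀ ⟨f, hf⟩).1 = f * u := by
      intro f hf
      have : (⟨f, hf⟩ : F.divisorSections D F.zeroCone)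
          = (⟨f, fun m _ α hα => absurd hα (Finset.notMem_empty α)⟩ : F.coordRing F.zeroCone) •
            ⟨1, mem₀ D 1⟩ := Subtype.ext (mul_one f).symm
      rw [this, map_smul]
      rfl
    have hmul' : ∀ (σ : F.Cone) (f : F.divisorSections D σ),
        ((e σ : F.divisorSections D σ ≃ₗ[F.coordRing σ] F.divisorSections D' σ) f).1
          = f.1 * u := by
      intro σ f
      rw [← hmul f.1 (mem₀ D _)]
      exact (congrArg Subtype.val (he (F.zeroCone_le σ) f)).symm
    obtain ⟨w, hw⟩ := e₀.surjective ⟨1, mem₀ D' 1⟩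
    have hwu : u * w.1 = 1 := by
      rw [mul_comm, ← hmul w.1 w.2]
      exact congrArg Subtype.val hw
    obtain ⟨m, a, ha, hm⟩ := exists_eq_single_of_mul_eq_one hwu
    refine ⟨-m, fun α => ?_⟩
    let ρ := F.rayCone α
    have hαρ : α.1 ∈ ρ.1 := Finset.mem_singleton_self _
    have single_mem : ∀ (D : F.ToricDivisor) (p : Fin n → ℤ), p ⬝ᵥ α.1 = - D α →
        AddMonoidAlgebra.single p 1 ∈ F.divisorSections D ρ := by
      intro D p hp q hq β hβ
      rw [eq_of_coeff_single_ne_zero hq]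
      obtain rfl : β = α.1 := Finset.mem_singleton.1 hβ
      exact hp.ge
    obtain ⟨p, hp⟩ := F.exists_character D ρ
    obtain ⟨q, hq⟩ := F.exists_character D' ρ
    have hp := hp α.1 hαρ
    have hq := hq α.1 hαρ
    -- On the chart of `α`, monomials of least order along `α` go to such, in both directions.
    have h₁ : - D' α ≤ p ⬝ᵥ α.1 + m ⬝ᵥ α.1 := by
      let f : F.divisorSections D ρ := ⟨_, single_mem D p hp⟩
      have hf := ((e ρ : F.divisorSections D ρ ≃ₗ[F.coordRing ρ] F.divisorSections D' ρ) f).2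
        (p + m) (by
          rw [hmul', hm, AddMonoidAlgebra.single_mul_single]
          simpa using ha) α.1 hαρ
      rwa [add_dotProduct] at hf
    have h₂ : - D α ≤ q ⬝ᵥ α.1 - m ⬝ᵥ α.1 := by
      let eρ : F.divisorSections D ρ ≃ₗ[F.coordRing ρ] F.divisorSections D' ρ := e ρ
      obtain ⟨f, hf⟩ := eρ.surjective ⟨_, single_mem D' q hq⟩
      have h₃ : f.1 * u = AddMonoidAlgebra.single q 1 := by
        rw [← hmul']
        exact congrArg Subtype.val hf
      have h₄ : f.1 = AddMonoidAlgebra.single (q - m) a⁻¹ := by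
        have h₅ := congrArg (· * AddMonoidAlgebra.single (-m) a⁻¹) h₃
        simp only [hm, mul_assoc, AddMonoidAlgebra.single_mul_single] at h₅
        rw [add_neg_cancel, mul_inv_cancel₀ ha, ← AddMonoidAlgebra.one_def, mul_one] at h₅
        rw [h₅, one_mul, sub_eq_add_neg]
      have h₆ := f.2 (q - m) (by rw [h₄]; simpa using ha) α.1 hαρ
      rwa [sub_dotProduct] at h₆
    rw [neg_dotProduct]
    have e₁ : - D ⟨α.1, F.ray_mem ρ hαρ⟩ = - D α := rfl
    have e₂ : - D' ⟨α.1, F.ray_mem ρ hαρ⟩ = - D' α := rfl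
    omega
  · rintro ⟨m, hm⟩
    have key : ∀ (D D' : F.ToricDivisor) (m : Fin n → ℤ),
        (∀ α : F.Ray, D' α = D α + m ⬝ᵥ α.1) → ∀ (σ : F.Cone) (α : Fin n → ℤ) (hα : α ∈ σ.1),
          m ⬝ᵥ α = D' ⟨α, F.ray_mem σ hα⟩ - D ⟨α, F.ray_mem σ hα⟩ := by
      intro D D' m hm σ α hα
      rw [hm ⟨α, F.ray_mem σ hα⟩]
      exact (add_sub_cancel_left _ _).symm
    have hm' : ∀ α : F.Ray, D α = D' α + (-m) ⬝ᵥ α.1 := by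
      intro α
      rw [hm, neg_dotProduct, add_neg_cancel_right]
    refine Quotient.sound (?_ : LineBundle.IsIso _ _)
    refine ⟨fun σ =>
      { toFun := fun f => ⟨AddMonoidAlgebra.single (-m) 1 * f.1,
          F.single_mul_mem D' D σ (-m) (key D' D (-m) hm' σ) f.2⟩
        invFun := fun f => ⟨AddMonoidAlgebra.single m 1 * f.1,
          F.single_mul_mem D D' σ m (key D D' m hm σ) f.2⟩
        map_add' := fun f g => Subtype.ext (mul_add _ _ _)
        map_smul' := fun r f => Subtype.ext (mul_left_comm _ _ _)
        left_inv := fun f => Subtype.ext (single_mul_single_neg m f.1)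
        right_inv := fun f => Subtype.ext (by simpa using single_mul_single_neg (-m) f.1) },
      fun {τ σ} h f => rfl⟩

theorem mul_mem_divisorSections {D D' : F.ToricDivisor} {σ : F.Cone}
    {f g : AddMonoidAlgebra ℂ (Fin n → ℤ)} (hf : f ∈ F.divisorSections D σ)
    (hg : g ∈ F.divisorSections D' σ) : f * g ∈ F.divisorSections (D + D') σ := by
  intro m hm α hα
  obtain ⟨p, q, hp, hq, rfl⟩ := exists_of_coeff_mul_ne_zero hm
  rw [add_dotProduct, Pi.add_apply]
  have := hf p hp α hα
  have := hg q hq α hα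
  omega

/-- On each chart, multiplication of Laurent polynomials identifies `O(D) ⊗ O(D')` with `O(D +
D')`. -/
theorem classO_add (D D' : F.ToricDivisor) :
    F.classO (D + D') = F.classO D * F.classO D' := by
  let μ : ∀ σ : F.Cone, F.divisorSections D σ ⊗[F.coordRing σ] F.divisorSections D' σ
      →ₗ[F.coordRing σ] F.divisorSections (D + D') σ := fun σ =>
    TensorProduct.lift (LinearMap.mk₂ (F.coordRing σ)
      (fun f g => ⟨f.1 * g.1, F.mul_mem_divisorSections f.2 g.2⟩)
      (fun f f' g => Subtype.ext (add_mul _ _ _))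
      (fun r f g => Subtype.ext (mul_assoc _ _ _))
      (fun f g g' => Subtype.ext (mul_add _ _ _))
      (fun r f g => Subtype.ext (mul_left_comm _ _ _)))
  have hμ : ∀ σ f g, (μ σ (f ⊗ₜ g)).1 = f.1 * g.1 := fun σ f g => rfl
  have hbij : ∀ σ, Function.Bijective (μ σ) := by
    intro σ
    have : Module.Invertible (F.coordRing σ) (F.divisorSections D σ) :=
      (F.lineBundleOf D).invertible σ
    have : Module.Invertible (F.coordRing σ) (F.divisorSections D' σ) :=
      (F.lineBundleOf D').invertible σ
    have : Module.Invertible (F.coordRing σ) (F.divisorSections (D + D') σ) :=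
      (F.lineBundleOf (D + D')).invertible σ
    refine Module.Invertible.bijective_of_surjective fun h => ?_
    obtain ⟨m, hm⟩ := F.exists_character D σ
    have h₁ : AddMonoidAlgebra.single m 1 ∈ F.divisorSections D σ := by
      intro p hp α hα
      rw [eq_of_coeff_single_ne_zero hp]
      exact (hm α hα).ge
    have h₂ : AddMonoidAlgebra.single (-m) 1 * h.1 ∈ F.divisorSections D' σ := by
      refine F.single_mul_mem D' (D + D') σ (-m) (fun α hα => ?_) h.2
      rw [neg_dotProduct, hm α hα, Pi.add_apply]
      ring
    exact ⟨⟨_, h₁⟩ ⊗ₜ ⟨_, h₂⟩, Subtype.ext (by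
      rw [hμ]; exact single_mul_single_neg m h.1)⟩
  refine Eq.symm (Quotient.sound (?_ : LineBundle.IsIso _ _))
  refine ⟨fun σ => LinearEquiv.ofBijective (μ σ) (hbij σ), fun {τ σ} h x => ?_⟩
  change F.divisorSections D σ ⊗[F.coordRing σ] F.divisorSections D' σ at x
  let r : ∀ D : F.ToricDivisor, F.divisorSections D σ →ₛₗ[restrict h] F.divisorSections D τ :=
    fun D => (F.lineBundleOf D).res h
  have key : μ τ (TensorProduct.map (r D) (r D') x) = r (D + D') (μ σ x) := by
    induction x using TensorProduct.induction_on with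
    | zero => simp only [map_zero]
    | tmul f g => rfl
    | add x y hx hy => simp only [map_add, hx, hy]
  exact key

end SmoothCompleteFan


/-! ### Geometry of the fan -/

theorem latticeVec_apply {n : ℕ} (α : Fin n → ℤ) (i : Fin n) : latticeVec α i = (α i : ℝ) := rfl

theorem sum_intCast_mul_latticeVec {n : ℕ} (m α : Fin n → ℤ) :
    ∑ k, (m k : ℝ) * latticeVec α k = ((m ⬝ᵥ α : ℤ) : ℝ) := by
  simp [latticeVec_apply, dotProduct]

theorem exists_real_basis {n : ℕ} (b : Module.Basis (Fin n) ℤ (Fin n → ℤ)) :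
    ∃ B : Module.Basis (Fin n) ℝ (EuclideanSpace ℝ (Fin n)), ∀ i, B i = latticeVec (b i) := by
  obtain ⟨d, hd⟩ := SmoothCompleteFan.exists_dual_basis b
  have hli : LinearIndependent ℝ (fun i => latticeVec (b i)) := by
    rw [Fintype.linearIndependent_iff]
    intro g hg j
    have h₁ : ∑ k, (d j k : ℝ) * (∑ i, g i • latticeVec (b i)) k = 0 := by
      rw [hg]; simp
    have h₂ : ∀ k, (∑ i, g i • latticeVec (b i)) k = ∑ i, g i * latticeVec (b i) k := by
      intro k; simp
    simp_rw [h₂, Finset.mul_sum] at h₁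
    rw [Finset.sum_comm] at h₁
    have h₃ : ∀ i, ∑ k, (d j k : ℝ) * (g i * latticeVec (b i) k)
        = g i * (if j = i then 1 else 0) := by
      intro i
      rw [show (if j = i then (1 : ℝ) else 0) = ((d j ⬝ᵥ b i : ℤ) : ℝ) by rw [hd]; push_cast; rfl,
        ← sum_intCast_mul_latticeVec, Finset.mul_sum]
      exact Finset.sum_congr rfl fun k _ => by ring
    simpa [h₃] using h₁
  exact ⟨Module.Basis.mk hli (hli.span_eq_top_of_card_eq_finrank' (by simp)).ge,
    fun i => Module.Basis.mk_apply _ _ i⟩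

namespace SmoothCompleteFan

variable {n : ℕ} (F : SmoothCompleteFan n)

instance : Finite F.Ray :=
  Finite.of_injective (β := F.Cone) (fun α => ⟨{α.1}, α.2⟩) fun α β h => Subtype.ext (by
    simpa using h)

theorem mem_coneOf_iff {b : Module.Basis (Fin n) ℤ (Fin n → ℤ)}
    {B : Module.Basis (Fin n) ℝ (EuclideanSpace ℝ (Fin n))} (hB : ∀ i, B i = latticeVec (b i))
    {σ : Finset (Fin n → ℤ)} (hσ : (σ : Set (Fin n → ℤ)) ⊆ Set.range b)
    {x : EuclideanSpace ℝ (Fin n)} :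
    x ∈ coneOf σ ↔ ∀ i, 0 ≤ B.repr x i ∧ (b i ∉ σ → B.repr x i = 0) := by
  classical
  have himage : ∀ f : (Fin n → ℤ) → EuclideanSpace ℝ (Fin n),
      ∑ α ∈ σ, f α = ∑ i, if b i ∈ σ then f (b i) else 0 := by
    intro f
    rw [← Finset.sum_filter]
    refine (Finset.sum_bij (fun i _ => b i) ?_ ?_ ?_ ?_).symm
    · intro i hi; simpa using hi
    · intro i _ j _ h; exact b.injective h
    · intro α hα
      obtain ⟨i, rfl⟩ := hσ hα
      exact ⟨i, by simpa using hα, rfl⟩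
    · intro i _; rfl
  constructor
  · rintro ⟨a, ha, rfl⟩ i
    have : B.repr (∑ α ∈ σ, a α • latticeVec α) i = if b i ∈ σ then a (b i) else 0 := by
      rw [himage]
      have h₁ : ∀ j, (if b j ∈ σ then a (b j) • latticeVec (b j) else 0)
          = (if b j ∈ σ then a (b j) else 0) • B j := by
        intro j; rw [hB]; split_ifs <;> simp
      simp_rw [h₁]
      rw [B.repr_sum_self]
    rw [this]
    split_ifs with h
    · exact ⟨ha _, fun h' => absurd h h'⟩
    · exact ⟨le_rfl, fun _ => rfl⟩
  · intro h
    refine ⟨fun α => if hα : α ∈ Set.range b then B.repr x hα.choose else 0, fun α => ?_, ?_⟩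
    · dsimp only
      split_ifs with hα
      · exact (h _).1
      · exact le_rfl
    · have hch : ∀ i, (if hα : b i ∈ Set.range b then B.repr x hα.choose else 0)
          = B.repr x i := by
        intro i
        have hi : b i ∈ Set.range b := ⟨i, rfl⟩
        rw [dif_pos hi, b.injective hi.choose_spec]
      rw [himage]
      simp_rw [hch]
      conv_lhs => rw [← B.sum_repr x]
      refine Finset.sum_congr rfl fun i _ => ?_
      split_ifs with hi
      · rw [hB]
      · rw [(h i).2 hi, zero_smul]

theorem isClosed_coneOf {σ : Finset (Fin n → ℤ)} (hσ : σ ∈ F.cones) : IsClosed (coneOf σ) := by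
  obtain ⟨b, hb⟩ := F.smooth σ hσ
  obtain ⟨B, hB⟩ := exists_real_basis b
  have h : coneOf σ = ⋂ i, {x | 0 ≤ B.repr x i ∧ (b i ∉ σ → B.repr x i = 0)} := by
    ext x
    rw [mem_coneOf_iff hB hb]
    simp
  have hc : ∀ i, Continuous fun x => B.repr x i := fun i =>
    (B.coord i).continuous_of_finiteDimensional
  rw [h]
  refine isClosed_iInter fun i => ?_
  by_cases hi : b i ∈ σ
  · simpa [hi] using isClosed_le continuous_const (hc i)
  · simp only [hi, not_false_eq_true, forall_const]
    exact (isClosed_le continuous_const (hc i)).inter (isClosed_eq (hc i) continuous_const)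

/-- The full-dimensional cones cover `ℝⁿ`: the other ones have measure zero. -/
theorem exists_full_cone (x : EuclideanSpace ℝ (Fin n)) :
    ∃ σ ∈ F.cones, (∃ b : Module.Basis (Fin n) ℤ (Fin n → ℤ), (σ : Set (Fin n → ℤ)) = Set.range b) ∧
      x ∈ coneOf σ := by
  classical
  let P : Finset (Fin n → ℤ) → Prop := fun σ =>
    ∃ b : Module.Basis (Fin n) ℤ (Fin n → ℤ), (σ : Set (Fin n → ℤ)) = Set.range b
  by_contra hcon
  let U : Set (EuclideanSpace ℝ (Fin n)) := (⋃ σ ∈ F.cones.filter P, coneOf σ)ᶜ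
  have hU : IsOpen U := by
    refine IsClosed.isOpen_compl (self := ?_)
    refine Set.Finite.isClosed_biUnion (Finset.finite_toSet _) fun σ hσ => ?_
    exact F.isClosed_coneOf (Finset.mem_filter.1 hσ).1
  have hx : x ∈ U := by
    intro hx
    simp only [Set.mem_iUnion, Finset.mem_filter, exists_prop] at hx
    obtain ⟨σ, ⟨hσ, hP⟩, hxσ⟩ := hx
    exact hcon ⟨σ, hσ, hP, hxσ⟩
  have hsub : U ⊆ ⋃ σ ∈ F.cones.filter (fun σ => ¬ P σ), coneOf σ := by
    intro y hy
    obtain ⟨σ, hσ, hyσ⟩ := F.complete y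
    simp only [Set.mem_iUnion, Finset.mem_filter, exists_prop]
    refine ⟨σ, ⟨hσ, fun hP => hy ?_⟩, hyσ⟩
    simp only [Set.mem_iUnion, Finset.mem_filter, exists_prop]
    exact ⟨σ, ⟨hσ, hP⟩, hyσ⟩
  have hnull : MeasureTheory.volume (⋃ σ ∈ F.cones.filter (fun σ => ¬ P σ), coneOf σ) = 0 := by
    refine (MeasureTheory.measure_biUnion_null_iff (Finset.countable_toSet _)).2 fun σ hσ => ?_
    obtain ⟨hσ, hP⟩ := Finset.mem_filter.1 hσ
    obtain ⟨b, hb⟩ := F.smooth σ hσ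
    obtain ⟨B, hB⟩ := exists_real_basis b
    obtain ⟨i, hi⟩ : ∃ i, b i ∉ σ := by
      by_contra! h
      exact hP ⟨b, hb.antisymm (by rintro _ ⟨i, rfl⟩; exact h i)⟩
    refine MeasureTheory.measure_mono_null (t := (LinearMap.ker (B.coord i) : Set _)) ?_ ?_
    · intro y hy
      exact ((mem_coneOf_iff hB hb).1 hy i).2 hi
    · refine MeasureTheory.Measure.addHaar_submodule _ _ fun htop => ?_
      have : B i ∈ LinearMap.ker (B.coord i) := by rw [htop]; trivial
      simp at this
  exact (hU.measure_pos MeasureTheory.volume ⟨x, hx⟩).ne'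
    (MeasureTheory.measure_mono_null hsub hnull)

/-! ### Divisions that are eventually contained in a combinatorial division -/

/-- The distance of `x` from a half-line that makes an angle at least `ε` with it. For `ε > π / 2`,
the bound is not sharp. -/
theorem sin_mul_norm_le_norm_sub {x y : EuclideanSpace ℝ (Fin n)} {ε : ℝ} (hε : 0 ≤ ε)
    (h : ε ≤ InnerProductGeometry.angle x y) :
    Real.sin ε * ‖x‖ ≤ ‖x - y‖ := by
  have h₁ : inner ℝ x y ≤ ‖x‖ * ‖y‖ * Real.cos ε := by
    rw [← InnerProductGeometry.cos_angle_mul_norm_mul_norm, mul_comm]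
    exact mul_le_mul_of_nonneg_left
      (Real.cos_le_cos_of_nonneg_of_le_pi hε (InnerProductGeometry.angle_le_pi _ _) h)
      (by positivity)
  have h₂ : ‖x - y‖ ^ 2 = ‖x‖ ^ 2 - 2 * inner ℝ x y + ‖y‖ ^ 2 := norm_sub_sq_real x y
  have h₃ := Real.sin_sq_add_cos_sq ε
  refine le_of_sq_le_sq ?_ (norm_nonneg _)
  nlinarith [sq_nonneg (‖y‖ - ‖x‖ * Real.cos ε)]

end SmoothCompleteFan

/-- A closed cover `C` of the complement of a ball such that each point of `C α` outside of the
ball has at least `δ` times its norm as distance from every cone of the fan not containing `α`. -/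
structure IsSeparatedDivision {n : ℕ} (F : SmoothCompleteFan n)
    (C : F.Ray → Set (EuclideanSpace ℝ (Fin n))) (δ R : ℝ) : Prop where
  δ_pos : 0 < δ
  R_pos : 0 < R
  closed : ∀ α, IsClosed (C α)
  cover : ∀ x, R ≤ ‖x‖ → ∃ α, x ∈ C α
  sep : ∀ α, ∀ x ∈ C α, R ≤ ‖x‖ → ∀ τ ∈ F.cones, α.1 ∉ τ → ∀ y ∈ coneOf τ, δ * ‖x‖ ≤ ‖x - y‖

theorem IsCompact.exists_norm_bound {E : Type*} [SeminormedAddCommGroup E] {K : Set E}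
    (hK : IsCompact K) : ∃ R : ℝ, ∀ x, R ≤ ‖x‖ → x ∉ K := by
  obtain ⟨R, hR⟩ := hK.isBounded.exists_norm_le
  exact ⟨R + 1, fun x hx hxK => by linarith [hR x hxK]⟩

/-- Angles at least `ε` with the cones become distances proportional to the norm. -/
theorem IsEventuallyCombinatorial.exists_isSeparatedDivision {n : ℕ} {F : SmoothCompleteFan n}
    {C : F.Ray → Set (EuclideanSpace ℝ (Fin n))} (h : IsEventuallyCombinatorial F C)
    (hclosed : ∀ α, IsClosed (C α)) (hcover : ∃ K, IsCompact K ∧ ∀ x, x ∉ K → ∃ α, x ∈ C α) :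
    ∃ δ R, IsSeparatedDivision F C δ R := by
  obtain ⟨ε, hε, h⟩ := h
  obtain ⟨K₀, hK₀, hcover⟩ := hcover
  obtain ⟨R₀, hR₀⟩ := hK₀.exists_norm_bound
  choose K hK hC using h
  choose R hR using fun α => (hK α).exists_norm_bound
  obtain ⟨M, hM⟩ := (Set.finite_range R).bddAbove
  have hε₀ : 0 < min ε 1 := lt_min hε one_pos
  refine ⟨Real.sin (min ε 1), max 1 (max R₀ M), ?_, by positivity, hclosed, ?_, ?_⟩
  · exact Real.sin_pos_of_pos_of_lt_pi hε₀
      ((min_le_right _ _).trans_lt (by linarith [Real.pi_gt_three]))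
  · intro x hx
    exact hcover x (hR₀ x (le_trans (le_max_of_le_right (le_max_left _ _)) hx))
  · intro α x hx hxR τ hτ hατ y hy
    have hα : R α ≤ ‖x‖ := (hM ⟨α, rfl⟩).trans
      ((le_max_right _ _).trans ((le_max_right _ _).trans hxR))
    rcases eq_or_ne y 0 with rfl | hy0
    · rw [sub_zero]
      exact mul_le_of_le_one_left (norm_nonneg _) (Real.sin_le_one _)
    · exact SmoothCompleteFan.sin_mul_norm_le_norm_sub hε₀.le
        ((min_le_left _ _).trans ((hC α x hx (hR α x hα)).2 τ hτ hατ y hy hy0))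

namespace IsSeparatedDivision

variable {n : ℕ} {F : SmoothCompleteFan n} {C : F.Ray → Set (EuclideanSpace ℝ (Fin n))} {δ R : ℝ}

/-- Far out, `C α` meets only the cones that contain `α`. -/
theorem mem_of_mem_coneOf (h : IsSeparatedDivision F C δ R) {α : F.Ray}
    {x : EuclideanSpace ℝ (Fin n)} (hx : x ∈ C α) (hxR : R ≤ ‖x‖) {τ : Finset (Fin n → ℤ)}
    (hτ : τ ∈ F.cones) (hxτ : x ∈ coneOf τ) : α.1 ∈ τ := by
  by_contra hα
  have h₁ := h.sep α x hx hxR τ hτ hα x hxτ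
  rw [sub_self, norm_zero] at h₁
  have := mul_pos h.δ_pos (h.R_pos.trans_le hxR)
  linarith

theorem _root_.SmoothCompleteFan.latticeVec_ray_ne_zero (α : F.Ray) : latticeVec α.1 ≠ 0 := by
  obtain ⟨b, hb⟩ := F.smooth _ α.2
  obtain ⟨B, hB⟩ := exists_real_basis b
  obtain ⟨i, hi⟩ := hb (Finset.mem_coe.2 (Finset.mem_singleton_self α.1))
  rw [← hi, ← hB]
  exact B.ne_zero i

theorem _root_.SmoothCompleteFan.smul_latticeVec_mem_coneOf {α : Fin n → ℤ}
    {σ : Finset (Fin n → ℤ)} (hα : α ∈ σ) {a : ℝ} (ha : 0 ≤ a) :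
    a • latticeVec α ∈ coneOf σ := by
  classical
  refine ⟨fun β => if β = α then a else 0, fun β => ?_, ?_⟩
  · dsimp only; split_ifs <;> [exact ha; exact le_rfl]
  · simp [hα]

theorem _root_.SmoothCompleteFan.add_mem_coneOf {σ : Finset (Fin n → ℤ)}
    {x y : EuclideanSpace ℝ (Fin n)} (hx : x ∈ coneOf σ) (hy : y ∈ coneOf σ) :
    x + y ∈ coneOf σ := by
  obtain ⟨a, ha, rfl⟩ := hx
  obtain ⟨a', ha', rfl⟩ := hy
  exact ⟨fun α => a α + a' α, fun α => add_nonneg (ha α) (ha' α), by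
    simp [add_smul, Finset.sum_add_distrib]⟩

/-- Far out, the ray of `α` lies in the interior of `C α`, since only `C α` can contain a point
of this ray. -/
theorem mem_nhds_ray (h : IsSeparatedDivision F C δ R) (α : F.Ray) {a : ℝ} (ha : 0 ≤ a)
    (haR : R < ‖a • latticeVec α.1‖) : C α ∈ nhds (a • latticeVec α.1) := by
  have h₁ : ∀ᶠ x in nhds (a • latticeVec α.1), ∀ β, β ≠ α → x ∉ C β := by
    refine Filter.eventually_all.2 fun β => ?_
    rcases eq_or_ne β α with rfl | hβ
    · exact Filter.Eventually.of_forall fun _ h => absurd rfl h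
    · have : a • latticeVec α.1 ∉ C β := fun hmem => by
        have := h.mem_of_mem_coneOf hmem haR.le α.2
          (SmoothCompleteFan.smul_latticeVec_mem_coneOf (Finset.mem_singleton_self _) ha)
        exact hβ (Subtype.ext (Finset.mem_singleton.1 this))
      filter_upwards [(h.closed β).isOpen_compl.mem_nhds this] with x hx _ using hx
  have h₂ : ∀ᶠ x : EuclideanSpace ℝ (Fin n) in nhds (a • latticeVec α.1), R < ‖x‖ :=
    continuous_norm.continuousAt.eventually (lt_mem_nhds haR)
  filter_upwards [h₁, h₂] with x hx₁ hx₂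
  obtain ⟨β, hβ⟩ := h.cover x hx₂.le
  by_contra hα
  exact hx₁ β (fun e => hα (e ▸ hβ)) hβ

/-- Far points of the ray of `α`. -/
theorem exists_far_ray (α : F.Ray) (R' : ℝ) : ∃ a : ℝ, 0 ≤ a ∧ R' < ‖a • latticeVec α.1‖ := by
  have hα := norm_pos_iff.2 (SmoothCompleteFan.latticeVec_ray_ne_zero α)
  refine ⟨(|R'| + 1) / ‖latticeVec α.1‖, by positivity, ?_⟩
  rw [norm_smul, Real.norm_of_nonneg (by positivity), div_mul_cancel₀ _ hα.ne']
  linarith [le_abs_self R']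

end IsSeparatedDivision


/-! ### Smooth functions with prescribed derivatives along the rays -/

namespace SmoothCompleteFan

variable {n : ℕ} (F : SmoothCompleteFan n)

/-- The function that is linear on each cone of the fan, with given values on the rays. -/
theorem exists_piecewiseLinear (κ : F.Ray → ℝ) :
    ∃ f : EuclideanSpace ℝ (Fin n) → ℝ, Continuous f ∧
      ∀ σ ∈ F.cones, ∀ α : F.Ray, α.1 ∈ σ → ∀ x ∈ coneOf σ, ∀ t : ℝ, 0 ≤ t →
        f (x + t • latticeVec α.1) = f x + t * κ α := by
  classical
  have hlin : ∀ σ ∈ F.cones, ∃ l : EuclideanSpace ℝ (Fin n) →ₗ[ℝ] ℝ,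
      ∀ α : F.Ray, α.1 ∈ σ → l (latticeVec α.1) = κ α := by
    intro σ hσ
    obtain ⟨b, hb⟩ := F.smooth σ hσ
    obtain ⟨B, hB⟩ := exists_real_basis b
    refine ⟨B.constr ℝ fun i => if h : {b i} ∈ F.cones then κ ⟨b i, h⟩ else 0, fun α hα => ?_⟩
    obtain ⟨i, hi⟩ := hb hα
    rw [← hi, ← hB, Module.Basis.constr_basis, dif_pos (by rw [hi]; exact α.2)]
    congr 1
    exact Subtype.ext hi
  choose l hl using hlin
  have hcompat : ∀ σ (hσ : σ ∈ F.cones) τ (hτ : τ ∈ F.cones), ∀ x ∈ coneOf σ, x ∈ coneOf τ →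
      l σ hσ x = l τ hτ x := by
    intro σ hσ τ hτ x hxσ hxτ
    obtain ⟨a, -, rfl⟩ := F.inter σ hσ τ hτ ⟨hxσ, hxτ⟩
    simp only [map_sum, map_smul]
    refine Finset.sum_congr rfl fun α hα => ?_
    rw [Finset.mem_inter] at hα
    rw [hl σ hσ ⟨α, F.ray_mem ⟨σ, hσ⟩ hα.1⟩ hα.1, hl τ hτ ⟨α, F.ray_mem ⟨σ, hσ⟩ hα.1⟩ hα.2]
  choose s hs hxs using F.complete
  let f : EuclideanSpace ℝ (Fin n) → ℝ := fun x => l (s x) (hs x) x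
  have hf : ∀ σ (hσ : σ ∈ F.cones), ∀ x ∈ coneOf σ, f x = l σ hσ x := fun σ hσ x hx =>
    hcompat _ _ σ hσ x (hxs x) hx
  refine ⟨f, ?_, fun σ hσ α hα x hx t ht => ?_⟩
  · refine (locallyFinite_of_finite (fun σ : F.Cone => coneOf σ.1)).continuous ?_
      (fun σ => F.isClosed_coneOf σ.2) fun σ => ?_
    · refine Set.eq_univ_of_forall fun x => ?_
      exact Set.mem_iUnion.2 ⟨⟨s x, hs x⟩, hxs x⟩
    · exact ((l σ.1 σ.2).continuous_of_finiteDimensional.continuousOn).congr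
        fun x hx => hf σ.1 σ.2 x hx
  · rw [hf σ hσ x hx, hf σ hσ _ (add_mem_coneOf hx (smul_latticeVec_mem_coneOf hα ht)), map_add,
      map_smul, hl σ hσ α hα, smul_eq_mul]

end SmoothCompleteFan

open MeasureTheory in
/-- There are smooth functions whose derivative along each ray `α` is any given constant on `C α`
near infinity: mollify the piecewise linear function with these slopes. -/
theorem IsSeparatedDivision.exists_contDiff_fderiv_eq {n : ℕ} {F : SmoothCompleteFan n}
    {C : F.Ray → Set (EuclideanSpace ℝ (Fin n))} {δ R : ℝ} (h : IsSeparatedDivision F C δ R)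
    (κ : F.Ray → ℝ) :
    ∃ f : EuclideanSpace ℝ (Fin n) → ℝ, ContDiff ℝ (⊤ : ℕ∞) f ∧ ∃ R' : ℝ,
      ∀ α, ∀ x ∈ C α, R' ≤ ‖x‖ → fderiv ℝ f x (latticeVec α.1) = κ α := by
  obtain ⟨p, hp, hpκ⟩ := F.exists_piecewiseLinear κ
  let φ : ContDiffBump (0 : EuclideanSpace ℝ (Fin n)) := ⟨1 / 2, 1, by norm_num, by norm_num⟩
  let w : EuclideanSpace ℝ (Fin n) → ℝ := φ.normed volume
  let f : EuclideanSpace ℝ (Fin n) → ℝ :=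
    convolution w p (ContinuousLinearMap.lsmul ℝ ℝ) volume
  have hf : ContDiff ℝ (⊤ : ℕ∞) f :=
    φ.hasCompactSupport_normed.contDiff_convolution_left _ φ.contDiff_normed
      hp.locallyIntegrable
  have hint : ∀ x, Integrable (fun y => w y * p (x - y)) := fun x =>
    (φ.continuous_normed.mul
      (hp.comp (continuous_const.sub continuous_id))).integrable_of_hasCompactSupport
      φ.hasCompactSupport_normed.mul_right
  have hfx : ∀ x, f x = ∫ y, w y * p (x - y) := fun x => rfl
  refine ⟨f, hf, max R (1 / δ), fun α x hx hxR => ?_⟩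
  have hstep : ∀ t : ℝ, 0 ≤ t → f (x + t • latticeVec α.1) = f x + t * κ α := by
    intro t ht
    have h₁ : ∀ y, w y * p (x + t • latticeVec α.1 - y) = w y * p (x - y) + w y * (t * κ α) := by
      intro y
      by_cases hy : y ∈ Function.support w
      · obtain ⟨σ, hσ, hxσ⟩ := F.complete (x - y)
        have hα : α.1 ∈ σ := by
          by_contra hα
          have h₂ := h.sep α x hx ((le_max_left _ _).trans hxR) σ hσ hα _ hxσ
          rw [sub_sub_cancel] at h₂
          have h₃ : 1 / δ ≤ ‖x‖ := (le_max_right _ _).trans hxR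
          rw [div_le_iff₀ h.δ_pos] at h₃
          have h₄ : ‖y‖ < 1 := by
            have : y ∈ Metric.ball (0 : EuclideanSpace ℝ (Fin n)) φ.rOut := by
              rw [← φ.support_normed_eq (μ := volume)]; exact hy
            simpa using this
          linarith
        rw [add_sub_right_comm, hpκ σ hσ α hα _ hxσ t ht, mul_add]
      · rw [Function.notMem_support.1 hy]; simp
    rw [hfx, hfx]
    simp_rw [h₁]
    rw [integral_add (hint x) (φ.integrable_normed.mul_const _), integral_mul_const]
    have : ∫ y, w y = 1 := φ.integral_normed
    rw [this, one_mul]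
  have hd : HasDerivWithinAt (fun t : ℝ => f (x + t • latticeVec α.1))
      (fderiv ℝ f x (latticeVec α.1)) (Set.Ici 0) 0 := by
    refine HasDerivAt.hasDerivWithinAt ?_
    have h₁ : HasFDerivAt f (fderiv ℝ f x) (x + (0 : ℝ) • latticeVec α.1) := by
      rw [zero_smul, add_zero]
      exact (hf.differentiable (by simp) x).hasFDerivAt
    have h₂ : HasDerivAt (fun t : ℝ => x + t • latticeVec α.1) (latticeVec α.1) 0 := by
      simpa using ((hasDerivAt_id (0 : ℝ)).smul_const (latticeVec α.1)).const_add x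
    exact h₁.comp_hasDerivAt (0 : ℝ) h₂
  have hd' : HasDerivWithinAt (fun t : ℝ => f (x + t • latticeVec α.1)) (κ α) (Set.Ici 0) 0 := by
    have : HasDerivWithinAt (fun t : ℝ => f x + t * κ α) (κ α) (Set.Ici 0) 0 := by
      simpa using (((hasDerivAt_id (0 : ℝ)).mul_const (κ α)).const_add (f x)).hasDerivWithinAt
    exact this.congr (fun t ht => hstep t ht) (hstep 0 le_rfl)
  exact (uniqueDiffOn_Ici (0 : ℝ) 0 Set.self_mem_Ici).eq_deriv _ hd hd'


/-! ### Rigidity of functions with locally constant slopes -/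

theorem eventually_eq_of_hasDerivAt_zero {g : ℝ → ℝ} {t : ℝ}
    (h : ∀ᶠ s in nhds t, HasDerivAt g 0 s) : ∀ᶠ s in nhds t, g s = g t := by
  obtain ⟨ε, hε, hb⟩ := Metric.eventually_nhds_iff_ball.1 h
  refine Metric.eventually_nhds_iff_ball.2 ⟨ε, hε, fun s hs => ?_⟩
  exact Metric.isOpen_ball.is_const_of_deriv_eq_zero (convex_ball t ε).isPreconnected
    (fun s hs => (hb s hs).differentiableAt.differentiableWithinAt)
    (fun s hs => (hb s hs).deriv) hs (Metric.mem_ball_self hε)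

theorem eventually_notMem_range_intCast {X : Type*} [TopologicalSpace X] {u : X → ℝ} {p : X}
    (hu : ContinuousAt u p) (hp : u p ∉ Set.range ((↑) : ℤ → ℝ)) :
    ∀ᶠ q in nhds p, u q ∉ Set.range ((↑) : ℤ → ℝ) :=
  hu.eventually (Int.isClosedEmbedding_coe_real.isClosed_range.isOpen_compl.mem_nhds hp)

section Rigidity

variable {E : Type*} [NormedAddCommGroup E] [NormedSpace ℝ E]

theorem hasDerivAt_add_smul (x w : E) (t : ℝ) : HasDerivAt (fun t : ℝ => x + t • w) w t := by
  simpa using ((hasDerivAt_id t).smul_const w).const_add x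

/-- A function on a convex open set whose derivative vanishes wherever its value is not an
integer is constant. -/
theorem eq_of_fderiv_eq_zero_of_notMem_range_intCast {u : E → ℝ} (hu : Differentiable ℝ u)
    {U : Set E} (hU : IsOpen U) (hUc : Convex ℝ U)
    (h : ∀ x ∈ U, u x ∉ Set.range ((↑) : ℤ → ℝ) → fderiv ℝ u x = 0) {x y : E} (hx : x ∈ U)
    (hy : y ∈ U) : u x = u y := by
  by_contra hne
  wlog hlt : u x < u y generalizing x y
  · exact this hy hx (Ne.symm hne) (lt_of_le_of_ne (not_lt.1 hlt) (Ne.symm hne))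
  -- A non-integral value between `u x` and `u y` would be attained on an open and closed subset.
  obtain ⟨c, hcirr, hcx, hcy⟩ := exists_irrational_btwn hlt
  obtain ⟨z, hz, hzc⟩ := hUc.isPreconnected.intermediate_value hx hy
    hu.continuous.continuousOn ⟨hcx.le, hcy.le⟩
  have hc : c ∉ Set.range ((↑) : ℤ → ℝ) := by
    rintro ⟨k, hk⟩
    exact hcirr.ne_int k hk.symm
  let γ : ℝ → E := fun t => z + t • (x - z)
  have hγ : Continuous γ := by fun_prop
  have hγU : ∀ t ∈ Set.Icc (0 : ℝ) 1, γ t ∈ U := by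
    intro t ht
    have := hUc.add_smul_sub_mem hz hx ht
    exact this
  have hsub : Set.Icc (0 : ℝ) 1 ⊆ {t | u (γ t) = c} := by
    refine IsClosed.Icc_subset_of_forall_mem_nhdsWithin ?_ (by simpa [γ] using hzc) ?_
    · exact (isClosed_eq (hu.continuous.comp hγ) continuous_const).inter isClosed_Icc
    · rintro t ⟨ht, ht01⟩
      have hp : u (γ t) ∉ Set.range ((↑) : ℤ → ℝ) := by rw [show u (γ t) = c from ht]; exact hc
      refine mem_nhdsWithin_of_mem_nhds ?_
      have h₁ : ∀ᶠ q in nhds (γ t), fderiv ℝ u q = 0 := by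
        filter_upwards [eventually_notMem_range_intCast hu.continuous.continuousAt hp,
          hU.mem_nhds (hγU t ⟨ht01.1, ht01.2.le⟩)] with q hq hqU using h q hqU hq
      have h₂ : ∀ᶠ s in nhds t, u (γ s) = u (γ t) := by
        refine eventually_eq_of_hasDerivAt_zero (g := fun s => u (γ s)) ?_
        filter_upwards [hγ.continuousAt.eventually h₁] with s hs
        have := (hu (γ s)).hasFDerivAt.comp_hasDerivAt s (hasDerivAt_add_smul z (x - z) s)
        rwa [hs] at this
      filter_upwards [h₂] with s hs using hs.trans ht
  have h₁ : u (γ 1) = c := hsub ⟨zero_le_one, le_rfl⟩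
  simp only [γ, one_smul, add_sub_cancel] at h₁
  exact hcx.ne h₁

variable [FiniteDimensional ℝ E] {ι : Type*} [Fintype ι]

/-- Rigidity in a translated cone, in the coordinates of a basis: closed sets `P i` cover the
cone, the function `u` takes integral values on `P i₀`, it does not depend on the coordinate `i`
in the interior of `P i`, and `P i` stays away from the face where this coordinate vanishes.
Then `u` is constant.

At a point with non-integral value where the largest possible number of partial derivatives is
nonzero, those with `i ∉ S` vanish in a neighbourhood. So do then the mixed second derivatives,
and the other partial derivatives as well as `u` are unchanged if the coordinates `i ∉ S` are
moved close to zero. There, only the sets `P i` with `i ∈ S` are left to cover a neighbourhood, so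
that one of them has interior points there, where the `i`-th partial derivative both vanishes and
does not. -/
theorem eq_of_partial_derivatives_vanish (B : Module.Basis ι ℝ E) (i₀ : ι) {A δ : ℝ}
    (hδ : 0 < δ) {u : E → ℝ} (hu : ContDiff ℝ 2 u) {P : ι → Set E} (hP : ∀ i, IsClosed (P i))
    {U : Set E} (hU : U = {x | A < B.repr x i₀ ∧ ∀ i, i ≠ i₀ → 0 < B.repr x i})
    (hcover : ∀ x ∈ U, ∃ i, x ∈ P i)
    (hsep : ∀ x ∈ U, ∀ i, i ≠ i₀ → x ∈ P i → δ ≤ B.repr x i)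
    (hint : ∀ x ∈ U, x ∈ P i₀ → u x ∈ Set.range ((↑) : ℤ → ℝ))
    (hder : ∀ i, i ≠ i₀ → ∀ x ∈ U, x ∈ interior (P i) → fderiv ℝ u x (B i) = 0)
    {x y : E} (hx : x ∈ U) (hy : y ∈ U) : u x = u y := by
  classical
  have hcoord : ∀ i, Continuous fun x => B.repr x i := fun i =>
    (B.coord i).continuous_of_finiteDimensional
  have hUo : IsOpen U := by
    have : U = {x | A < B.repr x i₀} ∩ ⋂ i, {x | i ≠ i₀ → 0 < B.repr x i} := by
      rw [hU]; ext x; simp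
    rw [this]
    refine (isOpen_lt continuous_const (hcoord i₀)).inter (isOpen_iInter_of_finite fun i => ?_)
    by_cases hi : i = i₀
    · simp [hi]
    · simpa [hi] using isOpen_lt continuous_const (hcoord i)
  have hUc : Convex ℝ U := by
    rw [hU]
    intro x hx y hy a b ha hb hab
    have e : ∀ i, B.repr (a • x + b • y) i = a * B.repr x i + b * B.repr y i := by
      intro i; simp
    obtain rfl | ha := ha.eq_or_lt
    · obtain rfl : b = 1 := by linarith
      simpa using hy
    · refine ⟨?_, fun i hi => ?_⟩
      · rw [e]
        have h₁ := mul_lt_mul_of_pos_left hx.1 ha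
        have h₂ := mul_le_mul_of_nonneg_left hy.1.le hb
        have h₃ : A = a * A + b * A := by rw [← add_mul, hab, one_mul]
        linarith
      · rw [e]
        have h₁ := mul_pos ha (hx.2 i hi)
        have h₂ := mul_nonneg hb (hy.2 i hi).le
        linarith
  have hud : Differentiable ℝ u := hu.differentiable (by norm_num)
  have hud' : ContDiff ℝ 1 (fderiv ℝ u) := hu.fderiv_right (by norm_num)
  have hcont : ∀ v, Continuous fun q => fderiv ℝ u q v := fun v =>
    hud'.continuous.clm_apply continuous_const
  refine eq_of_fderiv_eq_zero_of_notMem_range_intCast hud hUo hUc (fun p hp hpu => ?_) hx hy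
  by_contra hpd
  let S : E → Finset ι := fun q => Finset.univ.filter fun i => fderiv ℝ u q (B i) ≠ 0
  have hS : ∀ q i, i ∈ S q ↔ fderiv ℝ u q (B i) ≠ 0 := fun q i => by simp [S]
  let V : Set E := {q | q ∈ U ∧ u q ∉ Set.range ((↑) : ℤ → ℝ) ∧ fderiv ℝ u q ≠ 0}
  obtain ⟨x, hxV, hmax⟩ : ∃ x ∈ V, ∀ q ∈ V, (S q).card ≤ (S x).card := by
    obtain ⟨_, ⟨x, hxV, rfl⟩, hmax⟩ := Set.exists_max_image ((fun q => (S q).card) '' V) id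
      ((Set.finite_Iic (Fintype.card ι)).subset (by
        rintro _ ⟨q, -, rfl⟩; exact Finset.card_le_univ _)) ⟨_, p, ⟨hp, hpu, hpd⟩, rfl⟩
    exact ⟨x, hxV, fun q hq => hmax _ ⟨q, hq, rfl⟩⟩
  obtain ⟨hxU, hxu, hxd⟩ := hxV
  obtain ⟨j, hj⟩ : (S x).Nonempty := by
    by_contra hemp
    rw [Finset.not_nonempty_iff_eq_empty] at hemp
    refine hxd (ContinuousLinearMap.coe_injective (B.ext fun i => ?_))
    by_contra hi
    have : i ∈ S x := (hS x i).2 hi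
    rw [hemp] at this
    exact Finset.notMem_empty i this
  have hloc : ∀ q ∈ U, u q ∉ Set.range ((↑) : ℤ → ℝ) → S x ⊆ S q →
      ∀ᶠ r in nhds q, r ∈ U ∧ u r ∉ Set.range ((↑) : ℤ → ℝ) ∧ S r = S x := by
    intro q hq hqu hSq
    have h₁ : ∀ᶠ r in nhds q, ∀ i ∈ S x, fderiv ℝ u r (B i) ≠ 0 :=
      (Finset.eventually_all _).2 fun i hi =>
        (hcont (B i)).continuousAt.eventually_ne ((hS q i).1 (hSq hi))
    filter_upwards [h₁, hUo.mem_nhds hq,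
      eventually_notMem_range_intCast hud.continuous.continuousAt hqu] with r h₁ h₂ h₃
    have hsub : S x ⊆ S r := fun i hi => (hS r i).2 (h₁ i hi)
    refine ⟨h₂, h₃, (Finset.eq_of_subset_of_card_le hsub (hmax r ⟨h₂, h₃, fun h => ?_⟩)).symm⟩
    exact h₁ j hj (by rw [h]; rfl)
  let c : ι → ℝ := fun i => if i ∈ S x ∨ i = i₀ then 0 else δ / 2 - B.repr x i
  let w : E := ∑ i, c i • B i
  have hw : ∀ q, S q = S x → fderiv ℝ u q w = 0 := by
    intro q hq
    simp only [w, map_sum, map_smul, smul_eq_mul]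
    refine Finset.sum_eq_zero fun i _ => ?_
    by_cases hi : i ∈ S x
    · simp [c, hi]
    · have : fderiv ℝ u q (B i) = 0 := by
        by_contra hne
        exact hi (hq ▸ (hS q i).2 hne)
      rw [this, mul_zero]
  let γ : ℝ → E := fun t => x + t • w
  have hγ : Continuous γ := by fun_prop
  have hγr : ∀ t i, B.repr (γ t) i = B.repr x i + t * c i := by
    intro t i
    simp only [γ, map_add, map_smul, Finsupp.add_apply, Finsupp.smul_apply, smul_eq_mul, w,
      B.repr_sum_self]
  have hγU : ∀ t ∈ Set.Icc (0 : ℝ) 1, γ t ∈ U := by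
    intro t ht
    have hxU' := hxU
    rw [hU] at hxU' ⊢
    refine ⟨?_, fun i hi => ?_⟩
    · rw [hγr]
      simpa [c] using hxU'.1
    · rw [hγr]
      have hxi := hxU'.2 i hi
      by_cases hiS : i ∈ S x
      · simpa [c, hiS] using hxi
      · simp only [c, hiS, hi, or_self, if_false]
        rcases ht.1.eq_or_lt with h0 | h0
        · rw [← h0]; simpa using hxi
        · have := mul_pos h0 (half_pos hδ)
          nlinarith [mul_nonneg (sub_nonneg.2 ht.2) hxi.le]
  let G : Set ℝ := {t | u (γ t) = u x ∧ ∀ i ∈ S x, fderiv ℝ u (γ t) (B i) = fderiv ℝ u x (B i)}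
  have hG : ∀ t ∈ G, u (γ t) ∉ Set.range ((↑) : ℤ → ℝ) ∧ S x ⊆ S (γ t) := by
    rintro t ⟨ht₁, ht₂⟩
    refine ⟨ht₁ ▸ hxu, fun i hi => (hS _ i).2 ?_⟩
    rw [ht₂ i hi]
    exact (hS x i).1 hi
  have hsub : Set.Icc (0 : ℝ) 1 ⊆ G := by
    refine IsClosed.Icc_subset_of_forall_mem_nhdsWithin ?_ (by simp [G, γ]) ?_
    · refine IsClosed.inter ?_ isClosed_Icc
      have : G = {t | u (γ t) = u x} ∩
          ⋂ i ∈ S x, {t | fderiv ℝ u (γ t) (B i) = fderiv ℝ u x (B i)} := by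
        ext t; simp [G]
      rw [this]
      refine (isClosed_eq (hud.continuous.comp hγ) continuous_const).inter
        (isClosed_biInter fun i _ => isClosed_eq ((hcont (B i)).comp hγ) continuous_const)
    · rintro t ⟨ht, ht01⟩
      refine mem_nhdsWithin_of_mem_nhds ?_
      obtain ⟨h₁, h₂⟩ := hG t ht
      have hgood := eventually_eventually_nhds.2 (hloc _ (hγU t ⟨ht01.1, ht01.2.le⟩) h₁ h₂)
      have hgood' := hγ.continuousAt.eventually hgood
      have e₁ : ∀ᶠ s in nhds t, u (γ s) = u (γ t) := by
        refine eventually_eq_of_hasDerivAt_zero (g := fun s => u (γ s)) ?_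
        filter_upwards [hgood'] with s hs
        have := (hud (γ s)).hasFDerivAt.comp_hasDerivAt s (hasDerivAt_add_smul x w s)
        rwa [hw _ hs.self_of_nhds.2.2] at this
      have e₂ : ∀ i, ∀ᶠ s in nhds t, fderiv ℝ u (γ s) (B i) = fderiv ℝ u (γ t) (B i) := by
        intro i
        refine eventually_eq_of_hasDerivAt_zero (g := fun s => fderiv ℝ u (γ s) (B i)) ?_
        filter_upwards [hgood'] with s hs
        have hd : ∀ q v, HasFDerivAt (fun q => fderiv ℝ u q v)
            ((fderiv ℝ (fderiv ℝ u) q).flip v) q := by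
          intro q v
          exact (ContinuousLinearMap.apply ℝ ℝ v).hasFDerivAt.comp q
            (hud'.differentiable (by norm_num) q).hasFDerivAt
        have h₃ := (hd (γ s) (B i)).comp_hasDerivAt s (hasDerivAt_add_smul x w s)
        have hsymm : fderiv ℝ (fderiv ℝ u) (γ s) w (B i)
            = fderiv ℝ (fderiv ℝ u) (γ s) (B i) w :=
          (hu.contDiffAt.isSymmSndFDerivAt (by simp)).eq w (B i)
        have hzero : fderiv ℝ (fderiv ℝ u) (γ s) (B i) w = 0 := by
          have h₄ : (fun q => fderiv ℝ u q w) =ᶠ[nhds (γ s)] fun _ => 0 := by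
            filter_upwards [hs] with q hq using hw q hq.2.2
          have h₅ := (hd (γ s) w).unique
            ((hasFDerivAt_const (0 : ℝ) (γ s)).congr_of_eventuallyEq h₄)
          exact congrArg (fun l => l (B i)) h₅
        rw [ContinuousLinearMap.flip_apply, hsymm, hzero] at h₃
        exact h₃
      filter_upwards [e₁, (Finset.eventually_all (S x)).2 fun i _ => e₂ i] with s hs₁ hs₂
      exact ⟨hs₁.trans ht.1, fun i hi => (hs₂ i hi).trans (ht.2 i hi)⟩
  have hy₁ : (1 : ℝ) ∈ Set.Icc (0 : ℝ) 1 := ⟨zero_le_one, le_rfl⟩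
  have hsmall : ∀ᶠ q in nhds (γ 1), ∀ i, i ∉ S x → i ≠ i₀ → B.repr q i < δ := by
    refine Filter.eventually_all.2 fun i => ?_
    by_cases hi : i ∈ S x ∨ i = i₀
    · exact Filter.Eventually.of_forall fun q h₁ h₂ => absurd hi (by tauto)
    · have : B.repr (γ 1) i < δ := by
        rw [hγr]
        simp only [c, hi, if_false]
        linarith
      filter_upwards [(hcoord i).continuousAt.eventually (gt_mem_nhds this)] with q hq _ _ using hq
  have hgood : ∀ᶠ q in nhds (γ 1), ∃ i, i ∈ S q ∧ i ≠ i₀ ∧ q ∈ U ∧ q ∈ P i ∧ ∀ k, q ∈ P k →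
      k ∈ S q ∧ k ≠ i₀ := by
    obtain ⟨h₁, h₂⟩ := hG 1 (hsub hy₁)
    filter_upwards [hloc _ (hγU 1 hy₁) h₁ h₂, hsmall] with q ⟨hqU, hqu, hqS⟩ hq
    have key : ∀ k, q ∈ P k → k ∈ S q ∧ k ≠ i₀ := by
      intro k hk
      have hk₀ : k ≠ i₀ := by
        rintro rfl
        exact hqu (hint q hqU hk)
      refine ⟨?_, hk₀⟩
      rw [hqS]
      by_contra hkS
      exact absurd (hsep q hqU k hk₀ hk) (not_le.2 (hq k hkS hk₀))
    obtain ⟨i, hi⟩ := hcover q hqU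
    exact ⟨i, (key i hi).1, (key i hi).2, hqU, hi, key⟩
  -- Near a point lying in the fewest of the closed sets, it lies in the interior of each of them.
  let J : E → Finset ι := fun q => Finset.univ.filter fun i => q ∈ P i
  have hJ : ∀ q i, i ∈ J q ↔ q ∈ P i := fun q i => by simp [J]
  let T : Set E := {q | ∀ᶠ r in nhds q, ∃ i, i ∈ S r ∧ i ≠ i₀ ∧ r ∈ U ∧ r ∈ P i ∧ ∀ k, r ∈ P k →
    k ∈ S r ∧ k ≠ i₀}
  obtain ⟨q, hqT, hmin⟩ : ∃ q ∈ T, ∀ r ∈ T, (J q).card ≤ (J r).card := by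
    obtain ⟨_, ⟨q, hq, rfl⟩, hmin⟩ := Set.exists_min_image ((fun q => (J q).card) '' T) id
      ((Set.finite_Iic (Fintype.card ι)).subset (by
        rintro _ ⟨q, -, rfl⟩; exact Finset.card_le_univ _)) ⟨_, γ 1, hgood, rfl⟩
    exact ⟨q, hq, fun r hr => hmin _ ⟨r, hr, rfl⟩⟩
  obtain ⟨i, hiS, hi₀, hqU, hqi, -⟩ := hqT.self_of_nhds
  have hqint : q ∈ interior (P i) := by
    rw [mem_interior_iff_mem_nhds]
    have h₁ : ∀ᶠ r in nhds q, ∀ k, k ∉ J q → r ∉ P k := by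
      refine Filter.eventually_all.2 fun k => ?_
      by_cases hk : k ∈ J q
      · exact Filter.Eventually.of_forall fun _ h => absurd hk h
      · have := (hP k).isOpen_compl.mem_nhds (fun h => hk ((hJ q k).2 h))
        filter_upwards [this] with r hr _ using hr
    filter_upwards [h₁, eventually_eventually_nhds.2 hqT] with r hr hrT
    have hsub' : J r ⊆ J q := fun k hk => by
      by_contra hkq
      exact hr k hkq ((hJ r k).1 hk)
    have heq := Finset.eq_of_subset_of_card_le hsub' (hmin r hrT)
    rw [← hJ, heq, hJ]
    exact hqi
  exact (hS q i).1 hiS (hder i hi₀ q hqU hqint)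

end Rigidity


/-! ### Integrality of angles near infinity -/

theorem eventually_eq_of_eventually_mem_range_intCast {X : Type*} [TopologicalSpace X] {u : X → ℝ}
    {p : X} (hu : ContinuousAt u p)
    (h : ∀ᶠ q in nhds p, u q ∈ Set.range ((↑) : ℤ → ℝ)) : ∀ᶠ q in nhds p, u q = u p := by
  obtain ⟨k, hk⟩ := h.self_of_nhds
  filter_upwards [h, Metric.continuousAt_iff'.1 hu 1 one_pos] with q ⟨l, hl⟩ hq
  rw [← hk, ← hl, Real.dist_eq] at hq
  rw [← hk, ← hl]
  have : |l - k| < 1 := by exact_mod_cast hq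
  rw [Int.abs_lt_one_iff, sub_eq_zero] at this
  rw [this]

namespace IsSeparatedDivision

variable {n : ℕ} {F : SmoothCompleteFan n} {C : F.Ray → Set (EuclideanSpace ℝ (Fin n))} {δ R : ℝ}

theorem mono (h : IsSeparatedDivision F C δ R) {R' : ℝ} (hR : R ≤ R') :
    IsSeparatedDivision F C δ R' where
  δ_pos := h.δ_pos
  R_pos := h.R_pos.trans_le hR
  closed := h.closed
  cover x hx := h.cover x (hR.trans hx)
  sep α x hx hxR := h.sep α x hx (hR.trans hxR)

/-- On a full-dimensional cone, the points of `C α` have large `α`-coordinate. -/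
theorem mul_norm_le_repr (h : IsSeparatedDivision F C δ R)
    {b : Module.Basis (Fin n) ℤ (Fin n → ℤ)}
    {B : Module.Basis (Fin n) ℝ (EuclideanSpace ℝ (Fin n))} (hB : ∀ i, B i = latticeVec (b i))
    {σ : Finset (Fin n → ℤ)} (hσ : σ ∈ F.cones) (hσb : (σ : Set (Fin n → ℤ)) = Set.range b)
    {i : Fin n} {α : F.Ray} (hα : b i = α.1) {x : EuclideanSpace ℝ (Fin n)} (hx : x ∈ C α)
    (hxR : R ≤ ‖x‖) (hxσ : x ∈ coneOf σ) : δ * ‖x‖ ≤ B.repr x i * ‖B i‖ := by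
  classical
  have hx' := (SmoothCompleteFan.mem_coneOf_iff hB hσb.le).1 hxσ
  have hsub : ((σ.erase (b i) : Finset (Fin n → ℤ)) : Set (Fin n → ℤ)) ⊆ Set.range b :=
    fun β hβ => hσb.le (Finset.mem_of_mem_erase (Finset.mem_coe.1 hβ))
  have hy : x - B.repr x i • B i ∈ coneOf (σ.erase (b i)) := by
    refine (SmoothCompleteFan.mem_coneOf_iff hB hsub).2 fun j => ?_
    have e : B.repr (x - B.repr x i • B i) j = if i = j then 0 else B.repr x j := by
      rw [map_sub, map_smul, B.repr_self, Finsupp.sub_apply, Finsupp.smul_apply,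
        Finsupp.single_apply]
      split_ifs with hij <;> simp [hij]
    rw [e]
    split_ifs with hij
    · exact ⟨le_rfl, fun _ => rfl⟩
    · refine ⟨(hx' j).1, fun hj => (hx' j).2 fun hjσ => hj (Finset.mem_erase.2 ⟨?_, hjσ⟩)⟩
      exact fun h => hij (b.injective h).symm
  have h₁ := h.sep α x hx hxR _ (F.face_mem σ hσ _ (Finset.erase_subset _ _))
    (by rw [← hα]; exact Finset.notMem_erase _ _) _ hy
  rwa [sub_sub_cancel, norm_smul, Real.norm_of_nonneg (hx' i).1] at h₁

variable {θ : EuclideanSpace ℝ (Fin n) → Fin n → ℝ} {a : F.Ray → ℝ}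

/-- The angle of `c_α z^α` in full turns, if `θ` are the angles of the coordinates and `a` is the
argument of `c`. -/
def _root_.rayAngle (θ : EuclideanSpace ℝ (Fin n) → Fin n → ℝ) (a : F.Ray → ℝ) (α : F.Ray)
    (x : EuclideanSpace ℝ (Fin n)) : ℝ :=
  (∑ j, (α.1 j : ℝ) * θ x j + a α) / (2 * Real.pi)

theorem _root_.rayAngle_eq_iff {α : F.Ray} {x : EuclideanSpace ℝ (Fin n)} {k : ℤ} :
    rayAngle θ a α x = k ↔ ∑ j, (α.1 j : ℝ) * θ x j + a α = 2 * Real.pi * k := by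
  rw [rayAngle, div_eq_iff (by positivity), mul_comm]

theorem _root_.hasFDerivAt_rayAngle (hθ : ContDiff ℝ (⊤ : ℕ∞) θ) (α : F.Ray)
    (x : EuclideanSpace ℝ (Fin n)) : HasFDerivAt (rayAngle θ a α)
      ((2 * Real.pi)⁻¹ • ∑ j, (α.1 j : ℝ) •
        (ContinuousLinearMap.proj (R := ℝ) j).comp (fderiv ℝ θ x)) x := by
  have h₁ : ∀ j, HasFDerivAt (fun x => θ x j)
      ((ContinuousLinearMap.proj (R := ℝ) j).comp (fderiv ℝ θ x)) x := fun j =>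
    (ContinuousLinearMap.proj (R := ℝ) (φ := fun _ : Fin n => ℝ) j).hasFDerivAt.comp x
      (hθ.differentiable (by simp) x).hasFDerivAt
  have h₂ := ((HasFDerivAt.fun_sum (u := Finset.univ) fun j _ =>
    (h₁ j).const_mul (α.1 j : ℝ)).add_const (a α)).mul_const (2 * Real.pi)⁻¹
  exact h₂

theorem _root_.contDiff_rayAngle (hθ : ContDiff ℝ (⊤ : ℕ∞) θ) (α : F.Ray) :
    ContDiff ℝ (⊤ : ℕ∞) (rayAngle θ a α) := by
  have h₁ : ∀ j, ContDiff ℝ (⊤ : ℕ∞) fun x => θ x j := contDiff_pi.1 hθ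
  exact ((ContDiff.sum fun j _ => contDiff_const.mul (h₁ j)).add contDiff_const).div_const _

/-- Inside one full-dimensional cone `σ`, the angle of `α` far out in `C α` is its value far out on
the ray of `α`. For another ray `β` of `σ`, the angle of `β` is locally constant in the interior of
`C β`, so that by symmetry the angle of `α` has derivative zero there in the direction of `β`. This
is the hypothesis of `eq_of_partial_derivatives_vanish`, for the basis of the rays of `σ`. -/
theorem exists_forall_rayAngle_eq_of_cone (h : IsSeparatedDivision F C δ R)
    (hθ : ContDiff ℝ (⊤ : ℕ∞) θ)
    (hsymm : ∀ x v w : EuclideanSpace ℝ (Fin n),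
      ∑ j, v j * fderiv ℝ θ x w j = ∑ j, w j * fderiv ℝ θ x v j)
    (hint : ∀ α, ∀ x ∈ C α, R ≤ ‖x‖ → rayAngle θ a α x ∈ Set.range ((↑) : ℤ → ℝ))
    {σ : Finset (Fin n → ℤ)} (hσ : σ ∈ F.cones) {b : Module.Basis (Fin n) ℤ (Fin n → ℤ)}
    (hσb : (σ : Set (Fin n → ℤ)) = Set.range b) (α : F.Ray) (hα : α.1 ∈ σ) :
    ∃ A : ℝ, ∀ x ∈ coneOf σ, x ∈ C α → A ≤ ‖x‖ → ∀ t : ℝ, A ≤ t →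
      rayAngle θ a α x = rayAngle θ a α (t • latticeVec α.1) := by
  classical
  obtain ⟨B, hB⟩ := exists_real_basis b
  obtain ⟨i₀, hi₀⟩ : ∃ i, b i = α.1 := hσb.le hα
  have hray : ∀ i, {b i} ∈ F.cones := fun i => F.ray_mem ⟨σ, hσ⟩ (hσb.ge ⟨i, rfl⟩)
  have hR := h.R_pos
  have hδ := h.δ_pos
  obtain ⟨M, hM, hMx⟩ : ∃ M : ℝ, 0 < M ∧ ∀ x, B.repr x i₀ ≤ M * ‖x‖ := by
    let l := LinearMap.toContinuousLinearMap (B.coord i₀)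
    refine ⟨‖l‖ + 1, by positivity, fun x => ?_⟩
    have h₁ : B.repr x i₀ ≤ ‖l‖ * ‖x‖ := (le_abs_self _).trans (l.le_opNorm x)
    nlinarith [norm_nonneg x]
  obtain ⟨N, hN, hNi⟩ : ∃ N : ℝ, 0 < N ∧ ∀ i, ‖B i‖ ≤ N := by
    refine ⟨∑ i, ‖B i‖ + 1, by positivity, fun i => ?_⟩
    have := Finset.single_le_sum (f := fun i => ‖B i‖) (fun _ _ => norm_nonneg _)
      (Finset.mem_univ i)
    linarith
  let U : Set (EuclideanSpace ℝ (Fin n)) :=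
    {x | M * R < B.repr x i₀ ∧ ∀ i, i ≠ i₀ → 0 < B.repr x i}
  have hUR : ∀ x ∈ U, R ≤ ‖x‖ := fun x hx =>
    le_of_mul_le_mul_left (hx.1.le.trans (hMx x)) hM
  have hUσ : ∀ x ∈ U, x ∈ coneOf σ := by
    intro x hx
    refine (SmoothCompleteFan.mem_coneOf_iff hB hσb.le).2 fun i => ?_
    refine ⟨?_, fun hi => absurd (hσb.ge ⟨i, rfl⟩) hi⟩
    by_cases hi : i = i₀
    · rw [hi]; exact le_trans (by positivity) hx.1.le
    · exact (hx.2 i hi).le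
  have hθ₂ : ∀ β, ContDiff ℝ 2 (rayAngle θ a β) := fun β =>
    contDiff_infty.1 (contDiff_rayAngle hθ β) 2
  have hconst : ∀ x ∈ U, ∀ y ∈ U, rayAngle θ a α x = rayAngle θ a α y := by
    intro x hx y hy
    refine eq_of_partial_derivatives_vanish B i₀ (A := M * R) (δ := δ * R / N) (by positivity)
      (hθ₂ α) (P := fun i => C ⟨b i, hray i⟩) (fun i => h.closed _) (U := U) rfl
      ?_ ?_ ?_ ?_ hx hy
    · intro x hx
      obtain ⟨β, hβ⟩ := h.cover x (hUR x hx)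
      obtain ⟨i, hi⟩ := hσb.le (h.mem_of_mem_coneOf hβ (hUR x hx) hσ (hUσ x hx))
      refine ⟨i, ?_⟩
      rwa [show (⟨b i, hray i⟩ : F.Ray) = β from Subtype.ext hi]
    · intro x hx i hi hxi
      have h₁ := h.mul_norm_le_repr hB hσ hσb rfl hxi (hUR x hx) (hUσ x hx)
      have h₂ := mul_le_mul_of_nonneg_left (hUR x hx) hδ.le
      have h₃ := mul_le_mul_of_nonneg_left (hNi i) (hx.2 i hi).le
      rw [div_le_iff₀ hN]
      linarith
    · intro x hx hxα
      refine hint α x ?_ (hUR x hx)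
      rwa [show (⟨b i₀, hray i₀⟩ : F.Ray) = α from Subtype.ext hi₀] at hxα
    · intro i _ x hx hxi
      let β : F.Ray := ⟨b i, hray i⟩
      have hUo : ∀ᶠ q in nhds x, R ≤ ‖q‖ := by
        have : R < ‖x‖ := lt_of_mul_lt_mul_left (hx.1.trans_le (hMx x)) hM.le
        filter_upwards [continuous_norm.continuousAt.eventually (lt_mem_nhds this)] with q hq
          using le_of_lt hq
      have h₁ : ∀ᶠ q in nhds x, rayAngle θ a β q = rayAngle θ a β x := by
        refine eventually_eq_of_eventually_mem_range_intCast
          (hθ₂ β).continuous.continuousAt ?_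
        filter_upwards [hUo, mem_interior_iff_mem_nhds.1 hxi] with q hq₁ hq₂
          using hint β q hq₂ hq₁
      have h₂ := (hasFDerivAt_rayAngle (a := a) hθ β x).unique
        ((hasFDerivAt_const (rayAngle θ a β x) x).congr_of_eventuallyEq h₁)
      have h₃ := congrArg (fun l => l (B i₀)) h₂
      rw [(hasFDerivAt_rayAngle hθ α x).fderiv]
      simp only [smul_apply, sum_apply,
        ContinuousLinearMap.comp_apply, ContinuousLinearMap.proj_apply, smul_eq_mul,
        zero_apply] at h₃ ⊢
      rw [← h₃]
      have h₄ := hsymm x (B i₀) (B i)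
      rw [hB i₀, hi₀, hB i] at h₄ ⊢
      simp only [latticeVec_apply] at h₄
      rw [h₄]
  -- Points of the closed cone are limits of points of its interior, in the direction `v`.
  let v : EuclideanSpace ℝ (Fin n) := ∑ i, B i
  have hv : ∀ i, B.repr v i = 1 := by
    intro i
    have : v = ∑ i, (1 : ℝ) • B i := by simp [v]
    rw [this, B.repr_sum_self]
  have hvU : ∀ x, M * R < B.repr x i₀ → (∀ i, 0 ≤ B.repr x i) → ∀ s : ℝ, 0 < s → x + s • v ∈ U := by
    intro x hx₀ hx s hs
    have e : ∀ i, B.repr (x + s • v) i = B.repr x i + s := by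
      intro i; simp [hv]
    refine ⟨?_, fun i _ => ?_⟩
    · rw [e]; linarith
    · rw [e]; linarith [hx i]
  have hclos : ∀ x y, M * R < B.repr x i₀ → (∀ i, 0 ≤ B.repr x i) → M * R < B.repr y i₀ →
      (∀ i, 0 ≤ B.repr y i) → rayAngle θ a α x = rayAngle θ a α y := by
    intro x y hx₀ hx hy₀ hy
    have ht : ∀ x, Filter.Tendsto (fun s : ℝ => rayAngle θ a α (x + s • v))
        (nhdsWithin 0 (Set.Ioi 0)) (nhds (rayAngle θ a α x)) := by
      intro x
      have hc : Continuous fun s : ℝ => rayAngle θ a α (x + s • v) :=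
        (hθ₂ α).continuous.comp (by fun_prop)
      have := hc.tendsto 0
      simp only [zero_smul, add_zero] at this
      exact this.mono_left nhdsWithin_le_nhds
    refine tendsto_nhds_unique_of_eventuallyEq (ht x) (ht y) ?_
    filter_upwards [self_mem_nhdsWithin] with s hs
      using hconst _ (hvU x hx₀ hx s hs) _ (hvU y hy₀ hy s hs)
  refine ⟨max R (max (M * R + 1) ((M * R + 1) * N / δ)), fun x hxσ hxα hxA t ht => ?_⟩
  have hxA₁ : R ≤ ‖x‖ := (le_max_left _ _).trans hxA
  have hxA₂ : (M * R + 1) * N / δ ≤ ‖x‖ :=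
    ((le_max_right _ _).trans (le_max_right _ _)).trans hxA
  have htA : M * R + 1 ≤ t := ((le_max_left _ _).trans (le_max_right _ _)).trans ht
  have hMR : 0 < M * R := mul_pos hM hR
  have hx' := (SmoothCompleteFan.mem_coneOf_iff hB hσb.le).1 hxσ
  have hrepr : ∀ i, B.repr (t • latticeVec α.1) i = if i₀ = i then t else 0 := by
    intro i
    rw [← hi₀, ← hB, map_smul, B.repr_self, Finsupp.smul_apply, Finsupp.single_apply]
    split_ifs <;> simp
  refine hclos x _ ?_ (fun i => (hx' i).1) ?_ fun i => ?_
  · have h₁ := h.mul_norm_le_repr hB hσ hσb hi₀ hxα hxA₁ hxσ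
    have h₂ := mul_le_mul_of_nonneg_left (hNi i₀) (hx' i₀).1
    rw [div_le_iff₀ hδ] at hxA₂
    have h₃ : (M * R + 1) * N ≤ B.repr x i₀ * N := by linarith
    linarith [le_of_mul_le_mul_right h₃ hN]
  · rw [hrepr, if_pos rfl]; linarith
  · rw [hrepr]; split_ifs <;> linarith

/-- If the angles `θ` are a closed `1`-form and the angle of each `c_α z^α` is integral over the
part of `C α` near infinity, then it is constant there, even if this part is disconnected. -/
theorem exists_rayAngle_eq (h : IsSeparatedDivision F C δ R) (hθ : ContDiff ℝ (⊤ : ℕ∞) θ)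
    (hsymm : ∀ x v w : EuclideanSpace ℝ (Fin n),
      ∑ j, v j * fderiv ℝ θ x w j = ∑ j, w j * fderiv ℝ θ x v j)
    (hint : ∀ α, ∀ x ∈ C α, R ≤ ‖x‖ → rayAngle θ a α x ∈ Set.range ((↑) : ℤ → ℝ)) (α : F.Ray) :
    ∃ (k : ℤ) (A : ℝ), ∀ x ∈ C α, A ≤ ‖x‖ → rayAngle θ a α x = k := by
  have h₁ : ∀ σ : F.Cone, ∃ A : ℝ,
      (∃ b : Module.Basis (Fin n) ℤ (Fin n → ℤ), (σ.1 : Set (Fin n → ℤ)) = Set.range b) →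
      α.1 ∈ σ.1 → ∀ x ∈ coneOf σ.1, x ∈ C α → A ≤ ‖x‖ → ∀ t : ℝ, A ≤ t →
        rayAngle θ a α x = rayAngle θ a α (t • latticeVec α.1) := by
    intro σ
    by_cases hσ : (∃ b : Module.Basis (Fin n) ℤ (Fin n → ℤ),
      (σ.1 : Set (Fin n → ℤ)) = Set.range b) ∧ α.1 ∈ σ.1
    · obtain ⟨⟨b, hb⟩, hα⟩ := hσ
      obtain ⟨A, hA⟩ := h.exists_forall_rayAngle_eq_of_cone hθ hsymm hint σ.2 hb α hα
      exact ⟨A, fun _ _ => hA⟩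
    · exact ⟨0, fun h₁ h₂ => absurd ⟨h₁, h₂⟩ hσ⟩
  choose A hA using h₁
  obtain ⟨M, hM⟩ := (Set.finite_range A).bddAbove
  have hα := norm_pos_iff.2 (SmoothCompleteFan.latticeVec_ray_ne_zero α)
  let t : ℝ := max M ((R + 1) / ‖latticeVec α.1‖)
  have hR := h.R_pos
  have ht : 0 ≤ t := le_trans (by positivity) (le_max_right _ _)
  have htR : R < ‖t • latticeVec α.1‖ := by
    rw [norm_smul, Real.norm_of_nonneg ht]
    have : (R + 1) / ‖latticeVec α.1‖ ≤ t := le_max_right _ _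
    rw [div_le_iff₀ hα] at this
    linarith
  obtain ⟨k, hk⟩ := hint α _ (mem_of_mem_nhds (h.mem_nhds_ray α ht htR)) htR.le
  refine ⟨k, max M R, fun x hx hxA => ?_⟩
  obtain ⟨σ, hσ, hb, hxσ⟩ := F.exists_full_cone x
  have hAσ : A ⟨σ, hσ⟩ ≤ M := hM ⟨_, rfl⟩
  rw [hk]
  exact hA ⟨σ, hσ⟩ hb (h.mem_of_mem_coneOf hx ((le_max_right _ _).trans hxA) hσ hxσ) x hxσ hx
    (hAσ.trans ((le_max_left _ _).trans hxA)) t (hAσ.trans (le_max_left _ _))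

end IsSeparatedDivision


/-! ### Toric Kähler forms in polar coordinates -/

/-- The tangent vector at `z` to the torus action in the direction `a`. -/
def rotationVector {n : ℕ} (a : Fin n → ℝ) (z : Fin n → ℂ) : Fin n → ℂ :=
  fun j => Complex.I * a j * z j

/-- The tangent vector at `z` that changes the logarithms of the absolute values of the
coordinates with velocity `a`. -/
def radialVector {n : ℕ} (a : Fin n → ℝ) (z : Fin n → ℂ) : Fin n → ℂ :=
  fun j => a j * z j

theorem I_smul_radialVector {n : ℕ} (a : Fin n → ℝ) (z : Fin n → ℂ) :
    Complex.I • radialVector a z = rotationVector a z := by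
  funext j
  simp [radialVector, rotationVector, mul_assoc]

theorem rotationVector_eq_sum {n : ℕ} (a : Fin n → ℝ) (z : Fin n → ℂ) :
    rotationVector a z = ∑ j, a j • rotationField j z := by
  funext k
  simp only [rotationVector, rotationField, Finset.sum_apply, Pi.smul_apply, Pi.single_apply,
    Complex.real_smul]
  simp
  ring

theorem isOpen_torus (n : ℕ) : IsOpen (torus n) := by
  have : torus n = ⋂ i, {z | z i ≠ 0} := by ext; simp [torus]
  rw [this]
  exact isOpen_iInter_of_finite fun i => isOpen_ne_fun (continuous_apply i) continuous_const

theorem mul_mem_torus {n : ℕ} {t z : Fin n → ℂ} (ht : ∀ i, ‖t i‖ = 1) (hz : z ∈ torus n) :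
    t * z ∈ torus n := fun i => mul_ne_zero (norm_ne_zero_iff.1 (by rw [ht]; exact one_ne_zero))
      (hz i)

theorem update_pair {V : Type*} (u v w : V) : Function.update ![u, v] 1 w = ![u, w] := by
  funext i
  fin_cases i <;> simp

/-- A `2`-form at a point, as a bilinear form. -/
def bilinOfForm {V : Type*} [NormedAddCommGroup V] [NormedSpace ℝ V] (f : V [⋀^Fin 2]→L[ℝ] ℝ) :
    V →ₗ[ℝ] V →ₗ[ℝ] ℝ :=
  LinearMap.mk₂ ℝ (fun u v => f ![u, v])
    (fun u u' v => f.toAlternatingMap.map_vecCons_add ![v] u u')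
    (fun c u v => f.toAlternatingMap.map_vecCons_smul ![v] c u)
    (fun u v v' => by
      have h := f.map_update_add ![u, 0] 1 v v'
      rwa [update_pair, update_pair, update_pair] at h)
    (fun c u v => by
      have h := f.map_update_smul ![u, 0] 1 c v
      rwa [update_pair, update_pair] at h)

theorem bilinOfForm_apply {V : Type*} [NormedAddCommGroup V] [NormedSpace ℝ V]
    (f : V [⋀^Fin 2]→L[ℝ] ℝ) (u v : V) : bilinOfForm f u v = f ![u, v] := rfl

theorem bilinOfForm_swap {V : Type*} [NormedAddCommGroup V] [NormedSpace ℝ V]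
    (f : V [⋀^Fin 2]→L[ℝ] ℝ) (u v : V) : bilinOfForm f u v = - bilinOfForm f v u := by
  have h := f.toAlternatingMap.map_swap ![v, u] (i := 0) (j := 1) (by simp)
  have e : (![v, u] : Fin 2 → V) ∘ Equiv.swap 0 1 = ![u, v] := by
    funext i
    fin_cases i <;> simp
  rw [e] at h
  exact h

section

variable {n : ℕ} {ω : (Fin n → ℂ) → (Fin n → ℂ) [⋀^Fin 2]→L[ℝ] ℝ}
  {μ : (Fin n → ℂ) → EuclideanSpace ℝ (Fin n)}

theorem IsMomentMap.hasFDerivAt (hμ : IsMomentMap ω μ) {z : Fin n → ℂ} (hz : z ∈ torus n) :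
    HasFDerivAt μ (fderiv ℝ μ z) z :=
  ((hμ.smooth.contDiffAt ((isOpen_torus n).mem_nhds hz)).differentiableAt (by simp)).hasFDerivAt

theorem IsMomentMap.form_rotationVector (hμ : IsMomentMap ω μ) {z : Fin n → ℂ} (hz : z ∈ torus n)
    (a : Fin n → ℝ) (v : Fin n → ℂ) :
    bilinOfForm (ω z) (rotationVector a z) v = - ∑ j, a j * fderiv ℝ μ z v j := by
  rw [rotationVector_eq_sum, map_sum, LinearMap.sum_apply, ← Finset.sum_neg_distrib]
  refine Finset.sum_congr rfl fun j _ => ?_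
  rw [map_smul, LinearMap.smul_apply, bilinOfForm_apply, hμ.hamiltonian z hz]
  simp

/-- The infinitesimal form of the invariance of the moment map. -/
theorem IsMomentMap.fderiv_rotationVector (hμ : IsMomentMap ω μ) {z : Fin n → ℂ}
    (hz : z ∈ torus n) (a : Fin n → ℝ) : fderiv ℝ μ z (rotationVector a z) = 0 := by
  let γ : ℝ → Fin n → ℂ := fun t => (fun j => Complex.exp (t * a j * Complex.I)) * z
  have hγ : HasDerivAt γ (rotationVector a z) 0 := by
    rw [hasDerivAt_pi]
    intro j
    have h₁ : HasDerivAt (fun t : ℝ => (t : ℂ) * a j * Complex.I) (a j * Complex.I) 0 := by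
      simpa using (((hasDerivAt_id (0 : ℝ)).ofReal_comp.mul_const (a j : ℂ)).mul_const Complex.I)
    have h₂ := h₁.cexp.mul_const (z j)
    simp only [Complex.ofReal_zero, zero_mul, Complex.exp_zero, one_mul] at h₂
    rw [mul_comm (a j : ℂ)] at h₂
    exact h₂
  have hγ0 : γ 0 = z := by
    funext j; simp [γ]
  have h₁ := (by rw [hγ0]; exact hμ.hasFDerivAt hz :
    HasFDerivAt μ (fderiv ℝ μ z) (γ 0)).comp_hasDerivAt 0 hγ
  have h₂ : μ ∘ γ = fun _ => μ z := by
    funext t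
    refine hμ.invariant z hz _ fun j => ?_
    rw [← Complex.ofReal_mul]
    exact Complex.norm_exp_ofReal_mul_I _
  rw [h₂] at h₁
  exact h₁.unique (hasDerivAt_const _ _)

/-- Radial directions are `-I` times tangent directions of the torus orbits, which are isotropic,
and the form is of type `(1,1)`. -/
theorem form_radialVector (hω : IsToricKahlerForm ω) (hμ : IsMomentMap ω μ) {z : Fin n → ℂ}
    (hz : z ∈ torus n) (a b : Fin n → ℝ) :
    bilinOfForm (ω z) (radialVector a z) (radialVector b z) = 0 := by
  rw [bilinOfForm_apply, ← hω.compatible z hz, I_smul_radialVector, I_smul_radialVector,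
    ← bilinOfForm_apply, hμ.form_rotationVector hz, hμ.fderiv_rotationVector hz]
  simp

/-- In the coordinates given by the moment map and the angles, the form is `∑ dμ_j ∧ dθ_j`. -/
theorem form_eq (hω : IsToricKahlerForm ω) (hμ : IsMomentMap ω μ) {z : Fin n → ℂ}
    (hz : z ∈ torus n) (a l a' l' : Fin n → ℝ) {u u' : Fin n → ℂ}
    (hu : u = rotationVector a z + radialVector l z)
    (hu' : u' = rotationVector a' z + radialVector l' z) :
    ω z ![u, u'] = ∑ j, a' j * fderiv ℝ μ z u j - ∑ j, a j * fderiv ℝ μ z u' j := by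
  have h₁ : bilinOfForm (ω z) (radialVector l z) u' = ∑ j, a' j * fderiv ℝ μ z u j := by
    rw [hu', map_add, form_radialVector hω hμ hz, add_zero, bilinOfForm_swap,
      hμ.form_rotationVector hz, neg_neg, hu, map_add, hμ.fderiv_rotationVector hz, zero_add]
  rw [← bilinOfForm_apply]
  conv_lhs => rw [hu]
  rw [map_add, LinearMap.add_apply, h₁, hμ.form_rotationVector hz]
  ring

/-- In logarithmic coordinates, the derivative of the moment map is positive definite. -/
theorem fderiv_radialVector_pos (hω : IsToricKahlerForm ω) (hμ : IsMomentMap ω μ) {z : Fin n → ℂ}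
    (hz : z ∈ torus n) {a : Fin n → ℝ} (ha : a ≠ 0) :
    0 < ∑ j, a j * fderiv ℝ μ z (radialVector a z) j := by
  have h₁ : radialVector a z ≠ 0 := by
    obtain ⟨j, hj⟩ := Function.ne_iff.1 ha
    refine Function.ne_iff.2 ⟨j, mul_ne_zero ?_ (hz j)⟩
    exact_mod_cast hj
  have h₂ := hω.positive z hz _ h₁
  rwa [I_smul_radialVector, ← bilinOfForm_apply, bilinOfForm_swap, hμ.form_rotationVector hz,
    neg_neg] at h₂

theorem ofReal_norm_mem_torus {z : Fin n → ℂ} (hz : z ∈ torus n) :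
    (fun j => (‖z j‖ : ℂ)) ∈ torus n := fun j => by
  simpa using hz j

theorem IsMomentMap.apply_norm (hμ : IsMomentMap ω μ) {z : Fin n → ℂ} (hz : z ∈ torus n) :
    μ (fun j => (‖z j‖ : ℂ)) = μ z := by
  have hz' : ∀ j, (‖z j‖ : ℂ) ≠ 0 := ofReal_norm_mem_torus hz
  have h := hμ.invariant _ (ofReal_norm_mem_torus hz) (fun j => z j / ‖z j‖) (fun j => by
    rw [norm_div, Complex.norm_real, norm_norm, div_self (norm_ne_zero_iff.2 (hz j))])
  rw [← h]
  congr 1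
  funext j
  exact div_mul_cancel₀ _ (hz' j)

/-- The absolute values of the coordinates as functions of the moment map. -/
structure IsRadius {n : ℕ} (μ : (Fin n → ℂ) → EuclideanSpace ℝ (Fin n))
    (r : EuclideanSpace ℝ (Fin n) → Fin n → ℝ) : Prop where
  smooth : ContDiff ℝ (⊤ : ℕ∞) r
  pos : ∀ x j, 0 < r x j
  apply_ofReal : ∀ x, μ (fun j => (r x j : ℂ)) = x
  norm_eq : ∀ z ∈ torus n, ∀ j, ‖z j‖ = r (μ z) j

/-- In logarithmic coordinates, a surjective moment map is a diffeomorphism, as its derivative is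
positive definite. Hence the absolute values of the coordinates are smooth functions of the
moment map. -/
theorem IsMomentMap.exists_radius (hω : IsToricKahlerForm ω) (hμ : IsMomentMap ω μ)
    (hμ_onto : Set.SurjOn μ (torus n) Set.univ) :
    ∃ r : EuclideanSpace ℝ (Fin n) → Fin n → ℝ, IsRadius μ r := by
  let e : EuclideanSpace ℝ (Fin n) → Fin n → ℂ := fun ρ j => (Real.exp (ρ j) : ℂ)
  have he : ∀ ρ, e ρ ∈ torus n := fun ρ j => by
    simp only [e, ne_eq, Complex.ofReal_eq_zero]
    exact (Real.exp_pos _).ne'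
  have hes : ContDiff ℝ (⊤ : ℕ∞) e := by
    rw [contDiff_pi]
    intro j
    exact Complex.ofRealCLM.contDiff.comp
      (Real.contDiff_exp.comp (EuclideanSpace.proj j : EuclideanSpace ℝ (Fin n) →L[ℝ] ℝ).contDiff)
  have hed : ∀ ρ v, HasDerivAt (fun t : ℝ => e (ρ + t • v)) (radialVector v (e ρ)) 0 := by
    intro ρ v
    rw [hasDerivAt_pi]
    intro j
    have h₁ : HasDerivAt (fun t : ℝ => ρ j + t * v j) (v j) 0 := by
      simpa using ((hasDerivAt_id (0 : ℝ)).mul_const (v j)).const_add (ρ j)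
    have h₂ := h₁.exp.ofReal_comp
    simp only [zero_mul, add_zero, Complex.ofReal_mul] at h₂
    rw [mul_comm] at h₂
    exact h₂
  have hefd : ∀ ρ v, fderiv ℝ e ρ v = radialVector v (e ρ) := by
    intro ρ v
    have h₁ : HasFDerivAt e (fderiv ℝ e ρ) (ρ + (0 : ℝ) • v) := by
      rw [zero_smul, add_zero]
      exact (hes.differentiable (by simp) ρ).hasFDerivAt
    have h₂ := h₁.comp_hasDerivAt (0 : ℝ) (hasDerivAt_add_smul ρ v 0)
    exact h₂.unique (hed ρ v)
  let N : EuclideanSpace ℝ (Fin n) → EuclideanSpace ℝ (Fin n) := fun ρ => μ (e ρ)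
  have hN : ContDiff ℝ (⊤ : ℕ∞) N := contDiff_iff_contDiffAt.2 fun ρ =>
    (hμ.smooth.contDiffAt ((isOpen_torus n).mem_nhds (he ρ))).comp ρ hes.contDiffAt
  have hNd : ∀ ρ, HasFDerivAt N ((fderiv ℝ μ (e ρ)).comp (fderiv ℝ e ρ)) ρ := fun ρ =>
    (hμ.hasFDerivAt (he ρ)).comp ρ (hes.differentiable (by simp) ρ).hasFDerivAt
  have hpos : ∀ ρ v, v ≠ 0 → 0 < ∑ j, v j * fderiv ℝ N ρ v j := by
    intro ρ v hv
    rw [(hNd ρ).fderiv, ContinuousLinearMap.comp_apply, hefd]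
    refine fderiv_radialVector_pos hω hμ (he ρ) fun h => hv ?_
    ext j
    exact congrFun h j
  have hinj : Function.Injective N := by
    intro ρ ρ' h
    by_contra hne
    have hv : ρ' - ρ ≠ 0 := sub_ne_zero.2 (Ne.symm hne)
    let g : ℝ → ℝ := fun t => ∑ j, (ρ' - ρ) j * N (ρ + t • (ρ' - ρ)) j
    have hg : ∀ t, HasDerivAt g
        (∑ j, (ρ' - ρ) j * fderiv ℝ N (ρ + t • (ρ' - ρ)) (ρ' - ρ) j) t := by
      intro t
      have h₁ := (hN.differentiable (by simp) (ρ + t • (ρ' - ρ))).hasFDerivAt.comp_hasDerivAt t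
        (hasDerivAt_add_smul ρ (ρ' - ρ) t)
      refine HasDerivAt.fun_sum fun j _ => HasDerivAt.const_mul _ ?_
      exact (EuclideanSpace.proj j : EuclideanSpace ℝ (Fin n) →L[ℝ] ℝ).hasFDerivAt.comp_hasDerivAt
        t h₁
    have hmono : StrictMono g := strictMono_of_deriv_pos fun t => by
      rw [(hg t).deriv]; exact hpos _ _ hv
    have h₁ := hmono zero_lt_one
    simp only [g, zero_smul, add_zero, one_smul, add_sub_cancel, h] at h₁
    exact lt_irrefl _ h₁
  have hlog : ∀ z ∈ torus n, e (WithLp.toLp 2 fun j => Real.log ‖z j‖) = fun j => (‖z j‖ : ℂ) := by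
    intro z hz
    funext j
    simp only [e]
    rw [Real.exp_log (norm_pos_iff.2 (hz j))]
  have hNlog : ∀ z ∈ torus n, N (WithLp.toLp 2 fun j => Real.log ‖z j‖) = μ z := by
    intro z hz
    simp only [N]
    rw [hlog z hz, hμ.apply_norm hz]
  have hsurj : Function.Surjective N := by
    intro x
    obtain ⟨z, hz, rfl⟩ := hμ_onto (Set.mem_univ x)
    exact ⟨_, hNlog z hz⟩
  have hker : ∀ ρ, LinearMap.ker
      (fderiv ℝ N ρ : EuclideanSpace ℝ (Fin n) →ₗ[ℝ] EuclideanSpace ℝ (Fin n)) = ⊥ := by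
    intro ρ
    rw [LinearMap.ker_eq_bot']
    intro v hv
    by_contra hne
    have h₁ := hpos ρ v hne
    have h₂ : fderiv ℝ N ρ v = 0 := hv
    rw [h₂] at h₁
    simp at h₁
  let D : ∀ ρ, EuclideanSpace ℝ (Fin n) ≃L[ℝ] EuclideanSpace ℝ (Fin n) := fun ρ =>
    (LinearEquiv.ofInjectiveEndo
      (fderiv ℝ N ρ : EuclideanSpace ℝ (Fin n) →ₗ[ℝ] EuclideanSpace ℝ (Fin n))
      (LinearMap.ker_eq_bot.1 (hker ρ))).toContinuousLinearEquiv
  have hD : ∀ ρ, HasFDerivAt N (D ρ : EuclideanSpace ℝ (Fin n) →L[ℝ] _) ρ := by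
    intro ρ
    have : (D ρ : EuclideanSpace ℝ (Fin n) →L[ℝ] EuclideanSpace ℝ (Fin n)) = fderiv ℝ N ρ := by
      ext v : 1; rfl
    rw [this]
    exact (hN.differentiable (by simp) ρ).hasFDerivAt
  have hopen : IsOpenMap N := isOpenMap_iff_nhds_le.2 fun ρ =>
    ((hN.contDiffAt.hasStrictFDerivAt' (hD ρ) (by simp)).map_nhds_eq_of_equiv).ge
  let Nh : EuclideanSpace ℝ (Fin n) ≃ₜ EuclideanSpace ℝ (Fin n) :=
    (Equiv.ofBijective N ⟨hinj, hsurj⟩).toHomeomorphOfContinuousOpen hN.continuous hopen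
  have hNh : ContDiff ℝ (⊤ : ℕ∞) Nh.symm := Nh.contDiff_symm (f₀' := D) hD hN
  refine ⟨fun x j => Real.exp (Nh.symm x j), ?_, fun x j => Real.exp_pos _, fun x => ?_, ?_⟩
  · rw [contDiff_pi]
    intro j
    exact Real.contDiff_exp.comp
      ((EuclideanSpace.proj j : EuclideanSpace ℝ (Fin n) →L[ℝ] ℝ).contDiff.comp hNh)
  · exact Nh.apply_symm_apply x
  · intro z hz j
    have h₁ : Nh.symm (μ z) = WithLp.toLp 2 fun j => Real.log ‖z j‖ := by
      rw [Homeomorph.symm_apply_eq]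
      exact (hNlog z hz).symm
    dsimp only
    rw [h₁]
    exact (Real.exp_log (norm_pos_iff.2 (hz j))).symm

end


/-! ### Continuous arguments -/

/-- The exponential is a covering map of the circle, and a normed space is simply connected. -/
theorem exists_continuous_arg {A : Type*} [NormedAddCommGroup A] [NormedSpace ℝ A] {z : A → ℂ}
    (hz : Continuous z) (h0 : ∀ a, z a ≠ 0) :
    ∃ θ : A → ℝ, Continuous θ ∧ ∀ a, z a = ‖z a‖ * Complex.exp (θ a * Complex.I) := by
  have hn : ∀ a, (‖z a‖ : ℂ) ≠ 0 := fun a => by simpa using h0 a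
  let f : C(A, Circle) :=
    ⟨fun a => ⟨z a / ‖z a‖, mem_sphere_zero_iff_norm.2 (by
        rw [norm_div, Complex.norm_real, norm_norm, div_self (norm_ne_zero_iff.2 (h0 a))])⟩,
      Continuous.subtype_mk (hz.div (Complex.continuous_ofReal.comp hz.norm) hn) _⟩
  obtain ⟨t, ht⟩ : ∃ t : ℝ, Circle.exp t = f 0 := ⟨_, Circle.exp_arg (f 0)⟩
  obtain ⟨θ, ⟨-, hθ⟩, -⟩ :=
    Circle.isAddQuotientCoveringMap_exp.isCoveringMap.existsUnique_continuousMap_lifts f 0 t ht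
  refine ⟨θ, θ.continuous, fun a => ?_⟩
  have h₁ : Complex.exp (θ a * Complex.I) = z a / ‖z a‖ :=
    congrArg ((↑) : Circle → ℂ) (congrFun hθ a)
  rw [h₁, mul_div_cancel₀ _ (hn a)]

theorem exists_int_of_exp_eq {s t : ℝ}
    (h : Complex.exp (s * Complex.I) = Complex.exp (t * Complex.I)) :
    ∃ k : ℤ, s = t + 2 * Real.pi * k := by
  obtain ⟨k, hk⟩ := Complex.exp_eq_exp_iff_exists_int.1 h
  refine ⟨k, ?_⟩
  have h₁ : (s : ℂ) * Complex.I = ((t + 2 * Real.pi * k : ℝ) : ℂ) * Complex.I := by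
    rw [hk]; push_cast; ring
  exact_mod_cast mul_right_cancel₀ Complex.I_ne_zero h₁

theorem exp_add_two_pi_mul_int (t : ℝ) (k : ℤ) :
    Complex.exp (((t + 2 * Real.pi * k : ℝ) : ℂ) * Complex.I) = Complex.exp (t * Complex.I) :=
  Complex.exp_eq_exp_iff_exists_int.2 ⟨k, by push_cast; ring⟩

theorem contDiff_of_continuous_arg {E : Type*} [NormedAddCommGroup E] [NormedSpace ℝ E]
    {z : E → ℂ} (hz : ContDiff ℝ (⊤ : ℕ∞) z) (h0 : ∀ a, z a ≠ 0) {θ : E → ℝ} (hθ : Continuous θ)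
    (h : ∀ a, z a = ‖z a‖ * Complex.exp (θ a * Complex.I)) : ContDiff ℝ (⊤ : ℕ∞) θ := by
  refine contDiff_iff_contDiffAt.2 fun x => ?_
  -- Near `x`, the function `θ` is `θ x` plus the principal argument of `z / z x`.
  let g : E → ℝ := fun y => (Complex.log (z y / z x)).im
  have hg : ContDiffAt ℝ (⊤ : ℕ∞) g x := by
    have h₁ : ContDiffAt ℝ (⊤ : ℕ∞) (fun y => Complex.log (z y / z x)) x := by
      refine ContDiffAt.comp (g := Complex.log) x ((Complex.contDiffAt_log ?_).restrict_scalars ℝ)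
        (hz.contDiffAt.div_const _)
      rw [div_self (h0 x)]
      exact Complex.one_mem_slitPlane
    exact Complex.imCLM.contDiff.contDiffAt.comp x h₁
  have hgx : g x = 0 := by simp [g, div_self (h0 x)]
  let k : E → ℝ := fun y => (θ y - θ x - g y) / (2 * Real.pi)
  have hk : ContinuousAt k x :=
    ((hθ.continuousAt.sub continuousAt_const).sub hg.continuousAt).div_const _
  have hkint : ∀ y, k y ∈ Set.range ((↑) : ℤ → ℝ) := by
    intro y
    have h₁ : Complex.exp (((θ y - θ x : ℝ) : ℂ) * Complex.I)
        = Complex.exp ((g y : ℂ) * Complex.I) := by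
      have h₂ : z y / z x = ‖z y / z x‖ * Complex.exp ((g y : ℂ) * Complex.I) := by
        simp only [g, Complex.log_im]
        exact (Complex.norm_mul_exp_arg_mul_I _).symm
      have h₃ : z y / z x = ‖z y / z x‖ * Complex.exp (((θ y - θ x : ℝ) : ℂ) * Complex.I) := by
        conv_lhs => rw [h y, h x]
        rw [norm_div, Complex.ofReal_sub, sub_mul, Complex.exp_sub, Complex.ofReal_div]
        ring
      have h₄ : (‖z y / z x‖ : ℂ) ≠ 0 := by
        simpa using ⟨h0 y, h0 x⟩
      exact mul_left_cancel₀ h₄ (h₃.symm.trans h₂)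
    obtain ⟨m, hm⟩ := exists_int_of_exp_eq h₁
    refine ⟨m, ?_⟩
    simp only [k]
    rw [hm, add_sub_cancel_left, mul_div_cancel_left₀ _ (by positivity)]
  have h₁ := eventually_eq_of_eventually_mem_range_intCast hk (Filter.Eventually.of_forall hkint)
  have h₂ : θ =ᶠ[nhds x] fun y => θ x + g y := by
    filter_upwards [h₁] with y hy
    simp only [k, hgx, sub_self, zero_div] at hy
    have := (div_eq_zero_iff.1 hy).resolve_right (by positivity)
    linarith
  exact (contDiffAt_const.add hg).congr_of_eventuallyEq h₂

/-! ### Lagrangian sections -/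

/-- The section of the moment map with given absolute values and angles of the coordinates. -/
def polarSection {n : ℕ} (r θ : EuclideanSpace ℝ (Fin n) → Fin n → ℝ)
    (x : EuclideanSpace ℝ (Fin n)) : Fin n → ℂ :=
  fun j => r x j * Complex.exp (θ x j * Complex.I)

/-- Smooth angle functions `θ` for which the `1`-form `∑ θ_j dx_j` is closed. -/
structure IsClosedAngle {n : ℕ} (θ : EuclideanSpace ℝ (Fin n) → Fin n → ℝ) : Prop where
  smooth : ContDiff ℝ (⊤ : ℕ∞) θ
  symm : ∀ x v w : EuclideanSpace ℝ (Fin n),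
    ∑ j, v j * fderiv ℝ θ x w j = ∑ j, w j * fderiv ℝ θ x v j

section

variable {n : ℕ} {ω : (Fin n → ℂ) → (Fin n → ℂ) [⋀^Fin 2]→L[ℝ] ℝ}
  {μ : (Fin n → ℂ) → EuclideanSpace ℝ (Fin n)} {r θ θ' : EuclideanSpace ℝ (Fin n) → Fin n → ℝ}

theorem IsRadius.norm_polarSection (hr : IsRadius μ r) (x : EuclideanSpace ℝ (Fin n)) (j : Fin n) :
    ‖polarSection r θ x j‖ = r x j := by
  rw [polarSection, norm_mul, Complex.norm_exp_ofReal_mul_I, mul_one, Complex.norm_real,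
    Real.norm_of_nonneg (hr.pos x j).le]

theorem IsRadius.polarSection_mem (hr : IsRadius μ r) (x : EuclideanSpace ℝ (Fin n)) :
    polarSection r θ x ∈ torus n := fun j => norm_ne_zero_iff.1 (by
      rw [hr.norm_polarSection]; exact (hr.pos x j).ne')

theorem IsRadius.apply_polarSection (hr : IsRadius μ r) (hμ : IsMomentMap ω μ)
    (x : EuclideanSpace ℝ (Fin n)) : μ (polarSection r θ x) = x := by
  have h := hμ.apply_norm (hr.polarSection_mem (θ := θ) x)
  simp_rw [hr.norm_polarSection, hr.apply_ofReal] at h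
  exact h.symm

theorem IsRadius.contDiff_polarSection (hr : IsRadius μ r) (hθ : ContDiff ℝ (⊤ : ℕ∞) θ) :
    ContDiff ℝ (⊤ : ℕ∞) (polarSection r θ) := by
  rw [contDiff_pi]
  intro j
  have h₁ := contDiff_pi.1 hr.smooth j
  have h₂ := contDiff_pi.1 hθ j
  exact (Complex.ofRealCLM.contDiff.comp h₁).mul
    (Complex.contDiff_exp.comp ((Complex.ofRealCLM.contDiff.comp h₂).mul contDiff_const))

theorem IsRadius.fderiv_polarSection (hr : IsRadius μ r) (hθ : ContDiff ℝ (⊤ : ℕ∞) θ)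
    (x v : EuclideanSpace ℝ (Fin n)) :
    fderiv ℝ (polarSection r θ) x v = rotationVector (fderiv ℝ θ x v) (polarSection r θ x)
      + radialVector (fun j => fderiv ℝ r x v j / r x j) (polarSection r θ x) := by
  have hs := (hr.contDiff_polarSection hθ).differentiable (by simp) x
  have h0 : x + (0 : ℝ) • v = x := by rw [zero_smul, add_zero]
  have hline : ∀ {V : Type} [NormedAddCommGroup V] [NormedSpace ℝ V]
      {f : EuclideanSpace ℝ (Fin n) → V}, DifferentiableAt ℝ f x →
      HasDerivAt (fun t : ℝ => f (x + t • v)) (fderiv ℝ f x v) 0 := by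
    intro V _ _ f hf
    have h₁ : HasFDerivAt f (fderiv ℝ f x) (x + (0 : ℝ) • v) := by
      rw [h0]; exact hf.hasFDerivAt
    exact h₁.comp_hasDerivAt (0 : ℝ) (hasDerivAt_add_smul x v 0)
  refine (hline hs).unique ?_
  rw [hasDerivAt_pi]
  intro j
  have h₁ := hasDerivAt_pi.1 (hline (hr.smooth.differentiable (by simp) x)) j
  have h₂ := hasDerivAt_pi.1 (hline (hθ.differentiable (by simp) x)) j
  have h₃ := h₁.ofReal_comp.mul (h₂.ofReal_comp.mul_const Complex.I).cexp
  refine h₃.congr_deriv ?_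
  have h₄ : (r x j : ℂ) ≠ 0 := by exact_mod_cast (hr.pos x j).ne'
  simp only [h0, Pi.add_apply, rotationVector, radialVector, polarSection, Complex.ofReal_div]
  field_simp
  ring

/-- The pull-back of the form to a section is `∑ dx_j ∧ dθ_j`. -/
theorem IsRadius.form_fderiv_polarSection (hr : IsRadius μ r) (hω : IsToricKahlerForm ω)
    (hμ : IsMomentMap ω μ) (hθ : ContDiff ℝ (⊤ : ℕ∞) θ) (x v w : EuclideanSpace ℝ (Fin n)) :
    ω (polarSection r θ x) ![fderiv ℝ (polarSection r θ) x v, fderiv ℝ (polarSection r θ) x w]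
      = ∑ j, v j * fderiv ℝ θ x w j - ∑ j, w j * fderiv ℝ θ x v j := by
  have hdμ : ∀ v, fderiv ℝ μ (polarSection r θ x) (fderiv ℝ (polarSection r θ) x v) = v := by
    intro v
    have h₁ := (hμ.hasFDerivAt (hr.polarSection_mem (θ := θ) x)).comp x
      ((hr.contDiff_polarSection hθ).differentiable (by simp) x).hasFDerivAt
    have h₂ : μ ∘ polarSection r θ = id := funext fun x => hr.apply_polarSection hμ x
    rw [h₂] at h₁
    exact congrArg (fun l => l v) (h₁.unique (hasFDerivAt_id x))
  rw [form_eq hω hμ (hr.polarSection_mem x) _ _ _ _ (hr.fderiv_polarSection hθ x v)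
    (hr.fderiv_polarSection hθ x w), hdμ, hdμ]
  simp only [mul_comm]

/-- The Lagrangian sections are the sections whose angles form a closed `1`-form. -/
theorem IsRadius.isLagrangianSection_iff (hr : IsRadius μ r) (hω : IsToricKahlerForm ω)
    (hμ : IsMomentMap ω μ) {L : Set (Fin n → ℂ)} :
    IsLagrangianSection ω μ L ↔ ∃ θ, IsClosedAngle θ ∧ L = Set.range (polarSection r θ) := by
  constructor
  · rintro ⟨s, hs, hsμ, rfl, hsω⟩
    have hsj := contDiff_pi.1 hs
    choose θ hθc hθ using fun j => exists_continuous_arg (hsj j).continuous fun x => (hsμ x).1 j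
    let Θ : EuclideanSpace ℝ (Fin n) → Fin n → ℝ := fun x j => θ j x
    have hΘ : ContDiff ℝ (⊤ : ℕ∞) Θ := contDiff_pi.2 fun j =>
      contDiff_of_continuous_arg (hsj j) (fun x => (hsμ x).1 j) (hθc j) (hθ j)
    have hsΘ : s = polarSection r Θ := by
      funext x j
      rw [hθ j x, hr.norm_eq (s x) (hsμ x).1, (hsμ x).2]
      rfl
    subst hsΘ
    refine ⟨Θ, ⟨hΘ, fun x v w => ?_⟩, rfl⟩
    have := hsω x v w
    rw [hr.form_fderiv_polarSection hω hμ hΘ] at this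
    linarith
  · rintro ⟨θ, hθ, rfl⟩
    refine ⟨_, hr.contDiff_polarSection hθ.smooth,
      fun x => ⟨hr.polarSection_mem x, hr.apply_polarSection hμ x⟩, rfl, fun x v w => ?_⟩
    rw [hr.form_fderiv_polarSection hω hμ hθ.smooth, hθ.symm, sub_self]

/-! ### Flows of functions of the moment map -/

/-- The partial derivatives of a function on `ℝⁿ`. -/
def gradCoord (h : EuclideanSpace ℝ (Fin n) → ℝ) (x : EuclideanSpace ℝ (Fin n)) : Fin n → ℝ :=
  fun j => fderiv ℝ h x (EuclideanSpace.single j 1)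

theorem sum_mul_gradCoord (h : EuclideanSpace ℝ (Fin n) → ℝ) (x v : EuclideanSpace ℝ (Fin n)) :
    ∑ j, v j * gradCoord h x j = fderiv ℝ h x v := by
  have hv : v = ∑ j, v j • EuclideanSpace.single j (1 : ℝ) := by
    ext k
    simp [Finset.sum_apply, Pi.single_apply]
  conv_rhs => rw [hv]
  simp [gradCoord]

theorem isClosedAngle_gradCoord {h : EuclideanSpace ℝ (Fin n) → ℝ} (hh : ContDiff ℝ (⊤ : ℕ∞) h) :
    IsClosedAngle (gradCoord h) := by
  have hd : ContDiff ℝ (⊤ : ℕ∞) (fderiv ℝ h) := (contDiff_infty_iff_fderiv.1 hh).2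
  have hs : ContDiff ℝ (⊤ : ℕ∞) (gradCoord h) := contDiff_pi.2 fun j => hd.clm_apply contDiff_const
  have hd₂ : ∀ x v, HasFDerivAt (fun q => fderiv ℝ h q v)
      ((fderiv ℝ (fderiv ℝ h) x).flip v) x := fun x v =>
    (ContinuousLinearMap.apply ℝ ℝ v).hasFDerivAt.comp x
      (hd.differentiable (by simp) x).hasFDerivAt
  have key : ∀ x v w, ∑ j, v j * fderiv ℝ (gradCoord h) x w j = fderiv ℝ (fderiv ℝ h) x w v := by
    intro x v w
    have h₁ : HasFDerivAt (fun q => ∑ j, v j * gradCoord h q j)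
        (∑ j, v j • (ContinuousLinearMap.proj (R := ℝ) j).comp (fderiv ℝ (gradCoord h) x)) x :=
      HasFDerivAt.fun_sum fun j _ => HasFDerivAt.const_mul
        ((ContinuousLinearMap.proj (R := ℝ) (φ := fun _ : Fin n => ℝ) j).hasFDerivAt.comp x
          (hs.differentiable (by simp) x).hasFDerivAt) (v j)
    simp_rw [sum_mul_gradCoord] at h₁
    have h₂ := congrArg (fun l => l w) (h₁.unique (hd₂ x v))
    simpa using h₂
  refine ⟨hs, fun x v w => ?_⟩
  rw [key, key]
  exact (hh.contDiffAt.isSymmSndFDerivAt (by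
    simpa using WithTop.coe_le_coe.2 (le_top : (2 : ℕ∞) ≤ ⊤))).eq w v

/-- The Poincaré lemma. -/
theorem IsClosedAngle.exists_gradCoord_eq (hθ : IsClosedAngle θ) :
    ∃ h : EuclideanSpace ℝ (Fin n) → ℝ, ContDiff ℝ (⊤ : ℕ∞) h ∧ gradCoord h = θ := by
  let η : EuclideanSpace ℝ (Fin n) → EuclideanSpace ℝ (Fin n) →L[ℝ] ℝ := fun x =>
    ∑ j, θ x j • (EuclideanSpace.proj j : EuclideanSpace ℝ (Fin n) →L[ℝ] ℝ)
  have hη : ContDiff ℝ (⊤ : ℕ∞) η := ContDiff.sum fun j _ =>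
    (contDiff_pi.1 hθ.smooth j).smul contDiff_const
  have hηv : ∀ x v, η x v = ∑ j, v j * θ x j := by
    intro x v
    simp [η, mul_comm]
  have hηd : ∀ x v w, fderiv ℝ η x v w = ∑ j, w j * fderiv ℝ θ x v j := by
    intro x v w
    have h₁ : HasFDerivAt (fun x => η x w) ((fderiv ℝ η x).flip w) x :=
      (ContinuousLinearMap.apply ℝ ℝ w).hasFDerivAt.comp x
        (hη.differentiable (by simp) x).hasFDerivAt
    simp_rw [hηv] at h₁
    have h₂ : HasFDerivAt (fun q => ∑ j, w j * θ q j)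
        (∑ j, w j • (ContinuousLinearMap.proj (R := ℝ) j).comp (fderiv ℝ θ x)) x :=
      HasFDerivAt.fun_sum fun j _ => HasFDerivAt.const_mul
        ((ContinuousLinearMap.proj (R := ℝ) (φ := fun _ : Fin n => ℝ) j).hasFDerivAt.comp x
          (hθ.smooth.differentiable (by simp) x).hasFDerivAt) (w j)
    have h₃ := congrArg (fun l => l v) (h₁.unique h₂)
    simpa using h₃
  obtain ⟨h, hh⟩ := (convex_univ (𝕜 := ℝ)
    (E := EuclideanSpace ℝ (Fin n))).exists_forall_hasFDerivAt_of_fderiv_symmetric isOpen_univ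
    (hη.differentiable (by simp)).differentiableOn (fun x _ v w => by
      rw [hηd, hηd, hθ.symm])
  have hfd : fderiv ℝ h = η := funext fun x => (hh x trivial).fderiv
  refine ⟨h, contDiff_infty_iff_fderiv.2
    ⟨fun x => (hh x trivial).differentiableAt, by rw [hfd]; exact hη⟩, ?_⟩
  funext x j
  rw [gradCoord, hfd, hηv]
  simp

/-- The rotation of the fibres of the moment map with velocity `g`. -/
def fibreRotation (μ : (Fin n → ℂ) → EuclideanSpace ℝ (Fin n))
    (g : EuclideanSpace ℝ (Fin n) → Fin n → ℝ) (t : ℝ) (z : Fin n → ℂ) : Fin n → ℂ :=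
  (fun j => Complex.exp (((t * g (μ z) j : ℝ) : ℂ) * Complex.I)) * z

variable {g : EuclideanSpace ℝ (Fin n) → Fin n → ℝ}

theorem fibreRotation_mem (t : ℝ) {z : Fin n → ℂ} (hz : z ∈ torus n) :
    fibreRotation μ g t z ∈ torus n :=
  mul_mem_torus (fun _ => Complex.norm_exp_ofReal_mul_I _) hz

theorem IsMomentMap.apply_fibreRotation (hμ : IsMomentMap ω μ) (t : ℝ) {z : Fin n → ℂ}
    (hz : z ∈ torus n) : μ (fibreRotation μ g t z) = μ z :=
  hμ.invariant z hz _ fun _ => Complex.norm_exp_ofReal_mul_I _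

theorem IsMomentMap.fibreRotation_neg (hμ : IsMomentMap ω μ) (t : ℝ) {z : Fin n → ℂ}
    (hz : z ∈ torus n) : fibreRotation μ g (-t) (fibreRotation μ g t z) = z := by
  funext j
  have h₁ : fibreRotation μ g (-t) (fibreRotation μ g t z) j
      = Complex.exp (((-t * g (μ (fibreRotation μ g t z)) j : ℝ) : ℂ) * Complex.I) *
        (Complex.exp (((t * g (μ z) j : ℝ) : ℂ) * Complex.I) * z j) := rfl
  rw [h₁, hμ.apply_fibreRotation t hz, ← mul_assoc, ← Complex.exp_add, neg_mul, Complex.ofReal_neg,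
    neg_mul, neg_add_cancel, Complex.exp_zero, one_mul]

theorem IsMomentMap.contDiffOn_fibreRotation (hμ : IsMomentMap ω μ)
    (hg : ContDiff ℝ (⊤ : ℕ∞) g) : ContDiffOn ℝ (⊤ : ℕ∞)
      (Function.uncurry (fibreRotation μ g)) (Set.univ ×ˢ torus n) := by
  have hsnd : Set.MapsTo (Prod.snd : ℝ × (Fin n → ℂ) → _) (Set.univ ×ˢ torus n) (torus n) :=
    fun p hp => hp.2
  rw [contDiffOn_pi]
  intro j
  have h₁ : ContDiffOn ℝ (⊤ : ℕ∞) (fun p : ℝ × (Fin n → ℂ) => g (μ p.2) j)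
      (Set.univ ×ˢ torus n) :=
    (contDiff_pi.1 hg j).comp_contDiffOn (hμ.smooth.comp contDiff_snd.contDiffOn hsnd)
  have h₂ : ContDiffOn ℝ (⊤ : ℕ∞) (fun p : ℝ × (Fin n → ℂ) => p.1 * g (μ p.2) j)
      (Set.univ ×ˢ torus n) := contDiff_fst.contDiffOn.mul h₁
  have h₃ : ContDiffOn ℝ (⊤ : ℕ∞) (fun p : ℝ × (Fin n → ℂ) =>
      Complex.exp (((p.1 * g (μ p.2) j : ℝ) : ℂ) * Complex.I)) (Set.univ ×ˢ torus n) :=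
    Complex.contDiff_exp.comp_contDiffOn
      ((Complex.ofRealCLM.contDiff.comp_contDiffOn h₂).mul contDiffOn_const)
  exact h₃.mul ((contDiff_apply ℝ ℂ j).comp contDiff_snd).contDiffOn

theorem hasDerivAt_fibreRotation (t : ℝ) (z : Fin n → ℂ) :
    HasDerivAt (fun s => fibreRotation μ g s z)
      (rotationVector (g (μ z)) (fibreRotation μ g t z)) t := by
  rw [hasDerivAt_pi]
  intro j
  have h₁ : HasDerivAt (fun s : ℝ => s * g (μ z) j) (g (μ z) j) t := by
    simpa using (hasDerivAt_id t).mul_const (g (μ z) j)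
  have h₂ := ((h₁.ofReal_comp.mul_const Complex.I).cexp).mul_const (z j)
  refine h₂.congr_deriv ?_
  simp only [rotationVector, fibreRotation, Pi.mul_apply]
  ring

/-- The Hamiltonian vector field of a function of the moment map. -/
theorem IsMomentMap.form_rotationVector_gradCoord (hμ : IsMomentMap ω μ)
    {h : EuclideanSpace ℝ (Fin n) → ℝ} (hh : ContDiff ℝ (⊤ : ℕ∞) h) {z : Fin n → ℂ}
    (hz : z ∈ torus n) (v : Fin n → ℂ) :
    bilinOfForm (ω z) (rotationVector (gradCoord h (μ z)) z) v
      = - fderiv ℝ (fun z => h (μ z)) z v := by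
  have h₁ : HasFDerivAt (fun z => h (μ z)) ((fderiv ℝ h (μ z)).comp (fderiv ℝ μ z)) z :=
    (hh.differentiable (by simp) (μ z)).hasFDerivAt.comp z (hμ.hasFDerivAt hz)
  rw [hμ.form_rotationVector hz, h₁.fderiv, ContinuousLinearMap.comp_apply, ← sum_mul_gradCoord]
  simp only [mul_comm]

theorem IsMomentMap.isHamiltonianFlow_fibreRotation (hμ : IsMomentMap ω μ)
    {h : EuclideanSpace ℝ (Fin n) → ℝ} (hh : ContDiff ℝ (⊤ : ℕ∞) h) :
    IsHamiltonianFlow ω (fun _ z => h (μ z)) (fibreRotation μ (gradCoord h)) where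
  smooth_hamiltonian := hh.comp_contDiffOn
    (hμ.smooth.comp contDiff_snd.contDiffOn fun p hp => hp.2)
  smooth := (hμ.contDiffOn_fibreRotation (isClosedAngle_gradCoord hh).smooth).mono
    (Set.prod_mono (Set.subset_univ _) le_rfl)
  mapsTo t _ _ hz := fibreRotation_mem t hz
  inverse := by
    refine ⟨fun t => fibreRotation μ (gradCoord h) (-t), ?_, fun t _ =>
      ⟨fun z hz => fibreRotation_mem _ hz, fun z hz => hμ.fibreRotation_neg t hz, fun z hz => ?_⟩⟩
    · have h₁ : ContDiff ℝ (⊤ : ℕ∞) fun p : ℝ × (Fin n → ℂ) => (-p.1, p.2) :=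
        contDiff_fst.neg.prodMk contDiff_snd
      exact (hμ.contDiffOn_fibreRotation (isClosedAngle_gradCoord hh).smooth).comp h₁.contDiffOn
        fun p hp => ⟨trivial, hp.2⟩
    · have := hμ.fibreRotation_neg (g := gradCoord h) (-t) hz
      rwa [neg_neg] at this
  zero z _ := by
    funext j; simp [fibreRotation]
  velocity t _ z hz := by
    refine ⟨_, (hasDerivAt_fibreRotation t z).hasDerivWithinAt, fun v => ?_⟩
    rw [← bilinOfForm_apply, ← hμ.form_rotationVector_gradCoord hh (fibreRotation_mem t hz),
      hμ.apply_fibreRotation t hz]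

/-- A function of the moment map has only one flow: its vector field is tangent to the fibres
of the moment map, so that it is constant along the flow lines in the directions of the angles. -/
theorem IsHamiltonianFlow.eq_fibreRotation (hω : IsToricKahlerForm ω) (hμ : IsMomentMap ω μ)
    {h : EuclideanSpace ℝ (Fin n) → ℝ} (hh : ContDiff ℝ (⊤ : ℕ∞) h)
    {φ : ℝ → (Fin n → ℂ) → (Fin n → ℂ)} (hφ : IsHamiltonianFlow ω (fun _ z => h (μ z)) φ)
    {z : Fin n → ℂ} (hz : z ∈ torus n) {t : ℝ} (ht : t ∈ Set.Icc (0 : ℝ) 1) :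
    φ t z = fibreRotation μ (gradCoord h) t z := by
  have hder : ∀ t ∈ Set.Icc (0 : ℝ) 1, HasDerivWithinAt (fun s => φ s z)
      (rotationVector (gradCoord h (μ (φ t z))) (φ t z)) (Set.Icc 0 1) t := by
    intro t ht
    obtain ⟨X, hX, hXv⟩ := hφ.velocity t ht z hz
    have hw := hφ.mapsTo t ht hz
    have : X = rotationVector (gradCoord h (μ (φ t z))) (φ t z) := by
      rw [← sub_eq_zero]
      by_contra hne
      have h₁ := hω.positive _ hw _ hne
      rw [← bilinOfForm_apply, map_sub, LinearMap.sub_apply,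
        hμ.form_rotationVector_gradCoord hh hw, bilinOfForm_apply, hXv] at h₁
      linarith
    rwa [← this]
  have h01 : (0 : ℝ) ∈ Set.Icc (0 : ℝ) 1 := ⟨le_rfl, zero_le_one⟩
  have hconst : ∀ {V : Type} [NormedAddCommGroup V] [NormedSpace ℝ V] (f : ℝ → V),
      (∀ t ∈ Set.Icc (0 : ℝ) 1, HasDerivWithinAt f 0 (Set.Icc 0 1) t) →
      ∀ t ∈ Set.Icc (0 : ℝ) 1, f t = f 0 := by
    intro V _ _ f hf
    refine constant_of_derivWithin_zero (fun t ht => (hf t ht).differentiableWithinAt)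
      fun t ht => (hf t ⟨ht.1, ht.2.le⟩).derivWithin ?_
    exact uniqueDiffOn_Icc zero_lt_one t ⟨ht.1, ht.2.le⟩
  have hμφ : ∀ t ∈ Set.Icc (0 : ℝ) 1, μ (φ t z) = μ z := by
    intro t ht
    have h₁ := hconst (fun s => μ (φ s z)) (fun s hs => by
      have h₂ := (hμ.hasFDerivAt (hφ.mapsTo s hs hz)).comp_hasDerivWithinAt s (hder s hs)
      rwa [hμ.fderiv_rotationVector (hφ.mapsTo s hs hz)] at h₂) t ht
    simp only [hφ.zero z hz] at h₁
    exact h₁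
  funext j
  let a : ℝ := gradCoord h (μ z) j
  have h₁ := hconst (fun s : ℝ => Complex.exp (((-s * a : ℝ) : ℂ) * Complex.I) * φ s z j)
    (fun s hs => by
      have h₂ : HasDerivAt (fun s : ℝ => -s * a) (-a) s := by
        simpa using (hasDerivAt_id s).neg.mul_const a
      have h₃ := (h₂.ofReal_comp.mul_const Complex.I).cexp.hasDerivWithinAt (s := Set.Icc 0 1)
      have h₄ := hasDerivWithinAt_pi.1 (hder s hs) j
      refine (h₃.mul h₄).congr_deriv ?_
      rw [hμφ s hs]
      simp only [rotationVector, a]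
      push_cast
      ring) t ht
  simp only [hφ.zero z hz, neg_zero, zero_mul, Complex.ofReal_zero, Complex.exp_zero, one_mul]
    at h₁
  simp only [fibreRotation, Pi.mul_apply]
  rw [← h₁, ← mul_assoc, ← Complex.exp_add, neg_mul, Complex.ofReal_neg, neg_mul, add_neg_cancel,
    Complex.exp_zero, one_mul]

theorem IsRadius.fibreRotation_polarSection (hr : IsRadius μ r) (hμ : IsMomentMap ω μ) (t : ℝ)
    (x : EuclideanSpace ℝ (Fin n)) :
    fibreRotation μ g t (polarSection r θ x) = polarSection r (fun x => θ x + t • g x) x := by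
  funext j
  simp only [fibreRotation, hr.apply_polarSection hμ, Pi.mul_apply, polarSection, Pi.add_apply,
    Pi.smul_apply, smul_eq_mul, Complex.ofReal_add, add_mul, Complex.exp_add]
  ring

end


/-! ### Angles of sections near infinity -/

section

variable {n : ℕ} {F : SmoothCompleteFan n} {c : F.Ray → ℂ}
  {ω : (Fin n → ℂ) → (Fin n → ℂ) [⋀^Fin 2]→L[ℝ] ℝ}
  {μ : (Fin n → ℂ) → EuclideanSpace ℝ (Fin n)}
  {C : F.Ray → Set (EuclideanSpace ℝ (Fin n))}
  {r θ θ' : EuclideanSpace ℝ (Fin n) → Fin n → ℝ} {a : F.Ray → ℝ} {δ R : ℝ}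

theorem IsMomentMap.exists_norm_bound (hμ : IsMomentMap ω μ) {K : Set (Fin n → ℂ)}
    (hK : IsCompact K) (hKt : K ⊆ torus n) :
    ∃ A : ℝ, ∀ z, A ≤ ‖μ z‖ → z ∉ K := by
  obtain ⟨A, hA⟩ := (hK.image_of_continuousOn (hμ.smooth.continuousOn.mono hKt)).exists_norm_bound
  exact ⟨A, fun z hz hzK => hA _ hz ⟨z, hzK, rfl⟩⟩

/-- The moment map is proper. -/
theorem IsRadius.exists_isCompact (hr : IsRadius μ r) (A : ℝ) :
    ∃ K ⊆ torus n, IsCompact K ∧ ∀ z ∈ torus n, z ∉ K → A ≤ ‖μ z‖ := by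
  let f : EuclideanSpace ℝ (Fin n) × (Fin n → ℝ) → Fin n → ℂ := fun p =>
    polarSection r (fun _ => p.2) p.1
  have hf : Continuous f := by
    refine continuous_pi fun j => ?_
    have h₁ : Continuous fun x => r x j := (continuous_apply j).comp hr.smooth.continuous
    have h₂ : Continuous fun p : EuclideanSpace ℝ (Fin n) × (Fin n → ℝ) => r p.1 j :=
      h₁.comp continuous_fst
    simp only [f, polarSection]
    fun_prop
  refine ⟨f '' (Metric.closedBall 0 A ×ˢ Metric.closedBall 0 Real.pi), ?_,
    ((isCompact_closedBall 0 A).prod (isCompact_closedBall 0 Real.pi)).image hf, ?_⟩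
  · rintro _ ⟨p, -, rfl⟩
    exact hr.polarSection_mem p.1
  · intro z hz hzK
    by_contra hA
    refine hzK ⟨(μ z, fun j => (z j).arg), ⟨?_, ?_⟩, ?_⟩
    · simpa using (not_le.1 hA).le
    · rw [mem_closedBall_zero_iff, pi_norm_le_iff_of_nonneg Real.pi_pos.le]
      exact fun j => Complex.abs_arg_le_pi _
    · funext j
      simp only [f, polarSection]
      rw [← hr.norm_eq z hz, Complex.norm_mul_exp_arg_mul_I]

theorem IsRadius.arg_polarSection_eq_zero_iff (hr : IsRadius μ r) {α : F.Ray} (hc : c α ≠ 0)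
    (x : EuclideanSpace ℝ (Fin n)) :
    (c α * monomial α.1 (polarSection r θ x)).arg = 0 ↔
      rayAngle θ (fun α => (c α).arg) α x ∈ Set.range ((↑) : ℤ → ℝ) := by
  set S : ℝ := ∑ j, (α.1 j : ℝ) * θ x j + (c α).arg with hS
  let ρ : ℝ := ‖c α‖ * ∏ j, r x j ^ α.1 j
  have hρ : 0 < ρ := mul_pos (norm_pos_iff.2 hc)
    (Finset.prod_pos fun j _ => zpow_pos (hr.pos x j) _)
  have hz : c α * monomial α.1 (polarSection r θ x) = ρ * Complex.exp (S * Complex.I) := by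
    have h₁ : monomial α.1 (polarSection r θ x) = (∏ j, (r x j : ℂ) ^ α.1 j) *
        Complex.exp (∑ j, (α.1 j : ℂ) * (θ x j * Complex.I)) := by
      rw [Complex.exp_sum, ← Finset.prod_mul_distrib]
      refine Finset.prod_congr rfl fun j _ => ?_
      rw [polarSection, mul_zpow, ← Complex.exp_int_mul]
    have h₂ : ((S : ℝ) : ℂ) * Complex.I
        = ∑ j, (α.1 j : ℂ) * (θ x j * Complex.I) + (c α).arg * Complex.I := by
      simp only [hS, Complex.ofReal_add, Complex.ofReal_sum, Complex.ofReal_mul,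
        Complex.ofReal_intCast, add_mul, Finset.sum_mul, mul_assoc]
    rw [h₂, Complex.exp_add, h₁]
    conv_lhs => rw [← Complex.norm_mul_exp_arg_mul_I (c α)]
    simp only [ρ, Complex.ofReal_mul, Complex.ofReal_prod, Complex.ofReal_zpow]
    ring
  have hS' : ∀ k : ℤ, rayAngle θ (fun α => (c α).arg) α x = k ↔ S = 2 * Real.pi * k :=
    fun k => rayAngle_eq_iff
  rw [hz, Complex.arg_real_mul _ hρ]
  constructor
  · intro h
    have h₁ := Complex.norm_mul_exp_arg_mul_I (Complex.exp (S * Complex.I))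
    rw [Complex.norm_exp_ofReal_mul_I, h, Complex.ofReal_one, one_mul] at h₁
    obtain ⟨k, hk⟩ := exists_int_of_exp_eq h₁.symm
    exact ⟨k, ((hS' k).2 (by rw [hk, zero_add])).symm⟩
  · rintro ⟨k, hk⟩
    have h₁ := exp_add_two_pi_mul_int 0 k
    rw [zero_add, ← (hS' k).1 hk.symm] at h₁
    rw [h₁]
    simp

/-- Admissibility outside of a compact set makes the angle of `c_α z^α` integral outside of a ball,
the same one for all sections. -/
theorem IsRadius.exists_norm_bound_of_admissibleOutside (hr : IsRadius μ r)
    (hμ : IsMomentMap ω μ) {α : F.Ray} (hc : c α ≠ 0) {K : Set (Fin n → ℂ)} (hK : IsCompact K)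
    (hKt : K ⊆ torus n) : ∃ A : ℝ, ∀ θ : EuclideanSpace ℝ (Fin n) → Fin n → ℝ,
      AdmissibleOutside μ (c α) α.1 (C α) K (Set.range (polarSection r θ)) →
      ∀ x ∈ C α, A ≤ ‖x‖ →
        rayAngle θ (fun α => (c α).arg) α x ∈ Set.range ((↑) : ℤ → ℝ) := by
  obtain ⟨A, hA⟩ := hμ.exists_norm_bound hK hKt
  refine ⟨A, fun θ hθ x hx hxA => (hr.arg_polarSection_eq_zero_iff hc x).1 ?_⟩
  have h₁ : μ (polarSection r θ x) = x := hr.apply_polarSection hμ x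
  exact hθ _ ⟨x, rfl⟩ (hA _ (by rwa [h₁])) (by rwa [h₁])

/-- Conversely, integrality outside of a ball gives admissibility outside of a compact set that does
not depend on the section. -/
theorem IsRadius.exists_isCompact_admissibleOutside (hr : IsRadius μ r) (hμ : IsMomentMap ω μ)
    {α : F.Ray} (hc : c α ≠ 0) (A : ℝ) :
    ∃ K ⊆ torus n, IsCompact K ∧ ∀ θ : EuclideanSpace ℝ (Fin n) → Fin n → ℝ,
      (∀ x ∈ C α, A ≤ ‖x‖ →
        rayAngle θ (fun α => (c α).arg) α x ∈ Set.range ((↑) : ℤ → ℝ)) →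
      AdmissibleOutside μ (c α) α.1 (C α) K (Set.range (polarSection r θ)) := by
  obtain ⟨K, hKt, hK, hKA⟩ := hr.exists_isCompact A
  refine ⟨K, hKt, hK, ?_⟩
  rintro θ hθ _ ⟨x, rfl⟩ hxK hx
  have h₁ := hKA _ (hr.polarSection_mem x) hxK
  rw [hr.apply_polarSection hμ] at hx h₁
  exact (hr.arg_polarSection_eq_zero_iff hc x).2 (hθ x hx h₁)

/-- The angles of the `c_α z^α` are `ν α` full turns over the parts of the `C α` near infinity. -/
def HasRayAngles (C : F.Ray → Set (EuclideanSpace ℝ (Fin n))) (a : F.Ray → ℝ)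
    (θ : EuclideanSpace ℝ (Fin n) → Fin n → ℝ) (ν : F.Ray → ℤ) : Prop :=
  ∃ A : ℝ, ∀ α, ∀ x ∈ C α, A ≤ ‖x‖ → rayAngle θ a α x = ν α

/-- A constant value of a function far out in `C α` is unique, as `C α` contains far points of the
ray of `α`. -/
theorem IsSeparatedDivision.eq_of_eventually_eq (h : IsSeparatedDivision F C δ R) {α : F.Ray}
    {f : EuclideanSpace ℝ (Fin n) → ℝ} {k l A B : ℝ} (hk : ∀ x ∈ C α, A ≤ ‖x‖ → f x = k)
    (hl : ∀ x ∈ C α, B ≤ ‖x‖ → f x = l) : k = l := by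
  obtain ⟨t, ht, htR⟩ := IsSeparatedDivision.exists_far_ray α (max R (max A B))
  rw [max_lt_iff, max_lt_iff] at htR
  have hmem := mem_of_mem_nhds (h.mem_nhds_ray α ht htR.1)
  rw [← hk _ hmem htR.2.1.le, ← hl _ hmem htR.2.2.le]

theorem HasRayAngles.unique (h : IsSeparatedDivision F C δ R) {ν ν' : F.Ray → ℤ}
    (hν : HasRayAngles C a θ ν) (hν' : HasRayAngles C a θ ν') : ν = ν' := by
  obtain ⟨A, hA⟩ := hν
  obtain ⟨B, hB⟩ := hν'
  funext α
  exact_mod_cast h.eq_of_eventually_eq (hA α) (hB α)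

theorem rayAngle_add_two_pi_mul (m : Fin n → ℤ) (α : F.Ray) (x : EuclideanSpace ℝ (Fin n)) :
    rayAngle (fun x j => θ x j + 2 * Real.pi * m j) a α x
      = rayAngle θ a α x + ((m ⬝ᵥ α.1 : ℤ) : ℝ) := by
  have h₁ : ∑ j, (α.1 j : ℝ) * (θ x j + 2 * Real.pi * m j)
      = ∑ j, (α.1 j : ℝ) * θ x j + 2 * Real.pi * ((m ⬝ᵥ α.1 : ℤ) : ℝ) := by
    simp only [dotProduct, Int.cast_sum, Int.cast_mul, mul_add, Finset.sum_add_distrib,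
      Finset.mul_sum]
    congr 1
    exact Finset.sum_congr rfl fun j _ => by ring
  rw [rayAngle, rayAngle, h₁]
  field_simp
  ring

theorem HasRayAngles.add_two_pi_mul {ν : F.Ray → ℤ} (hν : HasRayAngles C a θ ν)
    (m : Fin n → ℤ) :
    HasRayAngles C a (fun x j => θ x j + 2 * Real.pi * m j) (fun α => ν α + m ⬝ᵥ α.1) := by
  obtain ⟨A, hA⟩ := hν
  refine ⟨A, fun α x hx hxA => ?_⟩
  rw [rayAngle_add_two_pi_mul, hA α x hx hxA]
  push_cast
  rfl

theorem rayAngle_add_gradCoord (t : ℝ) (h : EuclideanSpace ℝ (Fin n) → ℝ) (α : F.Ray)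
    (x : EuclideanSpace ℝ (Fin n)) :
    rayAngle (fun x => θ x + t • gradCoord h x) a α x
      = rayAngle θ a α x + t * fderiv ℝ h x (latticeVec α.1) / (2 * Real.pi) := by
  rw [rayAngle, rayAngle, ← add_div, ← sum_mul_gradCoord]
  congr 1
  simp only [Pi.add_apply, Pi.smul_apply, smul_eq_mul, mul_add, Finset.sum_add_distrib,
    Finset.mul_sum, latticeVec_apply, mul_left_comm t]
  ring

theorem IsTwisting.hasRayAngles {D : F.ToricDivisor} {h : EuclideanSpace ℝ (Fin n) → ℝ}
    (hD : IsTwisting C D h) {ν : F.Ray → ℤ} (hν : HasRayAngles C a θ ν) :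
    HasRayAngles C a (fun x => θ x + (1 : ℝ) • gradCoord h x) (ν - D) := by
  obtain ⟨A, hA⟩ := hν
  choose K hK hKD using hD.2
  choose B hB using fun α => (hK α).exists_norm_bound
  obtain ⟨M, hM⟩ := (Set.finite_range B).bddAbove
  refine ⟨max A M, fun α x hx hxA => ?_⟩
  rw [rayAngle_add_gradCoord, hA α x hx ((le_max_left _ _).trans hxA),
    hKD α x hx (hB α x ((hM ⟨α, rfl⟩).trans ((le_max_right _ _).trans hxA))), Pi.sub_apply]
  push_cast
  field_simp
  ring

theorem IsPreconnected.eq_of_mem_range_intCast {X : Type*} [TopologicalSpace X] {S : Set X}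
    (hS : IsPreconnected S) {f : X → ℝ} (hf : ContinuousOn f S)
    (hint : ∀ x ∈ S, f x ∈ Set.range ((↑) : ℤ → ℝ)) {x y : X} (hx : x ∈ S) (hy : y ∈ S) :
    f x = f y := by
  have : DiscreteTopology (Set.range ((↑) : ℤ → ℝ)) :=
    Int.isClosedEmbedding_coe_real.isEmbedding.toHomeomorph.discreteTopology
  exact hS.constant_of_mapsTo ⟨this⟩ hf hint hx hy

theorem IsRadius.eq_of_range_polarSection_eq (hr : IsRadius μ r) (hμ : IsMomentMap ω μ)
    (h : Set.range (polarSection r θ) = Set.range (polarSection r θ')) :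
    polarSection r θ = polarSection r θ' := by
  funext x
  obtain ⟨y, hy⟩ := h.le ⟨x, rfl⟩
  have := congrArg μ hy
  rw [hr.apply_polarSection hμ, hr.apply_polarSection hμ] at this
  rw [← hy, this]

theorem IsRadius.isClosedAngle_of_polarSection_eq (hr : IsRadius μ r) (hω : IsToricKahlerForm ω)
    (hμ : IsMomentMap ω μ) (hθ : IsClosedAngle θ) (hθ' : Continuous θ')
    (h : polarSection r θ' = polarSection r θ) : IsClosedAngle θ' := by
  have hs : ContDiff ℝ (⊤ : ℕ∞) θ' := by
    refine contDiff_pi.2 fun j => contDiff_of_continuous_arg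
      (contDiff_pi.1 (hr.contDiff_polarSection hθ.smooth) j) (fun x => hr.polarSection_mem x j)
      ((continuous_apply j).comp hθ') fun x => ?_
    rw [hr.norm_polarSection, ← h]
    rfl
  refine ⟨hs, fun x v w => ?_⟩
  have h₁ := hr.form_fderiv_polarSection hω hμ hs x v w
  rw [h, hr.form_fderiv_polarSection hω hμ hθ.smooth, hθ.symm, sub_self] at h₁
  linarith

/-- Two lifts of the arguments along a section differ by a constant in `2πℤⁿ`. -/
theorem IsRadius.exists_eq_add_two_pi_mul (hr : IsRadius μ r) (hθ : Continuous θ)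
    (hθ' : Continuous θ') (h : polarSection r θ' = polarSection r θ) :
    ∃ m : Fin n → ℤ, θ' = fun x j => θ x j + 2 * Real.pi * m j := by
  have h₁ : ∀ x j, ∃ k : ℤ, θ' x j = θ x j + 2 * Real.pi * k := by
    intro x j
    refine exists_int_of_exp_eq (mul_left_cancel₀ ?_ (congrFun (congrFun h x) j))
    exact_mod_cast (hr.pos x j).ne'
  choose m hm using h₁
  refine ⟨m 0, funext fun x => funext fun j => ?_⟩
  have h₂ : ∀ x, (θ' x j - θ x j) / (2 * Real.pi) = m x j := by
    intro x
    rw [hm, add_sub_cancel_left, mul_div_cancel_left₀ _ (by positivity)]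
  have h₃ : (θ' x j - θ x j) / (2 * Real.pi) = (θ' 0 j - θ 0 j) / (2 * Real.pi) :=
    isPreconnected_univ.eq_of_mem_range_intCast
      (f := fun x => (θ' x j - θ x j) / (2 * Real.pi))
      (by fun_prop) (fun x _ => ⟨_, (h₂ x).symm⟩) trivial trivial
  rw [h₂, h₂] at h₃
  rw [hm, h₃]

/-! ### Support functions -/

/-- Lifts of an admissible section that are only continuous are smooth and closed. -/
theorem IsRadius.isSupportFunction_iff (hr : IsRadius μ r) (hω : IsToricKahlerForm ω)
    (hμ : IsMomentMap ω μ) {L : AdmissibleSection F c ω μ C} {ν : F.Ray → ℤ} :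
    IsSupportFunction L ν ↔ ∃ θ, IsClosedAngle θ ∧ L.carrier = Set.range (polarSection r θ) ∧
      HasRayAngles C (fun α => (c α).arg) θ ν := by
  constructor
  · rintro ⟨θ, hθ, hL, hν⟩
    obtain ⟨θ₀, hθ₀, hL₀⟩ := (hr.isLagrangianSection_iff hω hμ).1 L.isSection
    have h₁ : polarSection r θ = polarSection r θ₀ := by
      funext x j
      have := hL (polarSection r θ₀ x) (hL₀ ▸ ⟨x, rfl⟩) j
      rw [hr.norm_polarSection, hr.apply_polarSection hμ] at this
      exact this.symm
    refine ⟨θ, hr.isClosedAngle_of_polarSection_eq hω hμ hθ₀ hθ h₁, by rw [hL₀, h₁], ?_⟩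
    choose K hK hKν using hν
    choose B hB using fun α => (hK α).exists_norm_bound
    obtain ⟨M, hM⟩ := (Set.finite_range B).bddAbove
    exact ⟨M, fun α x hx hxM => rayAngle_eq_iff.2
      (hKν α x hx (hB α x ((hM ⟨α, rfl⟩).trans hxM)))⟩
  · rintro ⟨θ, hθ, hL, A, hA⟩
    refine ⟨θ, hθ.smooth.continuous, ?_, fun α => ⟨Metric.closedBall 0 A,
      isCompact_closedBall 0 A, fun x hx hxA => rayAngle_eq_iff.1 (hA α x hx ?_)⟩⟩
    · rw [hL]
      rintro _ ⟨x, rfl⟩ j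
      rw [hr.norm_polarSection, hr.apply_polarSection hμ]
      rfl
    · simpa using (not_le.1 fun h => hxA (mem_closedBall_zero_iff.2 h)).le

theorem IsRadius.exists_hasRayAngles (hr : IsRadius μ r) (hμ : IsMomentMap ω μ)
    (hc : ∀ α, c α ≠ 0) (h : IsSeparatedDivision F C δ R) (hθ : IsClosedAngle θ)
    (hadm : ∀ α, ∃ K ⊆ torus n, IsCompact K ∧
      AdmissibleOutside μ (c α) α.1 (C α) K (Set.range (polarSection r θ))) :
    ∃ ν, HasRayAngles C (fun α => (c α).arg) θ ν := by
  choose K hKt hK hKadm using hadm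
  choose B hB using fun α =>
    hr.exists_norm_bound_of_admissibleOutside (C := C) hμ (hc α) (hK α) (hKt α)
  obtain ⟨M, hM⟩ := (Set.finite_range B).bddAbove
  choose ν A hA using (h.mono (le_max_left R M)).exists_rayAngle_eq hθ.smooth hθ.symm
    (fun α x hx hxM => hB α θ (hKadm α) x hx
      ((hM ⟨α, rfl⟩).trans ((le_max_right _ _).trans hxM)))
  obtain ⟨N, hN⟩ := (Set.finite_range A).bddAbove
  exact ⟨ν, N, fun α x hx hxN => hA α x hx ((hN ⟨α, rfl⟩).trans hxN)⟩

theorem IsRadius.exists_isSupportFunction (hr : IsRadius μ r) (hω : IsToricKahlerForm ω)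
    (hμ : IsMomentMap ω μ) (hc : ∀ α, c α ≠ 0) (h : IsSeparatedDivision F C δ R)
    (L : AdmissibleSection F c ω μ C) : ∃ ν, IsSupportFunction L ν := by
  obtain ⟨θ, hθ, hL⟩ := (hr.isLagrangianSection_iff hω hμ).1 L.isSection
  obtain ⟨ν, hν⟩ := hr.exists_hasRayAngles hμ hc h hθ (hL ▸ L.admissible)
  exact ⟨ν, (hr.isSupportFunction_iff hω hμ).2 ⟨θ, hθ, hL, hν⟩⟩

theorem IsRadius.isSupportFunction_iff_exists (hr : IsRadius μ r) (hω : IsToricKahlerForm ω)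
    (hμ : IsMomentMap ω μ) (h : IsSeparatedDivision F C δ R) {L : AdmissibleSection F c ω μ C}
    {ν ν' : F.Ray → ℤ} (hν : IsSupportFunction L ν) :
    IsSupportFunction L ν' ↔ ∃ m : Fin n → ℤ, ∀ α : F.Ray, ν' α = ν α + m ⬝ᵥ α.1 := by
  obtain ⟨θ, hθ, hL, hθν⟩ := (hr.isSupportFunction_iff hω hμ).1 hν
  constructor
  · intro hν'
    obtain ⟨θ', hθ', hL', hθν'⟩ := (hr.isSupportFunction_iff hω hμ).1 hν'
    obtain ⟨m, rfl⟩ := hr.exists_eq_add_two_pi_mul hθ.smooth.continuous hθ'.smooth.continuous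
      (hr.eq_of_range_polarSection_eq hμ (hL'.symm.trans hL))
    exact ⟨m, congrFun (hθν'.unique h (hθν.add_two_pi_mul m))⟩
  · rintro ⟨m, hm⟩
    obtain rfl : ν' = fun α => ν α + m ⬝ᵥ α.1 := funext hm
    have h₁ : polarSection r (fun x j => θ x j + 2 * Real.pi * m j) = polarSection r θ := by
      funext x j
      rw [polarSection, polarSection, exp_add_two_pi_mul_int]
    have h₂ : Continuous fun x (j : Fin n) => θ x j + 2 * Real.pi * m j :=
      continuous_pi fun j => ((continuous_apply j).comp hθ.smooth.continuous).add continuous_const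
    exact (hr.isSupportFunction_iff hω hμ).2 ⟨_, hr.isClosedAngle_of_polarSection_eq hω hμ hθ h₂ h₁,
      by rw [hL, h₁], hθν.add_two_pi_mul m⟩

theorem IsRadius.exists_admissibleSection (hr : IsRadius μ r) (hω : IsToricKahlerForm ω)
    (hμ : IsMomentMap ω μ) (hc : ∀ α, c α ≠ 0) (hθ : IsClosedAngle θ) {ν : F.Ray → ℤ}
    (hν : HasRayAngles C (fun α => (c α).arg) θ ν) :
    ∃ L : AdmissibleSection F c ω μ C, L.carrier = Set.range (polarSection r θ) ∧
      IsSupportFunction L ν := by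
  have hL := (hr.isLagrangianSection_iff hω hμ).2 ⟨θ, hθ, rfl⟩
  have hadm : ∀ α, ∃ K ⊆ torus n, IsCompact K ∧
      AdmissibleOutside μ (c α) α.1 (C α) K (Set.range (polarSection r θ)) := by
    obtain ⟨A, hA⟩ := hν
    intro α
    obtain ⟨K, hKt, hK, hKθ⟩ := hr.exists_isCompact_admissibleOutside (C := C) hμ (hc α) A
    exact ⟨K, hKt, hK, hKθ θ fun x hx hxA => ⟨ν α, (hA α x hx hxA).symm⟩⟩
  exact ⟨⟨_, hL, hadm⟩, rfl, (hr.isSupportFunction_iff hω hμ).2 ⟨θ, hθ, rfl, hν⟩⟩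

/-- Every function on the rays is the support function of some section: its angles are the
gradient of a function with prescribed slopes on the sets `C α`. -/
theorem IsRadius.exists_isSupportFunction_section (hr : IsRadius μ r) (hω : IsToricKahlerForm ω)
    (hμ : IsMomentMap ω μ) (hc : ∀ α, c α ≠ 0) (h : IsSeparatedDivision F C δ R)
    (ν : F.Ray → ℤ) : ∃ L : AdmissibleSection F c ω μ C, IsSupportFunction L ν := by
  obtain ⟨f, hf, A, hA⟩ := h.exists_contDiff_fderiv_eq
    fun α => 2 * Real.pi * ν α - (c α).arg
  obtain ⟨L, -, hL⟩ := hr.exists_admissibleSection hω hμ hc (isClosedAngle_gradCoord hf)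
    (ν := ν) (C := C) ⟨A, fun α x hx hxA => rayAngle_eq_iff.2 (by
      have h₁ := sum_mul_gradCoord f x (latticeVec α.1)
      simp only [latticeVec_apply] at h₁
      rw [h₁, hA α x hx hxA, sub_add_cancel])⟩
  exact ⟨L, hL⟩

end


/-! ### Hamiltonian isotopies -/

section

variable {n : ℕ} {F : SmoothCompleteFan n} {c : F.Ray → ℂ}
  {ω : (Fin n → ℂ) → (Fin n → ℂ) [⋀^Fin 2]→L[ℝ] ℝ}
  {μ : (Fin n → ℂ) → EuclideanSpace ℝ (Fin n)}
  {C : F.Ray → Set (EuclideanSpace ℝ (Fin n))}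
  {r θ θ' : EuclideanSpace ℝ (Fin n) → Fin n → ℝ} {a : F.Ray → ℝ} {δ R : ℝ}

/-- The angles of the sections in a Hamiltonian isotopy can be chosen to depend continuously on the
time, in the weak sense that, as `t` tends to `t₀`, the angles `Θ t (Y t)` at suitable points `Y t`
that tend to `y` tend to `Θ t₀ y`. -/
theorem IsHamiltonianFlow.exists_angles {H : ℝ → (Fin n → ℂ) → ℝ}
    {φ : ℝ → (Fin n → ℂ) → (Fin n → ℂ)} (hφ : IsHamiltonianFlow ω H φ) (hr : IsRadius μ r)
    (hω : IsToricKahlerForm ω) (hμ : IsMomentMap ω μ) (hθ : IsClosedAngle θ)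
    (hL : ∀ t ∈ Set.Icc (0 : ℝ) 1,
      IsLagrangianSection ω μ (φ t '' Set.range (polarSection r θ))) :
    ∃ Θ : ℝ → EuclideanSpace ℝ (Fin n) → Fin n → ℝ,
      (∀ t ∈ Set.Icc (0 : ℝ) 1, IsClosedAngle (Θ t) ∧
        φ t '' Set.range (polarSection r θ) = Set.range (polarSection r (Θ t))) ∧
      ∀ t₀ ∈ Set.Icc (0 : ℝ) 1, ∀ y, ∃ Y : ℝ → EuclideanSpace ℝ (Fin n),
        Filter.Tendsto Y (nhdsWithin t₀ (Set.Icc 0 1)) (nhds y) ∧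
        Filter.Tendsto (fun t => Θ t (Y t)) (nhdsWithin t₀ (Set.Icc 0 1)) (nhds (Θ t₀ y)) := by
  let I : Set ℝ := Set.Icc 0 1
  set s := polarSection r θ with hs
  have hst : ∀ x, s x ∈ torus n := fun x => hr.polarSection_mem x
  have hsc : Continuous s := (hr.contDiff_polarSection hθ.smooth).continuous
  let clamp : ℝ → ℝ := fun t => (Set.projIcc (0 : ℝ) 1 zero_le_one t : ℝ)
  have hclamp : Continuous clamp := continuous_subtype_val.comp continuous_projIcc
  have hclampI : ∀ t, clamp t ∈ I := fun t => (Set.projIcc (0 : ℝ) 1 zero_le_one t).2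
  have hclamp_eq : ∀ t ∈ I, clamp t = t := fun t ht =>
    congrArg Subtype.val (Set.projIcc_of_mem zero_le_one ht)
  let z : ℝ × EuclideanSpace ℝ (Fin n) → Fin n → ℂ := fun p => φ (clamp p.1) (s p.2)
  have hz : Continuous z := hφ.smooth.continuousOn.comp_continuous
    (f := fun p : ℝ × EuclideanSpace ℝ (Fin n) => (clamp p.1, s p.2)) (by fun_prop)
    fun p => ⟨hclampI _, hst _⟩
  have hzt : ∀ p, z p ∈ torus n := fun p => hφ.mapsTo _ (hclampI _) (hst _)
  have hzI : ∀ t ∈ I, ∀ x, z (t, x) = φ t (s x) := fun t ht x => by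
    simp only [z, hclamp_eq t ht]
  choose A hAc hA using fun j =>
    exists_continuous_arg ((continuous_apply j).comp hz) fun p => hzt p j
  obtain ⟨ψ, hψ, hψφ⟩ := hφ.inverse
  have hσ : ∀ t : ℝ, ∃ σ : EuclideanSpace ℝ (Fin n) → Fin n → ℂ, t ∈ I →
      Continuous σ ∧ (∀ x, σ x ∈ torus n ∧ μ (σ x) = x) ∧ φ t '' Set.range s = Set.range σ := by
    intro t
    by_cases ht : t ∈ I
    · obtain ⟨σ, hσ, hσμ, hσr, -⟩ := hL t ht
      exact ⟨σ, fun _ => ⟨hσ.continuous, hσμ, hσr⟩⟩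
    · exact ⟨s, fun h => absurd h ht⟩
  choose σ hσ using hσ
  -- The time `t` section passes over `y` at the point `φ t (s (g t y))`.
  let g : ℝ → EuclideanSpace ℝ (Fin n) → EuclideanSpace ℝ (Fin n) := fun t y => μ (ψ t (σ t y))
  have hgc : ∀ t ∈ I, Continuous (g t) := by
    intro t ht
    have h₁ : ∀ y, ψ t (σ t y) ∈ torus n := fun y => (hψφ t ht).1 ((hσ t ht).2.1 y).1
    have h₂ : Continuous fun y => ψ t (σ t y) := hψ.continuousOn.comp_continuous
      (f := fun y => (t, σ t y)) (continuous_const.prodMk (hσ t ht).1)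
      fun y => ⟨ht, ((hσ t ht).2.1 y).1⟩
    exact hμ.smooth.continuousOn.comp_continuous h₂ h₁
  have hgφ : ∀ t ∈ I, ∀ x, g t (μ (z (t, x))) = x ∧ σ t (μ (z (t, x))) = z (t, x) := by
    intro t ht x
    obtain ⟨y, hy⟩ := (hσ t ht).2.2.le ⟨s x, ⟨x, rfl⟩, rfl⟩
    have h₁ : μ (z (t, x)) = y := by rw [hzI t ht, ← hy, ((hσ t ht).2.1 y).2]
    refine ⟨?_, by rw [h₁, hy, hzI t ht]⟩
    simp only [g]
    rw [h₁, hy, (hψφ t ht).2.1 (hst x), hr.apply_polarSection hμ]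
  have hgz : ∀ t ∈ I, ∀ y, z (t, g t y) = σ t y := by
    intro t ht y
    obtain ⟨_, ⟨x, rfl⟩, hx⟩ := (hσ t ht).2.2.ge ⟨y, rfl⟩
    have h₁ := (hgφ t ht x).1
    rw [hzI t ht, hx, ((hσ t ht).2.1 y).2] at h₁
    rw [h₁, hzI t ht, hx]
  have hΘ : ∀ t ∈ I, polarSection r (fun y j => A j (t, g t y)) = σ t := by
    intro t ht
    funext y j
    have h₁ := hA j (t, g t y)
    simp only [Function.comp_apply, hgz t ht] at h₁
    rw [h₁, hr.norm_eq _ ((hσ t ht).2.1 y).1, ((hσ t ht).2.1 y).2]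
    rfl
  refine ⟨fun t y j => A j (t, g t y), fun t ht => ?_, fun t₀ ht₀ y => ?_⟩
  · have h₁ : φ t '' Set.range s = Set.range (polarSection r fun y j => A j (t, g t y)) := by
      rw [hΘ t ht, (hσ t ht).2.2]
    refine ⟨?_, h₁⟩
    obtain ⟨θ', hθ', hr'⟩ := (hr.isLagrangianSection_iff hω hμ).1 (hL t ht)
    refine hr.isClosedAngle_of_polarSection_eq hω hμ hθ' (continuous_pi fun j => ?_)
      (hr.eq_of_range_polarSection_eq hμ (h₁.symm.trans hr'))
    exact (hAc j).comp (continuous_const.prodMk (hgc t ht))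
  · have hlim : ∀ {Z : Type} [TopologicalSpace Z] (f : ℝ → Z), Continuous f →
        Filter.Tendsto f (nhdsWithin t₀ I) (nhds (f t₀)) :=
      fun f hf => hf.continuousAt.mono_left nhdsWithin_le_nhds
    refine ⟨fun t => μ (z (t, g t₀ y)), ?_, ?_⟩
    · have h₁ : Continuous fun t : ℝ => μ (z (t, g t₀ y)) :=
        hμ.smooth.continuousOn.comp_continuous (hz.comp (by fun_prop)) fun t => hzt _
      have h₂ := hlim _ h₁
      simp only [hgz t₀ ht₀, ((hσ t₀ ht₀).2.1 y).2] at h₂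
      exact h₂
    · have h₁ : Continuous fun t : ℝ => fun j => A j (t, g t₀ y) :=
        continuous_pi fun j => (hAc j).comp (by fun_prop)
      refine (hlim _ h₁).congr' ?_
      filter_upwards [self_mem_nhdsWithin] with t ht
      rw [(hgφ t ht _).1]

/-- The support function does not change in a Hamiltonian isotopy: its value at `α` is the angle
of `c_α z^α` over a single far point `y` of the ray of `α`, and this angle is integral over a
neighbourhood of `y` at all times. -/
theorem HamiltonianIsotopic.exists_isSupportFunction (hr : IsRadius μ r)
    (hω : IsToricKahlerForm ω) (hμ : IsMomentMap ω μ) (hc : ∀ α, c α ≠ 0)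
    (h : IsSeparatedDivision F C δ R) {L L' : AdmissibleSection F c ω μ C}
    (hLL' : HamiltonianIsotopic L L') :
    ∃ ν, IsSupportFunction L ν ∧ IsSupportFunction L' ν := by
  obtain ⟨H, φ, hφ, hlag, hadm, hφ₁⟩ := hLL'
  obtain ⟨θ, hθ, hL⟩ := (hr.isLagrangianSection_iff hω hμ).1 L.isSection
  have hφ₀ : φ 0 '' L.carrier = L.carrier := by
    rw [hL]
    refine (Set.image_congr fun z hz => ?_).trans (Set.image_id _)
    obtain ⟨x, rfl⟩ := hz
    exact hφ.zero _ (hr.polarSection_mem x)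
  obtain ⟨Θ, hΘ, hlim⟩ := hφ.exists_angles hr hω hμ hθ (by rwa [← hL])
  rw [← hL] at hΘ
  have h0 : (0 : ℝ) ∈ Set.Icc (0 : ℝ) 1 := ⟨le_rfl, zero_le_one⟩
  have h1 : (1 : ℝ) ∈ Set.Icc (0 : ℝ) 1 := ⟨zero_le_one, le_rfl⟩
  have hadm' : ∀ t ∈ Set.Icc (0 : ℝ) 1, ∀ α, ∃ K ⊆ torus n, IsCompact K ∧
      AdmissibleOutside μ (c α) α.1 (C α) K (Set.range (polarSection r (Θ t))) := by
    intro t ht α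
    obtain ⟨K, hKt, hK, hKα⟩ := hadm α
    exact ⟨K, hKt, hK, (hΘ t ht).2 ▸ hKα t ht⟩
  obtain ⟨ν₀, hν₀⟩ := hr.exists_hasRayAngles hμ hc h (hΘ 0 h0).1 (hadm' 0 h0)
  obtain ⟨ν₁, hν₁⟩ := hr.exists_hasRayAngles hμ hc h (hΘ 1 h1).1 (hadm' 1 h1)
  refine ⟨ν₀, (hr.isSupportFunction_iff hω hμ).2
    ⟨Θ 0, (hΘ 0 h0).1, by rw [← (hΘ 0 h0).2, hφ₀], hν₀⟩, (hr.isSupportFunction_iff hω hμ).2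
    ⟨Θ 1, (hΘ 1 h1).1, by rw [← (hΘ 1 h1).2, hφ₁], ?_⟩⟩
  suffices ν₀ = ν₁ by rwa [this]
  funext α
  obtain ⟨K, hKt, hK, hKα⟩ := hadm α
  obtain ⟨A, hA⟩ := hr.exists_norm_bound_of_admissibleOutside (C := C) hμ (hc α) hK hKt
  obtain ⟨A₀, hA₀⟩ := hν₀
  obtain ⟨A₁, hA₁⟩ := hν₁
  obtain ⟨τ, hτ, hτR⟩ :=
    IsSeparatedDivision.exists_far_ray α (max (max R A) (max A₀ A₁))
  simp only [max_lt_iff] at hτR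
  obtain ⟨⟨hR, hyA⟩, hyA₀, hyA₁⟩ := hτR
  have hyC := h.mem_nhds_ray α hτ hR
  set y := τ • latticeVec α.1
  let N : ℝ → EuclideanSpace ℝ (Fin n) → ℝ := fun t => rayAngle (Θ t) (fun α => (c α).arg) α
  have hNint : ∀ t ∈ Set.Icc (0 : ℝ) 1, ∀ x ∈ C α, A ≤ ‖x‖ →
      N t x ∈ Set.range ((↑) : ℤ → ℝ) := fun t ht =>
    hA (Θ t) ((hΘ t ht).2 ▸ hKα t ht)
  have hyn : {x : EuclideanSpace ℝ (Fin n) | A < ‖x‖} ∈ nhds y :=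
    (isOpen_lt continuous_const continuous_norm).mem_nhds hyA
  obtain ⟨ε, hε, hball⟩ := Metric.mem_nhds_iff.1 (Filter.inter_mem hyC hyn)
  have hNball : ∀ t ∈ Set.Icc (0 : ℝ) 1, ∀ x ∈ Metric.ball y ε, N t x = N t y := by
    intro t ht x hx
    exact (convex_ball y ε).isPreconnected.eq_of_mem_range_intCast
      (contDiff_rayAngle (hΘ t ht).1.smooth α).continuous.continuousOn
      (fun q hq => hNint t ht q (hball hq).1 (hball hq).2.le) hx (Metric.mem_ball_self hε)
  have hcont : ContinuousOn (fun t => N t y) (Set.Icc 0 1) := by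
    intro t₀ ht₀
    obtain ⟨Y, hY, hΘY⟩ := hlim t₀ ht₀ y
    have h₁ : Filter.Tendsto (fun t => N t (Y t)) (nhdsWithin t₀ (Set.Icc 0 1))
        (nhds (N t₀ y)) := by
      have h₂ : Continuous fun w : Fin n → ℝ =>
          (∑ j, (α.1 j : ℝ) * w j + (c α).arg) / (2 * Real.pi) := by fun_prop
      exact (h₂.tendsto _).comp hΘY
    refine h₁.congr' ?_
    filter_upwards [self_mem_nhdsWithin, hY (Metric.ball_mem_nhds y hε)] with t ht hYt
      using hNball t ht _ hYt
  have h₁ : N 0 y = N 1 y := isPreconnected_Icc.eq_of_mem_range_intCast hcont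
    (fun t ht => hNint t ht y (mem_of_mem_nhds hyC) hyA.le) h0 h1
  have h₂ : N 0 y = ν₀ α := hA₀ α y (mem_of_mem_nhds hyC) hyA₀.le
  have h₃ : N 1 y = ν₁ α := hA₁ α y (mem_of_mem_nhds hyC) hyA₁.le
  exact_mod_cast h₂.symm.trans (h₁.trans h₃)

theorem IsRadius.image_fibreRotation (hr : IsRadius μ r) (hμ : IsMomentMap ω μ)
    (g : EuclideanSpace ℝ (Fin n) → Fin n → ℝ) (t : ℝ) :
    fibreRotation μ g t '' Set.range (polarSection r θ)
      = Set.range (polarSection r fun x => θ x + t • g x) := by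
  rw [← Set.range_comp]
  exact congrArg Set.range (funext fun x => hr.fibreRotation_polarSection hμ t x)

theorem IsClosedAngle.add_smul (hθ : IsClosedAngle θ) (hθ' : IsClosedAngle θ') (t : ℝ) :
    IsClosedAngle fun x => θ x + t • θ' x := by
  refine ⟨hθ.smooth.add (hθ'.smooth.const_smul t), fun x v w => ?_⟩
  have h₁ : HasFDerivAt (fun x => θ x + t • θ' x) (fderiv ℝ θ x + t • fderiv ℝ θ' x) x :=
    (hθ.smooth.differentiable (by simp) x).hasFDerivAt.add
      ((hθ'.smooth.differentiable (by simp) x).hasFDerivAt.const_smul t)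
  have h₂ : ∀ v w : EuclideanSpace ℝ (Fin n),
      ∑ j, v j * (fderiv ℝ θ x + t • fderiv ℝ θ' x) w j
        = ∑ j, v j * fderiv ℝ θ x w j + t * ∑ j, v j * fderiv ℝ θ' x w j := by
    intro v w
    simp only [add_apply, smul_apply, Pi.add_apply, Pi.smul_apply, smul_eq_mul, mul_add,
      Finset.sum_add_distrib, Finset.mul_sum, mul_left_comm t]
  rw [h₁.fderiv, h₂, h₂, hθ.symm, hθ'.symm]

/-- Sections with the same support function are Hamiltonian isotopic: the angles are
interpolated linearly by the flow of a function of the moment map. -/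
theorem IsRadius.hamiltonianIsotopic (hr : IsRadius μ r) (hω : IsToricKahlerForm ω)
    (hμ : IsMomentMap ω μ) (hc : ∀ α, c α ≠ 0) {L L' : AdmissibleSection F c ω μ C}
    {ν : F.Ray → ℤ} (hL : IsSupportFunction L ν) (hL' : IsSupportFunction L' ν) :
    HamiltonianIsotopic L L' := by
  obtain ⟨θ, hθ, hLθ, A, hA⟩ := (hr.isSupportFunction_iff hω hμ).1 hL
  obtain ⟨θ', hθ', hLθ', A', hA'⟩ := (hr.isSupportFunction_iff hω hμ).1 hL'
  obtain ⟨h, hh, hgrad⟩ := (hθ'.add_smul hθ (-1)).exists_gradCoord_eq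
  have himg : ∀ t, fibreRotation μ (gradCoord h) t '' L.carrier
      = Set.range (polarSection r fun x => θ x + t • gradCoord h x) := fun t => by
    rw [hLθ, hr.image_fibreRotation hμ]
  refine ⟨_, _, hμ.isHamiltonianFlow_fibreRotation hh, fun t _ => ?_, fun α => ?_, ?_⟩
  · rw [himg]
    exact (hr.isLagrangianSection_iff hω hμ).2
      ⟨_, hθ.add_smul (isClosedAngle_gradCoord hh) t, rfl⟩
  · obtain ⟨K, hKt, hK, hKα⟩ :=
      hr.exists_isCompact_admissibleOutside (C := C) hμ (hc α) (max A A')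
    refine ⟨K, hKt, hK, fun t _ => ?_⟩
    rw [himg]
    refine hKα _ fun x hx hxA => ⟨ν α, ?_⟩
    have h₁ : rayAngle θ' (fun α => (c α).arg) α x
        = rayAngle (fun x => θ x + (1 : ℝ) • gradCoord h x) (fun α => (c α).arg) α x := by
      congr 1
      funext x
      simp only [hgrad]
      simp
    rw [hA' α x hx ((le_max_right _ _).trans hxA), rayAngle_add_gradCoord,
      hA α x hx ((le_max_left _ _).trans hxA), one_mul, left_eq_add] at h₁
    rw [rayAngle_add_gradCoord, hA α x hx ((le_max_left _ _).trans hxA), mul_div_assoc, h₁,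
      mul_zero, add_zero]
  · rw [himg, hLθ']
    congr 2
    funext x
    simp [hgrad]

/-- Time `1` maps of twisting Hamiltonians change the support function by the divisor. -/
theorem IsTwisting.exists_image (hr : IsRadius μ r) (hω : IsToricKahlerForm ω)
    (hμ : IsMomentMap ω μ) (hc : ∀ α, c α ≠ 0) {D : F.ToricDivisor}
    {h : EuclideanSpace ℝ (Fin n) → ℝ} (hD : IsTwisting C D h)
    {φ : ℝ → (Fin n → ℂ) → (Fin n → ℂ)} (hφ : IsHamiltonianFlow ω (fun _ z => h (μ z)) φ)
    {L : AdmissibleSection F c ω μ C} {ν : F.Ray → ℤ} (hL : IsSupportFunction L ν) :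
    ∃ L' : AdmissibleSection F c ω μ C, L'.carrier = φ 1 '' L.carrier ∧
      IsSupportFunction L' (ν - D) := by
  obtain ⟨θ, hθ, hLθ, hν⟩ := (hr.isSupportFunction_iff hω hμ).1 hL
  obtain ⟨L', hL', hνL'⟩ := hr.exists_admissibleSection hω hμ hc
    (hθ.add_smul (isClosedAngle_gradCoord hD.1) 1) (hD.hasRayAngles hν)
  refine ⟨L', ?_, hνL'⟩
  rw [hL', hLθ, ← hr.image_fibreRotation hμ]
  refine Set.image_congr fun z hz => ?_
  obtain ⟨x, rfl⟩ := hz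
  exact (hφ.eq_fibreRotation hω hμ hD.1 (hr.polarSection_mem x) ⟨zero_le_one, le_rfl⟩).symm

end


/-! ### Isotopy classes, the Picard group and twisting Hamiltonians -/

namespace SmoothCompleteFan

variable {n : ℕ} (F : SmoothCompleteFan n)

/-- Toric divisors act on the Picard group, `D` by the product with the class of `O(D)`. -/
def picTranslation : Multiplicative F.ToricDivisor →* Equiv.Perm F.Pic where
  toFun D :=
    { toFun := fun x => x * F.classO D.toAdd
      invFun := fun x => x * F.classO (-D.toAdd)
      left_inv := fun x => by
        obtain ⟨E, rfl⟩ := F.classO_surjective x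
        change F.classO E * F.classO D.toAdd * F.classO (-D.toAdd) = F.classO E
        rw [← classO_add, ← classO_add, add_neg_cancel_right]
      right_inv := fun x => by
        obtain ⟨E, rfl⟩ := F.classO_surjective x
        change F.classO E * F.classO (-D.toAdd) * F.classO D.toAdd = F.classO E
        rw [← classO_add, ← classO_add, neg_add_cancel_right] }
  map_one' := Equiv.ext fun x => by
    obtain ⟨E, rfl⟩ := F.classO_surjective x
    change F.classO E * F.classO 0 = F.classO E
    rw [← classO_add, add_zero]
  map_mul' D D' := Equiv.ext fun x => by
    obtain ⟨E, rfl⟩ := F.classO_surjective x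
    change F.classO E * F.classO (D.toAdd + D'.toAdd)
      = F.classO E * F.classO D'.toAdd * F.classO D.toAdd
    rw [← classO_add, ← classO_add, ← classO_add, add_assoc, add_comm D'.toAdd]

end SmoothCompleteFan

section

variable {n : ℕ} {F : SmoothCompleteFan n} {c : F.Ray → ℂ}
  {ω : (Fin n → ℂ) → (Fin n → ℂ) [⋀^Fin 2]→L[ℝ] ℝ}
  {μ : (Fin n → ℂ) → EuclideanSpace ℝ (Fin n)}
  {C : F.Ray → Set (EuclideanSpace ℝ (Fin n))}
  {r : EuclideanSpace ℝ (Fin n) → Fin n → ℝ} {δ R : ℝ}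

theorem IsTwisting.unique (h : IsSeparatedDivision F C δ R) {D D' : F.ToricDivisor}
    {f : EuclideanSpace ℝ (Fin n) → ℝ} (hD : IsTwisting C D f) (hD' : IsTwisting C D' f) :
    D = D' := by
  funext α
  obtain ⟨K, hK, hKD⟩ := hD.2 α
  obtain ⟨K', hK', hKD'⟩ := hD'.2 α
  obtain ⟨A, hA⟩ := hK.exists_norm_bound
  obtain ⟨A', hA'⟩ := hK'.exists_norm_bound
  have h₁ := h.eq_of_eventually_eq (fun x hx hxA => hKD x hx (hA x hxA))
    (fun x hx hxA => hKD' x hx (hA' x hxA))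
  have h₂ : (D α : ℝ) = D' α := mul_left_cancel₀ Real.two_pi_pos.ne' (neg_injective h₁)
  exact_mod_cast h₂

theorem IsTwisting.add {D D' : F.ToricDivisor} {f f' : EuclideanSpace ℝ (Fin n) → ℝ}
    (hD : IsTwisting C D f) (hD' : IsTwisting C D' f') : IsTwisting C (D + D') (f + f') := by
  refine ⟨hD.1.add hD'.1, fun α => ?_⟩
  obtain ⟨K, hK, hx⟩ := hD.2 α
  obtain ⟨K', hK', hx'⟩ := hD'.2 α
  refine ⟨K ∪ K', hK.union hK', fun x hxC hxK => ?_⟩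
  rw [Set.mem_union, not_or] at hxK
  rw [fderiv_add (hD.1.differentiable (by simp) x) (hD'.1.differentiable (by simp) x),
    add_apply, hx x hxC hxK.1, hx' x hxC hxK.2, Pi.add_apply]
  push_cast
  ring

/-- The divisor of a twisting Hamiltonian is determined by it, and additive. -/
theorem IsSeparatedDivision.exists_divisorHom (h : IsSeparatedDivision F C δ R) :
    ∃ d : twistingGroup C →+ F.ToricDivisor, ∀ f : twistingGroup C, IsTwisting C (d f) f.1 := by
  choose d hd using fun f : twistingGroup C => f.2
  exact ⟨AddMonoidHom.mk' d fun f f' => (hd (f + f')).unique h ((hd f).add (hd f')), hd⟩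

/-- Isotopic sections are those with the same support function modulo characters, hence those with
the same line bundle. -/
theorem IsRadius.hamiltonianIsotopic_iff (hr : IsRadius μ r) (hω : IsToricKahlerForm ω)
    (hμ : IsMomentMap ω μ) (hc : ∀ α, c α ≠ 0) (h : IsSeparatedDivision F C δ R)
    {L L' : AdmissibleSection F c ω μ C} {ν ν' : F.Ray → ℤ} (hν : IsSupportFunction L ν)
    (hν' : IsSupportFunction L' ν') :
    HamiltonianIsotopic L L' ↔ F.classO (-ν) = F.classO (-ν') := by
  rw [eq_comm, F.classO_eq_iff]
  constructor
  · intro hLL'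
    obtain ⟨κ, hκ, hκ'⟩ := hLL'.exists_isSupportFunction hr hω hμ hc h
    obtain ⟨m, hm⟩ := (hr.isSupportFunction_iff_exists hω hμ h hκ).1 hν
    obtain ⟨m', hm'⟩ := (hr.isSupportFunction_iff_exists hω hμ h hκ').1 hν'
    refine ⟨m' - m, fun α => ?_⟩
    rw [Pi.neg_apply, Pi.neg_apply, hm, hm', sub_dotProduct]
    ring
  · rintro ⟨m, hm⟩
    refine hr.hamiltonianIsotopic hω hμ hc hν
      ((hr.isSupportFunction_iff_exists hω hμ h hν').2 ⟨-m, fun α => ?_⟩)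
    have := hm α
    rw [Pi.neg_apply, Pi.neg_apply] at this
    rw [neg_dotProduct]
    linarith

end

end

theorem mainTheorem6 {n : ℕ} (F : SmoothCompleteFan n)
    (ω : (Fin n → ℂ) → (Fin n → ℂ) [⋀^Fin 2]→L[ℝ] ℝ) (hω : IsToricKahlerForm ω)
    (μ : (Fin n → ℂ) → EuclideanSpace ℝ (Fin n)) (hμ : IsMomentMap ω μ)
    (hμ_onto : Set.SurjOn μ (torus n) Set.univ)
    (c : F.Ray → ℂ) (hc : ∀ α, c α ≠ 0)
    (C : F.Ray → Set (EuclideanSpace ℝ (Fin n)))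
    (hC : IsMonomialDivision F c μ C) (hC_adapted : IsAdapted F μ C)
    (hC_comb : IsEventuallyCombinatorial F C) :
    Equivalence (HamiltonianIsotopic (F := F) (c := c) (ω := ω) (μ := μ) (C := C)) ∧
    (∀ L : AdmissibleSection F c ω μ C, ∃ ν, IsSupportFunction L ν) ∧
    (∀ (L : AdmissibleSection F c ω μ C) (ν ν' : F.Ray → ℤ), IsSupportFunction L ν →
      (IsSupportFunction L ν' ↔ ∃ m : Fin n → ℤ, ∀ α : F.Ray, ν' α = ν α + m ⬝ᵥ α.1)) ∧
    ∃ Φ : IsotopyClass F c ω μ C ≃ F.Pic,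
      (∀ (L : AdmissibleSection F c ω μ C) (ν : F.Ray → ℤ), IsSupportFunction L ν →
        Φ (Quot.mk _ L) = F.classO (-ν)) ∧
      ∃ act : Multiplicative (twistingGroup C) →* Equiv.Perm (IsotopyClass F c ω μ C),
        (∀ h : twistingGroup C,
          ∃ φ, IsHamiltonianFlow ω (fun _ z => h.1 (μ z)) φ) ∧
        (∀ (h : twistingGroup C) (φ : ℝ → (Fin n → ℂ) → (Fin n → ℂ)),
          IsHamiltonianFlow ω (fun _ z => h.1 (μ z)) φ →
          ∀ L : AdmissibleSection F c ω μ C, ∃ L' : AdmissibleSection F c ω μ C,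
            L'.carrier = φ 1 '' L.carrier ∧
            act (Multiplicative.ofAdd h) (Quot.mk _ L) = Quot.mk _ L') ∧
        (∀ (D : F.ToricDivisor) (h : twistingGroup C), IsTwisting C D h.1 →
          ∀ x : IsotopyClass F c ω μ C,
            Φ (act (Multiplicative.ofAdd h) x) = Φ x * F.classO D) := by
  obtain ⟨r, hr⟩ := hμ.exists_radius hω hμ_onto
  obtain ⟨δ, R, hsep⟩ := hC_comb.exists_isSeparatedDivision hC.closed hC.cover
  have hex := hr.exists_isSupportFunction hω hμ hc hsep
  choose ν hν using hex
  have hiff : ∀ L L' : AdmissibleSection F c ω μ C,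
      HamiltonianIsotopic L L' ↔ F.classO (-ν L) = F.classO (-ν L') := fun L L' =>
    hr.hamiltonianIsotopic_iff hω hμ hc hsep (hν L) (hν L')
  -- Support functions of the same section have the same class, as the constant isotopy shows.
  have hclass : ∀ (L : AdmissibleSection F c ω μ C) (κ : F.Ray → ℤ), IsSupportFunction L κ →
      F.classO (-ν L) = F.classO (-κ) := fun L κ hκ =>
    (hr.hamiltonianIsotopic_iff hω hμ hc hsep (hν L) hκ).1 ((hiff L L).2 rfl)
  let f : IsotopyClass F c ω μ C → F.Pic :=
    Quot.lift (fun L => F.classO (-ν L)) fun L L' hLL' => (hiff L L').1 hLL'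
  have hf : Function.Bijective f := by
    constructor
    · rintro ⟨L⟩ ⟨L'⟩ hLL'
      exact Quot.sound ((hiff L L').2 hLL')
    · intro x
      obtain ⟨D, rfl⟩ := F.classO_surjective x
      obtain ⟨L, hL⟩ := hr.exists_isSupportFunction_section hω hμ hc hsep (-D)
      exact ⟨Quot.mk _ L, (hclass L _ hL).trans (by rw [neg_neg])⟩
  obtain ⟨d, hd⟩ := hsep.exists_divisorHom
  let Φ := Equiv.ofBijective f hf
  have hΦ : ∀ (L : AdmissibleSection F c ω μ C) (κ : F.Ray → ℤ), IsSupportFunction L κ →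
      Φ (Quot.mk _ L) = F.classO (-κ) := hclass
  let act : Multiplicative (twistingGroup C) →* Equiv.Perm (IsotopyClass F c ω μ C) :=
    (Φ.symm.permCongrHom.toMonoidHom.comp F.picTranslation).comp (AddMonoidHom.toMultiplicative d)
  have hact : ∀ h x, Φ (act (Multiplicative.ofAdd h) x) = Φ x * F.classO (d h) := by
    intro h x
    exact Φ.apply_symm_apply _
  refine ⟨⟨fun L => (hiff L L).2 rfl, fun {L L'} h => (hiff L' L).2 ((hiff L L').1 h).symm,
    fun {L L' L''} h h' => (hiff L L'').2 (((hiff L L').1 h).trans ((hiff L' L'').1 h'))⟩,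
    fun L => ⟨ν L, hν L⟩, fun L κ κ' hκ => hr.isSupportFunction_iff_exists hω hμ hsep hκ,
    Φ, hΦ, act, fun h => ⟨_, hμ.isHamiltonianFlow_fibreRotation (hd h).1⟩, ?_, ?_⟩
  · intro h φ hφ L
    obtain ⟨L', hL', hνL'⟩ := (hd h).exists_image hr hω hμ hc hφ (hν L)
    refine ⟨L', hL', Φ.injective ?_⟩
    have h₁ : F.classO (-ν L) * F.classO (d h) = F.classO (-(ν L - d h)) := by
      rw [← F.classO_add, neg_sub, neg_add_eq_sub]
    exact (hact h (Quot.mk _ L)).trans (h₁.trans (hΦ L' _ hνL').symm)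
  · intro D h hD x
    rw [hact, (hd h).unique hsep hD]
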